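/- **Setting.** Let $d\ge 3$, let $\mathbb S^{d-1}$ be the unit sphere of $\mathbb R^d$, let $D_{\mathcal X}$ be the uniform distribution on it, and write $\theta(v,w)=\arccos(v\cdot w)$ for unit vectors $v,w$. A labeling oracle $\mathcal O$ is a conditional law $D_{Y\mid X}$ of a label $Y\in\{+1,-1\}$ given $X\in\mathbb S^{d-1}$. It satisfies the $\eta$-bounded noise condition with respect to $u\in\mathbb S^{d-1}$ if $\mathbb P[Y\ne \operatorname{sign}(u\cdot x)\mid X=x]\le\eta$ for ($D_{\mathcal X}$-almost) every $x$. **Algorithm.** MODIFIED-PERCEPTRON, with initial unit vector $w_0$, number of iterations $m$ and band width $b$, does the following for $t=0,1,\dots,m-1$: it draws unlabeled examples independently from $D_{\mathcal X}$ until it obtains an $x_t$ with $\frac b2\le w_t\cdot x_t\le b$, queries $\mathcal O$ for the label $y_t$ of $x_t$, and sets $$w_{t+1}=w_t-2\,\mathbf 1\{y_t\,(w_t\cdot x_t)<0\}\,(w_t\cdot x_t)\,x_t .$$ It returns $w_m$. Its running time is the number of steps on a real RAM: arithmetic operations and comparisons on real numbers and counters, accesses to array entries and label queries cost one unit each, and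 receiving an unlabeled example costs $d$ units. **Claim.** There is a universal constant $C>0$ such that the following holds for all $d\ge3$, $\eta\in[0,\frac12)$, $\delta\in(0,1)$, $\theta\in(0,\frac\pi2]$, all $u,w_0\in\mathbb S^{d-1}$ with $\theta(w_0,u)\le\theta$, and every oracle $\mathcal O$ that satisfies the $\eta$-bounded noise condition with respect to $u$. Put $$A=\frac{(3200\pi)^3d}{(1-2\eta)^2},\qquad m=\Big\lceil A\Big(\ln A+\ln\frac1\delta\Big)\Big\rceil,\qquad b=\frac{1}{2(600\pi)^2\ln\frac{m^2}{\delta}}\cdot\frac{\theta(1-2\eta)}{\sqrt d},\qquad \Lambda=\ln\frac{d}{(1-2\eta)^2}+\ln\frac1\delta .$$ Then $m=\Theta\big(\frac{d}{(1-2\eta)^2}\Lambda\big)$ and $b=\Theta\big(\frac{\theta(1-2\eta)}{\sqrt d\,\ln(m/\delta)}\big)$, each within a factor $C$ on both sides. With probability at least $1-\delta$, MODIFIED-PERCEPTRON with inputs $w_0,m,b$ halts, and simultaneously 1. its output $w_m$ is a unit vector with $\theta(w_m,u)\le\frac\theta2$; 2. the number of label queries is at most $C\,\frac{d}{(1-2\eta)^2}\,\Lambda$;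 3. the number of unlabeled examples drawn is at most $C\,\frac{d}{(1-2\eta)^3}\,\Lambda^2\cdot\frac1\theta$; 4. the running time is at most $C\,\frac{d^2}{(1-2\eta)^3}\,\Lambda^2\cdot\frac1\theta$. -/

import Mathlib

open MeasureTheory ProbabilityTheory

noncomputable section

namespace HalfspaceLearning

/-! ## Data model -/

/-- The instance space: the unit sphere of `ℝ^d` with the Euclidean norm. -/
abbrev Sph (d : ℕ) : Type := Metric.sphere (0 : EuclideanSpace ℝ (Fin d)) 1

/-- The label space `{+1, -1}`: `true` stands for `+1` and `false` for `-1`. -/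
abbrev Label : Type := Bool

/-- The real number `+1` or `-1` that a label stands for. -/
def Label.toReal (y : Label) : ℝ := if y then 1 else -1

/-- The uniform distribution on the unit sphere: the normalized surface measure. -/
def uniformSphere (d : ℕ) : Measure (Sph d) :=
  (volume : Measure (EuclideanSpace ℝ (Fin d))).toSphere[|Set.univ]

/-- The label that the homogeneous halfspace with normal vector `u` gives to `x`
(with the convention `sign 0 = +1`; the boundary of the halfspace is a null set). -/
def halfspaceLabel {d : ℕ} (u x : Sph d) : Label :=
  decide (0 ≤ inner ℝ (u : EuclideanSpace ℝ (Fin d)) (x : EuclideanSpace ℝ (Fin d)))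

/-- A labeling oracle, given by the conditional law of the label given the instance, satisfies
the `η`-bounded noise condition with respect to `u`. The conditional law matters only up to null
sets, so the bound is required for almost every instance. -/
def BoundedNoise {d : ℕ} (O : Kernel (Sph d) Label) (u : Sph d) (η : ℝ) : Prop :=
  ∀ᵐ x ∂(uniformSphere d), O x {y | y ≠ halfspaceLabel u x} ≤ ENNReal.ofReal η

/-- The distribution `D` of a labeled example `(x, y)`: `x` is uniform on the sphere and, given
`x`, the label `y` is drawn from the oracle. -/
def dataLaw {d : ℕ} (O : Kernel (Sph d) Label) : Measure (Sph d × Label) :=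
  (uniformSphere d) ⊗ₘ O

/-! ## Machine model: a real RAM with access to unlabeled examples and to a labeling oracle

Every elementary operation on real numbers or counters, every access to an entry of an array and
every label query takes one unit of time; receiving an unlabeled example takes `d` units, one per
coordinate.

The environment is a sequence of labeled examples. An unlabeled draw reveals the instance of the
next example only, and its label is revealed only when it is queried. If the sequence is i.i.d.
with law `dataLaw O`, the instances are i.i.d. uniform draws, and a query for the label of a drawn
instance `x` returns a label with law `O x`. -/

/-- The resources used so far. -/
structure Ledger where
  /-- elementary steps -/
  time : ℕ
  /-- unlabeled examples drawn -/
  draws : ℕ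
  /-- label queries -/
  labels : ℕ

/-- Programs: they read the environment through `draw` and `query` and keep a ledger. -/
abbrev RAM (d : ℕ) (α : Type) : Type := ReaderT (ℕ → Sph d × Label) (StateM Ledger) α

namespace RAM

variable {d : ℕ}

/-- Spend one unit of time. -/
def tick : RAM d Unit := fun _ L => ((), { L with time := L.time + 1 })

/-- Draw the next unlabeled example. The result is its number, by which its label can be queried
later, and the array of its coordinates. -/
def draw : RAM d (ℕ × (Fin d → ℝ)) := fun ω L =>
  ((L.draws, fun i => ((ω L.draws).1 : EuclideanSpace ℝ (Fin d)) i),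
    { L with time := L.time + d, draws := L.draws + 1 })

/-- Query the oracle for the label of the example number `k`. -/
def query (k : ℕ) : RAM d ℝ := fun ω L =>
  (Label.toReal (ω k).2, { L with time := L.time + 1, labels := L.labels + 1 })

/-- Unit cost operations on real numbers. -/
def add (a b : ℝ) : RAM d ℝ := do tick; return a + b
def sub (a b : ℝ) : RAM d ℝ := do tick; return a - b
def mul (a b : ℝ) : RAM d ℝ := do tick; return a * b
def div (a b : ℝ) : RAM d ℝ := do tick; return a / b
def le (a b : ℝ) : RAM d Bool := do tick; return decide (a ≤ b)
def lt (a b : ℝ) : RAM d Bool := do tick; return decide (a < b)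

/-- Unit cost operations on counters. -/
def incr (t : ℕ) : RAM d ℕ := do tick; return t + 1
def eqNat (s t : ℕ) : RAM d Bool := do tick; return decide (s = t)

/-- Unit cost access to arrays. -/
def load (v : Fin d → ℝ) (i : Fin d) : RAM d ℝ := do tick; return v i
def store (v : Fin d → ℝ) (i : Fin d) (a : ℝ) : RAM d (Fin d → ℝ) := do
  tick; return Function.update v i a

/-- A loop over the coordinates `0, …, d - 1`, with one unit of overhead per round. -/
def forCoords {α : Type} (a : α) (body : α → Fin d → RAM d α) : RAM d α :=
  (List.finRange d).foldlM (fun a i => do tick; body a i) a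

/-- The inner product `v · x`, computed coordinate by coordinate. -/
def dot (v x : Fin d → ℝ) : RAM d ℝ :=
  forCoords (0 : ℝ) fun acc i => do
    let p ← load v i
    let q ← load x i
    let r ← mul p q
    add acc r

/-- The vector `v - c x`, computed in place, coordinate by coordinate. -/
def subScaled (v : Fin d → ℝ) (c : ℝ) (x : Fin d → ℝ) : RAM d (Fin d → ℝ) :=
  forCoords v fun v' i => do
    let p ← load v' i
    let q ← load x i
    let r ← mul c q
    let s ← sub p r
    store v' i s

end RAM

/-! ## The algorithm MODIFIED-PERCEPTRON -/

/-- The variables of the algorithm: the iteration number `t`, the iterate `w = w_t`, and whether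
the algorithm has halted. -/
structure Config (d : ℕ) where
  t : ℕ
  w : Fin d → ℝ
  halted : Bool

/-- One pass of the main loop, with iteration number `m` and band width `b`: draw an unlabeled
example `x`; if `b / 2 ≤ w · x ≤ b` fails, reject it and stay in iteration `t`; otherwise query its
label `y`, replace `w` by `w - 2 (w · x) x` if `y (w · x) < 0`, and go on to iteration `t + 1`,
halting when `m` iterations are done. Nothing happens after halting. -/
def perceptronPass {d : ℕ} (m : ℕ) (b : ℝ) (s : Config d) : RAM d (Config d) := do
  if s.halted then
    return s
  else
    let (k, x) ← RAM.draw
    let a ← RAM.dot s.w x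
    let h ← RAM.div b 2
    let lower ← RAM.le h a
    let upper ← RAM.le a b
    if lower && upper then
      let y ← RAM.query k
      let z ← RAM.mul y a
      let mistake ← RAM.lt z 0
      let t' ← RAM.incr s.t
      let done ← RAM.eqNat t' m
      if mistake then
        let c ← RAM.mul 2 a
        let w' ← RAM.subScaled s.w c x
        return { t := t', w := w', halted := done }
      else
        return { t := t', w := s.w, halted := done }
    else
      return s

/-- MODIFIED-PERCEPTRON started at `w₀`, after at most `n` passes of the main loop. -/
def modifiedPerceptron {d : ℕ} (w₀ : Fin d → ℝ) (m : ℕ) (b : ℝ) : ℕ → RAM d (Config d)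
  | 0 => do
    let done ← RAM.eqNat 0 m
    return { t := 0, w := w₀, halted := done }
  | n + 1 => do
    let s ← modifiedPerceptron w₀ m b n
    perceptronPass m b s

/-- In the environment `ω`, MODIFIED-PERCEPTRON with initial vector `w₀`, iteration number `m` and
band width `b` halts, outputs `w`, and has then used the resources `L`. -/
def Outputs {d : ℕ} (w₀ : Sph d) (m : ℕ) (b : ℝ) (ω : ℕ → Sph d × Label)
    (w : EuclideanSpace ℝ (Fin d)) (L : Ledger) : Prop :=
  ∃ (n : ℕ) (s : Config d),
    modifiedPerceptron (fun i => (w₀ : EuclideanSpace ℝ (Fin d)) i) m b n ω ⟨0, 0, 0⟩ = (s, L) ∧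
    s.halted = true ∧ w = WithLp.toLp 2 s.w

/-! ## The parameters -/

/-- `⌈A (ln A + ln (1/δ))⌉` with `A = (3200 π)³ d / (1 - 2η)²`. -/
def numIterations (d : ℕ) (η δ : ℝ) : ℕ :=
  ⌈(3200 * Real.pi) ^ 3 * d / (1 - 2 * η) ^ 2 *
    (Real.log ((3200 * Real.pi) ^ 3 * d / (1 - 2 * η) ^ 2) + Real.log (1 / δ))⌉₊

/-- `θ (1 - 2η) / (2 (600 π)² ln (m²/δ) √d)`. -/
def bandWidth (d : ℕ) (η δ θ : ℝ) (m : ℕ) : ℝ :=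
  1 / (2 * (600 * Real.pi) ^ 2 * Real.log ((m : ℝ) ^ 2 / δ)) * (θ * (1 - 2 * η) / √d)

/-- `ln (d / (1 - 2η)²) + ln (1/δ)`. -/
def logFactor (d : ℕ) (η δ : ℝ) : ℝ :=
  Real.log (d / (1 - 2 * η) ^ 2) + Real.log (1 / δ)

end HalfspaceLearning

end

open HalfspaceLearning

/-! The progress measure is `Φ = 1 - ⟪w, u⟫`, which is `1 - cos` of the angle. An accepted `x` has
`⟪w, x⟫ > 0`, so an update happens exactly on a negative label. It is a reflection, which keeps `w`
on the sphere and changes `Φ` by `2⟪w, x⟫⟪u, x⟫`. Write `u = c w + s v` with a unit vector `v ⊥ w`.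
Under bounded noise the expected change is at most a curvature term of order `b²`, minus a gain
proportional to `(1 - 2η) b s E[⟪v, x⟫⁻]`, plus a term in `⟪w, x⟫⟪v, x⟫` that vanishes by symmetry
(`integral_drift_le`). Conditioned on the band, `E[⟪v, x⟫⁻]` is at least `1/(4√d)`. This follows
from rotation-invariant second and fourth moments and a quartic minorant of `|a|`, with no density
formula (`weighted_neg_part_moment`).

Put `r² = 1 - cos θ`. While `r²/8 ≤ Φ ≤ 3r²/2`, the factor by which an accepted example multiplies
`exp(λΦ)` has expectation at most `1 - ξ` (`integral_exp_update_le_of_mem`). A single potential then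
replaces stopping times and union bounds. In `updatePotential`, the first summand pays for ending
with `Φ > r²/4` and the last for escaping above `3r²/2`. The middle one charges each remaining
update for a possible visit below `r²/8`, where no drift is available but a single step cannot climb
past `3r²/16`. `passPotential` adds `(exp n - 1) qᴺ`, which pays for too few acceptances among the
remaining `N` passes. Truncated at `1`, the sum is a supermartingale along the passes
(`integral_statePotential_le`), and it is at least `1` at the end of every failed run. The failure
probability is thus at most its initial value (`measure_success_ge`), which the choice `λ r² = 16
ln(m²/δ)` makes at most `δ` (`passPotential_start_le`).

The number of passes needed is governed by the probability of the band, which is at least `b√d/5000`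
(`integral_band_ge`). This is proved by averaging over rotations of a plane through `w`. The monadic
program is reduced to the deterministic recursion `chain` with exact query counts and a linear time
bound per pass (`modifiedPerceptron_run`), so success within `passBudget` passes gives all the
resource bounds at once. -/

namespace HalfspaceLearning

/-! ### Rotation invariance of the uniform distribution on the sphere -/

section Sphere

open Set Metric
open scoped Pointwise

variable {d : ℕ}

/-- The action of a linear isometry on the unit sphere. -/
noncomputable def sphereEquiv (R : EuclideanSpace ℝ (Fin d) ≃ₗᵢ[ℝ] EuclideanSpace ℝ (Fin d)) :
    Sph d ≃ᵐ Sph d where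
  toFun x := ⟨R x, by simp⟩
  invFun x := ⟨R.symm x, by simp⟩
  left_inv x := by simp
  right_inv x := by simp
  measurable_toFun := by
    exact (R.continuous.measurable.comp measurable_subtype_coe).subtype_mk
  measurable_invFun := by
    exact (R.symm.continuous.measurable.comp measurable_subtype_coe).subtype_mk

@[simp] lemma coe_sphereEquiv
    (R : EuclideanSpace ℝ (Fin d) ≃ₗᵢ[ℝ] EuclideanSpace ℝ (Fin d)) (x : Sph d) :
    (sphereEquiv R x : EuclideanSpace ℝ (Fin d)) = R x := rfl

/-- The surface measure of a set is a multiple of the volume of the cone over it. A linear isometry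
commutes with taking cones and preserves volume. -/
lemma measurePreserving_sphereEquiv_toSphere
    (R : EuclideanSpace ℝ (Fin d) ≃ₗᵢ[ℝ] EuclideanSpace ℝ (Fin d)) :
    MeasurePreserving (sphereEquiv R)
      (volume : Measure (EuclideanSpace ℝ (Fin d))).toSphere
      (volume : Measure (EuclideanSpace ℝ (Fin d))).toSphere := by
  refine ⟨(sphereEquiv R).measurable, ?_⟩
  ext s hs
  rw [Measure.map_apply (sphereEquiv R).measurable hs, Measure.toSphere_apply' _ hs,
    Measure.toSphere_apply' _ ((sphereEquiv R).measurable hs)]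
  congr 1
  have hset : (Ioo (0 : ℝ) 1 • ((↑) '' ((sphereEquiv R) ⁻¹' s) : Set (EuclideanSpace ℝ (Fin d))))
      = R ⁻¹' (Ioo (0 : ℝ) 1 • ((↑) '' s)) := by
    ext y
    simp only [Set.mem_smul, mem_image, mem_preimage]
    constructor
    · rintro ⟨r, hr, _, ⟨x, hx, rfl⟩, rfl⟩
      exact ⟨r, hr, _, ⟨_, hx, rfl⟩, by simp⟩
    · rintro ⟨r, hr, _, ⟨x, hx, rfl⟩, h⟩
      refine ⟨r, hr, _, ⟨(sphereEquiv R).symm x, by simpa using hx, rfl⟩, ?_⟩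
      apply R.injective
      rw [← h, map_smul]
      congr 1
      exact congrArg Subtype.val ((sphereEquiv R).apply_symm_apply x)
  rw [hset]
  exact R.measurePreserving.measure_preimage_equiv
    (f := R.toHomeomorph.toMeasurableEquiv) _

lemma uniformSphere_eq_smul :
    uniformSphere d = ((volume : Measure (EuclideanSpace ℝ (Fin d))).toSphere univ)⁻¹ •
      (volume : Measure (EuclideanSpace ℝ (Fin d))).toSphere := by
  simp [uniformSphere, ProbabilityTheory.cond]

lemma measurePreserving_sphereEquiv
    (R : EuclideanSpace ℝ (Fin d) ≃ₗᵢ[ℝ] EuclideanSpace ℝ (Fin d)) :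
    MeasurePreserving (sphereEquiv R) (uniformSphere d) (uniformSphere d) := by
  rw [uniformSphere_eq_smul]
  exact (measurePreserving_sphereEquiv_toSphere R).smul_measure _

lemma isProbabilityMeasure_uniformSphere (hd : 1 ≤ d) :
    IsProbabilityMeasure (uniformSphere d) := by
  have : Nonempty (Fin d) := ⟨⟨0, hd⟩⟩
  refine ProbabilityTheory.cond_isProbabilityMeasure ?_
  rw [Measure.toSphere_apply_univ]
  exact mul_ne_zero (by simp; omega) (measure_ball_pos _ _ one_pos).ne'

lemma integral_isometry
    (R : EuclideanSpace ℝ (Fin d) ≃ₗᵢ[ℝ] EuclideanSpace ℝ (Fin d))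
    (f : EuclideanSpace ℝ (Fin d) → ℝ) :
    ∫ x : Sph d, f (R x) ∂(uniformSphere d) = ∫ x : Sph d, f x ∂(uniformSphere d) :=
  (measurePreserving_sphereEquiv R).integral_comp' (fun x : Sph d => f x)

/-- Rotational symmetry: given `⟪w, x⟫`, the law of `⟪v, x⟫` depends only on the length of `v`
and its inner product with `w`. -/
lemma integral_inner_congr (F : ℝ → ℝ → ℝ) {w v v' : EuclideanSpace ℝ (Fin d)}
    (hv : ‖v‖ = ‖v'‖) (hw : inner ℝ w v = inner ℝ w v') :
    ∫ x : Sph d, F (inner ℝ w x) (inner ℝ v x) ∂(uniformSphere d) =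
      ∫ x : Sph d, F (inner ℝ w x) (inner ℝ v' x) ∂(uniformSphere d) := by
  -- The reflection in the hyperplane orthogonal to `v - v'` swaps `v` and `v'`, which have equal
  -- length. It fixes `w`, since `w ⊥ v - v'`.
  set R := (Submodule.span ℝ {v - v'})ᗮ.reflection with hR
  have hRv : R v = v' := Submodule.reflection_sub hv
  have hRw : R w = w := by
    refine Submodule.reflection_mem_subspace_eq_self ?_
    rw [Submodule.mem_orthogonal_singleton_iff_inner_left, inner_sub_right, hw, sub_self]
  have hRR : ∀ x y, inner ℝ x (R y) = inner ℝ (R x) y := by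
    intro x y
    rw [← R.inner_map_map x (R y), hR, Submodule.reflection_reflection]
  have h := integral_isometry R fun x => F (inner ℝ w x) (inner ℝ v x)
  simp only [hRR, hRw, hRv] at h
  exact h.symm

lemma abs_inner_sphere_le (v : EuclideanSpace ℝ (Fin d)) (x : Sph d) :
    |inner ℝ v (x : EuclideanSpace ℝ (Fin d))| ≤ ‖v‖ := by
  simpa using abs_real_inner_le_norm v (x : EuclideanSpace ℝ (Fin d))

@[fun_prop]
lemma continuous_inner_sphere (v : EuclideanSpace ℝ (Fin d)) :
    Continuous fun x : Sph d => inner ℝ v (x : EuclideanSpace ℝ (Fin d)) := by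
  fun_prop

lemma integrable_weight_mul (hd : 1 ≤ d) {χ : ℝ → ℝ} (hχ : Measurable χ) (h0 : ∀ s, 0 ≤ χ s)
    (h1 : ∀ s, χ s ≤ 1) (w : EuclideanSpace ℝ (Fin d)) {f : Sph d → ℝ} (hf : Continuous f) :
    Integrable (fun x : Sph d => χ (inner ℝ w x) * f x) (uniformSphere d) := by
  have := isProbabilityMeasure_uniformSphere hd
  have hfi : Integrable f (uniformSphere d) :=
    hf.integrable_of_hasCompactSupport (HasCompactSupport.of_compactSpace f)
  refine hfi.bdd_mul (c := 1) ?_ ?_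
  · exact (hχ.comp (continuous_inner_sphere w).measurable).aestronglyMeasurable
  · exact Filter.Eventually.of_forall fun x => by
      rw [Real.norm_eq_abs, abs_of_nonneg (h0 _)]; exact h1 _

end Sphere

/-! ### Moments of coordinates orthogonal to `w`, weighted by a function of `⟪w, x⟫` -/

section Moments

variable {d : ℕ}

lemma exists_orthonormalBasis_pair (hd : 2 ≤ d) {w v : EuclideanSpace ℝ (Fin d)}
    (hw : ‖w‖ = 1) (hv : ‖v‖ = 1) (hwv : inner ℝ w v = 0) :
    ∃ (i j : Fin d) (e : OrthonormalBasis (Fin d) ℝ (EuclideanSpace ℝ (Fin d))),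
      i ≠ j ∧ e i = w ∧ e j = v := by
  set i : Fin d := ⟨0, by omega⟩
  set j : Fin d := ⟨1, by omega⟩
  have hij : i ≠ j := by simp [i, j]
  have ho : Orthonormal ℝ (({i, j} : Set (Fin d)).domRestrict fun k => if k = i then w else v) := by
    constructor
    · rintro ⟨k, hk⟩
      rw [Set.domRestrict_apply]
      split_ifs <;> assumption
    · rintro ⟨k, rfl | rfl⟩ ⟨l, rfl | rfl⟩ hkl
      · exact absurd rfl hkl
      · simpa [Set.domRestrict_apply, hij.symm] using hwv
      · simpa [Set.domRestrict_apply, hij.symm, real_inner_comm] using hwv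
      · exact absurd rfl hkl
  obtain ⟨e, he⟩ := ho.exists_orthonormalBasis_extension_of_card_eq (by simp)
  refine ⟨i, j, e, hij, ?_, ?_⟩
  · simpa using he i (by simp)
  · simpa [hij.symm] using he j (by simp)

lemma sum_sq_inner_eq_one (e : OrthonormalBasis (Fin d) ℝ (EuclideanSpace ℝ (Fin d)))
    (x : Sph d) : ∑ k, inner ℝ (e k) (x : EuclideanSpace ℝ (Fin d)) ^ 2 = 1 := by
  have h := e.sum_sq_norm_inner_right (x : EuclideanSpace ℝ (Fin d))
  simpa using h

variable {χ : ℝ → ℝ}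

/-- Complete `w, v` to an orthonormal basis. The `d - 1` directions other than `w` have equal
weighted second moments, and their squared coordinates add up to `1 - ⟪w, x⟫²`. -/
lemma weighted_second_moment (hd : 2 ≤ d) (hχ : Measurable χ) (h0 : ∀ s, 0 ≤ χ s)
    (h1 : ∀ s, χ s ≤ 1) {w v : EuclideanSpace ℝ (Fin d)}
    (hw : ‖w‖ = 1) (hv : ‖v‖ = 1) (hwv : inner ℝ w v = 0) :
    ((d : ℝ) - 1) * ∫ x : Sph d, χ (inner ℝ w x) * inner ℝ v x ^ 2 ∂(uniformSphere d) =
      ∫ x : Sph d, χ (inner ℝ w x) * (1 - inner ℝ w x ^ 2) ∂(uniformSphere d) := by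
  obtain ⟨i, j, e, hij, rfl, rfl⟩ := exists_orthonormalBasis_pair hd hw hv hwv
  have hk : ∀ k ∈ Finset.univ.erase i,
      ∫ x : Sph d, χ (inner ℝ (e i) x) * inner ℝ (e k) x ^ 2 ∂(uniformSphere d) =
      ∫ x : Sph d, χ (inner ℝ (e i) x) * inner ℝ (e j) x ^ 2 ∂(uniformSphere d) := by
    intro k hk
    refine integral_inner_congr (fun s a => χ s * a ^ 2) (by simp) ?_
    rw [hwv, e.orthonormal.2 (Finset.ne_of_mem_erase hk).symm]
  have hsum := Finset.sum_congr rfl hk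
  rw [Finset.sum_const, ← integral_finsetSum, Finset.card_erase_of_mem (Finset.mem_univ _),
    Finset.card_univ, Fintype.card_fin, nsmul_eq_mul, Nat.cast_sub (by omega), Nat.cast_one] at hsum
  · rw [← hsum]
    refine integral_congr_ae (Filter.Eventually.of_forall fun x => ?_)
    simp only
    have hs := sum_sq_inner_eq_one e x
    rw [← Finset.sum_erase_add _ _ (Finset.mem_univ i)] at hs
    rw [← Finset.mul_sum, eq_sub_of_add_eq hs]
  · exact fun k _ => integrable_weight_mul (by omega) hχ h0 h1 _ (by fun_prop)

/-- The unit vectors `(v ± v')/√2` have the same weighted fourth moment as `v` and `v'`. Adding the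
two expansions cancels the odd terms and leaves a linear relation between the pure and the mixed
moment. -/
lemma weighted_mixed_moment (hd : 2 ≤ d) (hχ : Measurable χ) (h0 : ∀ s, 0 ≤ χ s)
    (h1 : ∀ s, χ s ≤ 1) {w v v' : EuclideanSpace ℝ (Fin d)}
    (hv : ‖v‖ = 1) (hv' : ‖v'‖ = 1) (hwv : inner ℝ w v = 0)
    (hwv' : inner ℝ w v' = 0) (hvv' : inner ℝ v v' = 0) :
    3 * ∫ x : Sph d, χ (inner ℝ w x) * (inner ℝ v x ^ 2 * inner ℝ v' x ^ 2) ∂(uniformSphere d) =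
      ∫ x : Sph d, χ (inner ℝ w x) * inner ℝ v x ^ 4 ∂(uniformSphere d) := by
  have hd1 : 1 ≤ d := by omega
  set c : ℝ := (√2)⁻¹ with hc
  have hc4 : c ^ 4 = 1 / 4 := by
    have : c ^ 2 = 1 / 2 := by rw [hc, inv_pow, Real.sq_sqrt (by norm_num)]; norm_num
    calc c ^ 4 = (c ^ 2) ^ 2 := by ring
      _ = 1 / 4 := by rw [this]; norm_num
  have hc2 : c ^ 2 = 1 / 2 := by rw [hc, inv_pow, Real.sq_sqrt (by norm_num)]; norm_num
  have hnorm : ∀ ε : ℝ, ε ^ 2 = 1 → ‖v‖ = ‖c • v + (ε * c) • v'‖ := by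
    intro ε hε
    rw [hv, eq_comm, ← sq_eq_sq₀ (norm_nonneg _) zero_le_one, norm_add_sq_real, norm_smul, norm_smul,
      hv, hv', inner_smul_left, inner_smul_right, hvv']
    simp only [Real.norm_eq_abs, mul_one, sq_abs, mul_pow, hε]
    simp [hc2]
    norm_num
  have key : ∀ ε : ℝ, ε ^ 2 = 1 →
      ∫ x : Sph d, χ (inner ℝ w x) * inner ℝ v x ^ 4 ∂(uniformSphere d) =
      ∫ x : Sph d, χ (inner ℝ w x) * inner ℝ (c • v + (ε * c) • v') x ^ 4 ∂(uniformSphere d) := by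
    intro ε hε
    refine integral_inner_congr (fun s a => χ s * a ^ 4) (hnorm ε hε) ?_
    simp [inner_add_right, inner_smul_right, hwv, hwv']
  have hv'4 : ∫ x : Sph d, χ (inner ℝ w x) * inner ℝ v x ^ 4 ∂(uniformSphere d) =
      ∫ x : Sph d, χ (inner ℝ w x) * inner ℝ v' x ^ 4 ∂(uniformSphere d) :=
    integral_inner_congr (fun s a => χ s * a ^ 4) (hv.trans hv'.symm) (hwv.trans hwv'.symm)
  have hp := key 1 (by norm_num)
  have hm := key (-1) (by norm_num)
  have int : ∀ {f : Sph d → ℝ}, Continuous f →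
      Integrable (fun x : Sph d => χ (inner ℝ w x) * f x) (uniformSphere d) := fun hf =>
    integrable_weight_mul hd1 hχ h0 h1 w hf
  have hadd : ∫ x : Sph d, χ (inner ℝ w x) * inner ℝ (c • v + (1 * c) • v') x ^ 4 ∂(uniformSphere d)
      + ∫ x : Sph d, χ (inner ℝ w x) * inner ℝ (c • v + (-1 * c) • v') x ^ 4 ∂(uniformSphere d)
      = (1 / 2) * ∫ x : Sph d, χ (inner ℝ w x) * inner ℝ v x ^ 4 ∂(uniformSphere d)
        + 3 * ∫ x : Sph d, χ (inner ℝ w x) * (inner ℝ v x ^ 2 * inner ℝ v' x ^ 2) ∂(uniformSphere d)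
        + (1 / 2) * ∫ x : Sph d, χ (inner ℝ w x) * inner ℝ v' x ^ 4 ∂(uniformSphere d) := by
    rw [← integral_const_mul, ← integral_const_mul, ← integral_const_mul, ← integral_add,
      ← integral_add, ← integral_add]
    · refine integral_congr_ae (Filter.Eventually.of_forall fun x => ?_)
      simp only [inner_add_left, inner_smul_left, RCLike.conj_to_real]
      linear_combination (χ (inner ℝ w (x : EuclideanSpace ℝ (Fin d))) *
        (2 * inner ℝ v (x : EuclideanSpace ℝ (Fin d)) ^ 4
        + 12 * inner ℝ v (x : EuclideanSpace ℝ (Fin d)) ^ 2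
          * inner ℝ v' (x : EuclideanSpace ℝ (Fin d)) ^ 2
        + 2 * inner ℝ v' (x : EuclideanSpace ℝ (Fin d)) ^ 4)) * hc4
    · exact ((int (by fun_prop)).const_mul _).add ((int (by fun_prop)).const_mul _)
    · exact (int (by fun_prop)).const_mul _
    · exact (int (by fun_prop)).const_mul _
    · exact (int (by fun_prop)).const_mul _
    · exact int (by fun_prop)
    · exact int (by fun_prop)
  rw [← hp, ← hm, ← hv'4] at hadd
  linarith

/-- Multiply `∑ ⟪e k, x⟫² ≤ 1`, summed over directions orthogonal to `w`, by `⟪v, x⟫²` and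
integrate. The direction `v` contributes the fourth moment, and each of the other `d - 2` directions
a third of it. -/
lemma weighted_fourth_moment (hd : 2 ≤ d) (hχ : Measurable χ) (h0 : ∀ s, 0 ≤ χ s)
    (h1 : ∀ s, χ s ≤ 1) {w v : EuclideanSpace ℝ (Fin d)}
    (hw : ‖w‖ = 1) (hv : ‖v‖ = 1) (hwv : inner ℝ w v = 0) :
    ((d : ℝ) + 1) * ∫ x : Sph d, χ (inner ℝ w x) * inner ℝ v x ^ 4 ∂(uniformSphere d) ≤
      3 * ∫ x : Sph d, χ (inner ℝ w x) * inner ℝ v x ^ 2 ∂(uniformSphere d) := by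
  have hd1 : 1 ≤ d := by omega
  obtain ⟨i, j, e, hij, rfl, rfl⟩ := exists_orthonormalBasis_pair hd hw hv hwv
  have int : ∀ {f : Sph d → ℝ}, Continuous f →
      Integrable (fun x : Sph d => χ (inner ℝ (e i) x) * f x) (uniformSphere d) := fun hf =>
    integrable_weight_mul hd1 hχ h0 h1 _ hf
  set M := ∫ x : Sph d, χ (inner ℝ (e i) x) * inner ℝ (e j) x ^ 4 ∂(uniformSphere d) with hM
  have hk : ∀ k ∈ (Finset.univ.erase i).erase j,
      ∫ x : Sph d, χ (inner ℝ (e i) x) * (inner ℝ (e j) x ^ 2 * inner ℝ (e k) x ^ 2)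
        ∂(uniformSphere d) = M / 3 := by
    intro k hk
    have hkj : k ≠ j := Finset.ne_of_mem_erase hk
    have hki : k ≠ i := Finset.ne_of_mem_erase (Finset.mem_of_mem_erase hk)
    have := weighted_mixed_moment (v := e j) (v' := e k) (w := e i) hd hχ h0 h1 (by simp)
      (by simp) hwv (e.orthonormal.2 hki.symm) (e.orthonormal.2 hkj.symm)
    rw [eq_div_iff (by norm_num), mul_comm, this]
  have hjmem : j ∈ Finset.univ.erase i := Finset.mem_erase.2 ⟨hij.symm, Finset.mem_univ _⟩
  have hsum := Finset.sum_congr rfl hk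
  rw [Finset.sum_const, ← integral_finsetSum, Finset.card_erase_of_mem hjmem,
    Finset.card_erase_of_mem (Finset.mem_univ _),
    Finset.card_univ, Fintype.card_fin, nsmul_eq_mul, Nat.sub_sub, Nat.cast_sub (by omega)] at hsum
  · have hle : M + ((d : ℝ) - 2) * (M / 3) ≤
        ∫ x : Sph d, χ (inner ℝ (e i) x) * inner ℝ (e j) x ^ 2 ∂(uniformSphere d) := by
      have h2 : ((d : ℝ) - 2) * (M / 3) = ((d : ℝ) - ((1 + 1 : ℕ) : ℝ)) * (M / 3) := by
        norm_num
      rw [h2, ← hsum, hM, ← integral_add (int (by fun_prop))]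
      · refine integral_mono ((int (by fun_prop)).add ?_) (int (by fun_prop)) fun x => ?_
        · simp only [← Finset.mul_sum]
          exact int (by fun_prop)
        · simp only [← Finset.mul_sum]
          have hs := sum_sq_inner_eq_one e x
          rw [← Finset.sum_erase_add _ _ (Finset.mem_univ i),
            ← Finset.sum_erase_add _ _ hjmem] at hs
          rw [← mul_add]
          refine mul_le_mul_of_nonneg_left ?_ (h0 _)
          nlinarith [mul_nonneg (sq_nonneg (inner ℝ (e j) (x : EuclideanSpace ℝ (Fin d))))
            (sq_nonneg (inner ℝ (e i) (x : EuclideanSpace ℝ (Fin d))))]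
      · simp only [← Finset.mul_sum]
        exact int (by fun_prop)
    linarith
  · exact fun k _ => int (by fun_prop)

end Moments

/-! ### First absolute moments inside a thin band -/

section AbsMoment

variable {d : ℕ} {χ : ℝ → ℝ}

/-- The even quartic touches `|a|` at `0` and tangentially at `q|a| = 2`, hence the double root in
the factorization. With `q = √d` it is adapted to coordinates of size about `1/√d`. -/
lemma abs_ge_quartic (q a : ℝ) (hq : 0 ≤ q) :
    3 * q / 4 * a ^ 2 - q ^ 3 / 16 * a ^ 4 ≤ |a| := by
  have h : |a| - (3 * q / 4 * a ^ 2 - q ^ 3 / 16 * a ^ 4) =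
      |a| * (q * |a| - 2) ^ 2 * (q * |a| + 4) / 16 := by
    rw [show a ^ 4 = (a ^ 2) ^ 2 by ring, ← sq_abs a]; ring
  have : 0 ≤ |a| * (q * |a| - 2) ^ 2 * (q * |a| + 4) / 16 := by positivity
  linarith

/-- Integrating the quartic minorant turns the claim into a lower bound on the second moment and an
upper bound on the fourth. The support condition makes `1 - ⟪w, x⟫²` at least `49/50`, and the
constant works because `9/8 · 49/50 ≥ 1`. -/
lemma weighted_abs_moment (hd : 2 ≤ d) (hχ : Measurable χ) (h0 : ∀ s, 0 ≤ χ s)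
    (h1 : ∀ s, χ s ≤ 1) (hsupp : ∀ s, χ s ≠ 0 → s ^ 2 ≤ 1 / 50)
    {w v : EuclideanSpace ℝ (Fin d)}
    (hw : ‖w‖ = 1) (hv : ‖v‖ = 1) (hwv : inner ℝ w v = 0) :
    1 / (2 * √d) * ∫ x : Sph d, χ (inner ℝ w x) ∂(uniformSphere d) ≤
      ∫ x : Sph d, χ (inner ℝ w x) * |inner ℝ v x| ∂(uniformSphere d) := by
  have int : ∀ {f : Sph d → ℝ}, Continuous f →
      Integrable (fun x : Sph d => χ (inner ℝ w x) * f x) (uniformSphere d) := fun hf =>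
    integrable_weight_mul (by omega) hχ h0 h1 w hf
  have int1 : Integrable (fun x : Sph d => χ (inner ℝ w x)) (uniformSphere d) := by
    simpa using int (f := fun _ => 1) continuous_const
  have h2 := weighted_second_moment hd hχ h0 h1 hw hv hwv
  have h4 := weighted_fourth_moment hd hχ h0 h1 hw hv hwv
  set p := ∫ x : Sph d, χ (inner ℝ w x) ∂(uniformSphere d) with hp
  set q2 := ∫ x : Sph d, χ (inner ℝ w x) * inner ℝ v x ^ 2 ∂(uniformSphere d) with hq2
  set m4 := ∫ x : Sph d, χ (inner ℝ w x) * inner ℝ v x ^ 4 ∂(uniformSphere d) with hm4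
  have hp0 : 0 ≤ p := integral_nonneg fun x => h0 _
  have hm0 : 0 ≤ m4 := integral_nonneg fun x => mul_nonneg (h0 _) (by positivity)
  have hdR : (2 : ℝ) ≤ d := by exact_mod_cast hd
  set q := √(d : ℝ) with hq
  have hqq : q ^ 2 = d := Real.sq_sqrt (by positivity)
  have hqpos : 0 < q := Real.sqrt_pos.2 (by linarith)
  have hlow : 49 / 50 * p ≤ ((d : ℝ) - 1) * q2 := by
    rw [h2, hp, ← integral_const_mul]
    refine integral_mono (int1.const_mul _) (int (by fun_prop)) fun x => ?_
    by_cases hx : χ (inner ℝ w (x : EuclideanSpace ℝ (Fin d))) = 0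
    · simp [hx]
    · have := hsupp _ hx
      have h := h0 (inner ℝ w (x : EuclideanSpace ℝ (Fin d)))
      simp only
      nlinarith
  have hq20 : 0 ≤ q2 := by
    by_contra hneg
    nlinarith
  have habs : 3 * q / 4 * q2 - q ^ 3 / 16 * m4 ≤
      ∫ x : Sph d, χ (inner ℝ w x) * |inner ℝ v x| ∂(uniformSphere d) := by
    rw [hq2, hm4, ← integral_const_mul, ← integral_const_mul, ← integral_sub]
    · refine integral_mono (((int (by fun_prop)).const_mul _).sub ((int (by fun_prop)).const_mul _))
        (int (by fun_prop)) fun x => ?_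
      have := mul_le_mul_of_nonneg_left
        (abs_ge_quartic q (inner ℝ v (x : EuclideanSpace ℝ (Fin d))) hqpos.le)
        (h0 (inner ℝ w (x : EuclideanSpace ℝ (Fin d))))
      simp only
      linarith
    · exact (int (by fun_prop)).const_mul _
    · exact (int (by fun_prop)).const_mul _
  have hA : (d : ℝ) * m4 ≤ 3 * q2 := by nlinarith
  have hB : q ^ 3 / 16 * m4 ≤ q * (3 / 16) * q2 := by
    have : q ^ 3 / 16 * m4 = q / 16 * (d * m4) := by rw [← hqq]; ring
    rw [this]
    have := mul_le_mul_of_nonneg_left hA (show 0 ≤ q / 16 by positivity)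
    linarith
  have hC : 49 / 50 * p ≤ d * q2 := by nlinarith
  have hD : 1 / (2 * q) * p ≤ 9 / 16 * q * q2 := by
    have : 1 / (2 * q) * p = p / (2 * q) := by ring
    rw [this, div_le_iff₀ (by positivity)]
    have : 9 / 16 * q * q2 * (2 * q) = 9 / 8 * (d * q2) := by rw [← hqq]; ring
    rw [this]
    linarith
  have : 3 * q / 4 * q2 - q * (3 / 16) * q2 = 9 / 16 * q * q2 := by ring
  linarith

lemma weighted_neg_part_moment (hd : 2 ≤ d) (hχ : Measurable χ) (h0 : ∀ s, 0 ≤ χ s)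
    (h1 : ∀ s, χ s ≤ 1) (hsupp : ∀ s, χ s ≠ 0 → s ^ 2 ≤ 1 / 50)
    {w v : EuclideanSpace ℝ (Fin d)}
    (hw : ‖w‖ = 1) (hv : ‖v‖ = 1) (hwv : inner ℝ w v = 0) :
    1 / (4 * √d) * ∫ x : Sph d, χ (inner ℝ w x) ∂(uniformSphere d) ≤
      ∫ x : Sph d, χ (inner ℝ w x) * max (-inner ℝ v x) 0 ∂(uniformSphere d) := by
  have int : ∀ {f : Sph d → ℝ}, Continuous f →
      Integrable (fun x : Sph d => χ (inner ℝ w x) * f x) (uniformSphere d) := fun hf =>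
    integrable_weight_mul (by omega) hχ h0 h1 w hf
  have h := weighted_abs_moment hd hχ h0 h1 hsupp hw hv hwv
  have hsymm := integral_inner_congr (fun s a => χ s * max (-a) 0) (w := w) (v := v) (v' := -v)
    (by simp) (by simp [hwv])
  have hsplit : ∫ x : Sph d, χ (inner ℝ w x) * |inner ℝ v x| ∂(uniformSphere d) =
      ∫ x : Sph d, χ (inner ℝ w x) * max (-inner ℝ v x) 0 ∂(uniformSphere d) +
      ∫ x : Sph d, χ (inner ℝ w x) * max (-inner ℝ (-v) x) 0 ∂(uniformSphere d) := by
    rw [← integral_add (int (by fun_prop)) (int (by fun_prop))]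
    refine integral_congr_ae (Filter.Eventually.of_forall fun x => ?_)
    simp only [inner_neg_left, neg_neg, ← mul_add]
    congr 1
    rcases le_total 0 (inner ℝ v (x : EuclideanSpace ℝ (Fin d))) with h | h
    · rw [abs_of_nonneg h, max_eq_right (by linarith), max_eq_left h, zero_add]
    · rw [abs_of_nonpos h, max_eq_left (by linarith), max_eq_right h, add_zero]
  have : 1 / (4 * √(d : ℝ)) = 1 / 2 * (1 / (2 * √(d : ℝ))) := by ring
  rw [this, mul_assoc]
  linarith

/-- Replacing `v` by `-v` preserves the integral and flips its sign. -/
lemma weighted_cross_moment (χ : ℝ → ℝ) {w v : EuclideanSpace ℝ (Fin d)}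
    (hwv : inner ℝ w v = 0) :
    ∫ x : Sph d, χ (inner ℝ w x) * (inner ℝ w x * inner ℝ v x) ∂(uniformSphere d) = 0 := by
  have hsymm := integral_inner_congr (d := d) (fun s a => χ s * (s * a)) (w := w) (v := v)
    (v' := -v) (by simp) (by simp [hwv])
  simp only [inner_neg_left, mul_neg, integral_neg] at hsymm
  linarith

end AbsMoment

/-! ### Unweighted moments and anticoncentration of two coordinates -/

section BandProbability

variable {d : ℕ}

/-- The indicator function of the band `[b / 2, b]`. -/
noncomputable def band (b : ℝ) : ℝ → ℝ := Set.indicator (Set.Icc (b / 2) b) 1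

lemma measurable_band (b : ℝ) : Measurable (band b) :=
  measurable_one.indicator measurableSet_Icc

lemma band_nonneg (b s : ℝ) : 0 ≤ band b s := Set.indicator_nonneg (by simp) _

lemma band_le_one (b s : ℝ) : band b s ≤ 1 :=
  Set.indicator_le_self' (by simp) _ |>.trans (by simp)

lemma second_moment (hd : 2 ≤ d) {v : EuclideanSpace ℝ (Fin d)} {w : EuclideanSpace ℝ (Fin d)}
    (hw : ‖w‖ = 1) (hv : ‖v‖ = 1) (hwv : inner ℝ w v = 0) :
    ∫ x : Sph d, inner ℝ v x ^ 2 ∂(uniformSphere d) = 1 / d := by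
  have := isProbabilityMeasure_uniformSphere (d := d) (by omega)
  have h := weighted_second_moment (χ := fun _ => 1) hd measurable_const (by simp) (by simp)
    hw hv hwv
  have h' := integral_inner_congr (d := d) (fun _ a => a ^ 2) (w := 0) (v := w) (v' := v)
    (by rw [hw, hv]) (by simp)
  have hi : Integrable (fun x : Sph d => inner ℝ w (x : EuclideanSpace ℝ (Fin d)) ^ 2)
      (uniformSphere d) := by
    simpa using integrable_weight_mul (χ := fun _ => 1) (by omega) measurable_const (by simp)
      (by simp) w (f := fun x : Sph d => inner ℝ w (x : EuclideanSpace ℝ (Fin d)) ^ 2) (by fun_prop)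
  simp only [one_mul] at h
  rw [integral_sub (integrable_const _) hi, h'] at h
  simp only [integral_const, probReal_univ, smul_eq_mul, mul_one] at h
  have : (0 : ℝ) < d := by exact_mod_cast (by omega : 0 < d)
  field_simp
  linarith

lemma fourth_moment (hd : 2 ≤ d) {v : EuclideanSpace ℝ (Fin d)} {w : EuclideanSpace ℝ (Fin d)}
    (hw : ‖w‖ = 1) (hv : ‖v‖ = 1) (hwv : inner ℝ w v = 0) :
    ∫ x : Sph d, inner ℝ v x ^ 4 ∂(uniformSphere d) ≤ 3 / (d : ℝ) ^ 2 := by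
  have h := weighted_fourth_moment (χ := fun _ => 1) hd measurable_const (by simp) (by simp)
    hw hv hwv
  simp only [one_mul] at h
  rw [second_moment hd hw hv hwv] at h
  have h0 : 0 ≤ ∫ x : Sph d, inner ℝ v x ^ 4 ∂(uniformSphere d) :=
    integral_nonneg fun x => by positivity
  have hd0 : (0 : ℝ) < d := by exact_mod_cast (by omega : 0 < d)
  rw [le_div_iff₀ (by positivity)]
  have h1 : 3 * (1 / (d : ℝ)) * d = 3 := by field_simp
  nlinarith

lemma integrable_of_measurable_bounded (hd : 1 ≤ d) {f : Sph d → ℝ} (hf : Measurable f) (C : ℝ)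
    (hC : ∀ x, |f x| ≤ C) : Integrable f (uniformSphere d) := by
  have := isProbabilityMeasure_uniformSphere hd
  exact Integrable.of_bound hf.aestronglyMeasurable C (Filter.Eventually.of_forall hC)

/-- A quantitative form of the fact that two orthogonal coordinates of a uniform point of the
sphere have size of order `1 / √d`, with all four combinations of signs. -/
lemma measure_quadrant_ge (hd : 2 ≤ d) {v w : EuclideanSpace ℝ (Fin d)}
    (hw : ‖w‖ = 1) (hv : ‖v‖ = 1) (hwv : inner ℝ w v = 0) :
    1 / 40 ≤ ∫ x : Sph d, Set.indicator {x : Sph d | inner ℝ w (x : EuclideanSpace ℝ (Fin d)) ≤ 0 ∧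
      1 / (2 * √d) ≤ inner ℝ v (x : EuclideanSpace ℝ (Fin d)) ∧
      inner ℝ w (x : EuclideanSpace ℝ (Fin d)) ^ 2 + inner ℝ v (x : EuclideanSpace ℝ (Fin d)) ^ 2
        ≤ 100 / d} (1 : Sph d → ℝ) x ∂(uniformSphere d) := by
  have := isProbabilityMeasure_uniformSphere (d := d) (by omega)
  have hd1 : 1 ≤ d := by omega
  have hd0 : (0 : ℝ) < d := by exact_mod_cast hd1
  set c : ℝ := 1 / (2 * √(d : ℝ)) with hc
  have hcpos : 0 < c := by positivity
  have hcsq : d * c ^ 2 = 1 / 4 := by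
    rw [hc, div_pow, mul_pow, Real.sq_sqrt hd0.le]; field_simp; norm_num
  have hvw : inner ℝ v w = 0 := by rw [real_inner_comm]; exact hwv
  have mw : Measurable fun x : Sph d => inner ℝ w (x : EuclideanSpace ℝ (Fin d)) :=
    (continuous_inner_sphere w).measurable
  have mv : Measurable fun x : Sph d => inner ℝ v (x : EuclideanSpace ℝ (Fin d)) :=
    (continuous_inner_sphere v).measurable
  set F : ℝ → ℝ → ℝ := fun s a => if c ≤ s ∧ a ≤ 0 then 1 else 0 with hF
  have hFm : ∀ s a, |F s a| ≤ 1 := by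
    intro s a; simp only [hF]; split_ifs <;> simp
  have iF : ∀ v' w' : EuclideanSpace ℝ (Fin d),
      Integrable (fun x : Sph d => F (inner ℝ v' x) (inner ℝ w' x)) (uniformSphere d) := by
    intro v' w'
    refine integrable_of_measurable_bounded hd1 ?_ 1 fun x => hFm _ _
    refine Measurable.ite ?_ measurable_const measurable_const
    exact (measurableSet_le measurable_const (continuous_inner_sphere v').measurable).inter
      (measurableSet_le (continuous_inner_sphere w').measurable measurable_const)
  have i2 : ∀ v' : EuclideanSpace ℝ (Fin d),
      Integrable (fun x : Sph d => inner ℝ v' (x : EuclideanSpace ℝ (Fin d)) ^ 2)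
        (uniformSphere d) := fun v' => by
    simpa using integrable_weight_mul (χ := fun _ => 1) (by omega) measurable_const (by simp)
      (by simp) w (f := fun x : Sph d => inner ℝ v' (x : EuclideanSpace ℝ (Fin d)) ^ 2)
      (by fun_prop)
  have i4 : Integrable (fun x : Sph d => inner ℝ v (x : EuclideanSpace ℝ (Fin d)) ^ 4)
        (uniformSphere d) := by
    simpa using integrable_weight_mul (χ := fun _ => 1) (by omega) measurable_const (by simp)
      (by simp) w (f := fun x : Sph d => inner ℝ v (x : EuclideanSpace ℝ (Fin d)) ^ 4)
      (by fun_prop)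
  have e1 : ∫ x : Sph d, F (inner ℝ v x) (inner ℝ (-w) x) ∂(uniformSphere d) =
      ∫ x : Sph d, F (inner ℝ v x) (inner ℝ w x) ∂(uniformSphere d) :=
    integral_inner_congr F (by simp) (by simp [hvw])
  have e2 : ∀ w' : EuclideanSpace ℝ (Fin d), inner ℝ w' v = 0 →
      ∫ x : Sph d, F (inner ℝ (-v) x) (inner ℝ w' x) ∂(uniformSphere d) =
      ∫ x : Sph d, F (inner ℝ v x) (inner ℝ w' x) ∂(uniformSphere d) := fun w' hw' =>
    integral_inner_congr (fun a s => F s a) (w := w') (by simp) (by simp [hw'])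
  -- With `β = ⟪v, x⟫`, the function `1 - (16/225)(dβ² - 4)²` is at most `1`, and it is nonpositive
  -- when `dβ² ≤ 1/4`, so it lies below the indicator of `|β| ≥ c`. The four sign patterns, which
  -- have equal probability, cover that event.
  have hsum : ∫ x : Sph d, (1 - 16 / 225 *
      (d ^ 2 * inner ℝ v (x : EuclideanSpace ℝ (Fin d)) ^ 4
        - 8 * d * inner ℝ v (x : EuclideanSpace ℝ (Fin d)) ^ 2 + 16)) ∂(uniformSphere d) ≤
      4 * ∫ x : Sph d, F (inner ℝ v x) (inner ℝ w x) ∂(uniformSphere d) := by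
    have : 4 * ∫ x : Sph d, F (inner ℝ v x) (inner ℝ w x) ∂(uniformSphere d) =
        ∫ x : Sph d, (F (inner ℝ v x) (inner ℝ w x) + F (inner ℝ v x) (inner ℝ (-w) x)
          + F (inner ℝ (-v) x) (inner ℝ w x) + F (inner ℝ (-v) x) (inner ℝ (-w) x))
          ∂(uniformSphere d) := by
      rw [integral_add, integral_add, integral_add, e1, e2 w hwv, e2 (-w) (by simp [hwv]), e1]
      · ring
      all_goals first
        | exact iF _ _
        | exact (iF _ _).add (iF _ _)
        | exact ((iF _ _).add (iF _ _)).add (iF _ _)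
    rw [this]
    refine integral_mono ?_ ((((iF _ _).add (iF _ _)).add (iF _ _)).add (iF _ _)) fun x => ?_
    · exact (integrable_const _).sub ((((i4.const_mul _).sub ((i2 v).const_mul _)).add
        (integrable_const _)).const_mul _)
    simp only [inner_neg_left]
    set β := inner ℝ v (x : EuclideanSpace ℝ (Fin d))
    set α := inner ℝ w (x : EuclideanSpace ℝ (Fin d))
    have hFn : ∀ s a, 0 ≤ F s a := by intro s a; simp only [hF]; split_ifs <;> simp
    have hpoly : 1 - 16 / 225 * ((d : ℝ) ^ 2 * β ^ 4 - 8 * d * β ^ 2 + 16) =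
        1 - 16 / 225 * (d * β ^ 2 - 4) ^ 2 := by ring
    rw [hpoly]
    by_cases hβ : c ≤ |β|
    · have hone : 1 ≤ F β α + F β (-α) + F (-β) α + F (-β) (-α) := by
        have := hFn β α
        have := hFn β (-α)
        have := hFn (-β) α
        have := hFn (-β) (-α)
        rcases le_abs.1 hβ with h | h <;> rcases le_total α 0 with h' | h'
        · have : F β α = 1 := if_pos ⟨h, h'⟩
          linarith
        · have : F β (-α) = 1 := if_pos ⟨h, by linarith⟩
          linarith
        · have : F (-β) α = 1 := if_pos ⟨h, h'⟩
          linarith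
        · have : F (-β) (-α) = 1 := if_pos ⟨h, by linarith⟩
          linarith
      nlinarith [sq_nonneg (d * β ^ 2 - 4)]
    · push Not at hβ
      have h1 : d * β ^ 2 ≤ 1 / 4 := by
        rw [← hcsq, ← sq_abs β]
        gcongr
      have h2 : (15 / 4) ^ 2 ≤ (d * β ^ 2 - 4) ^ 2 := by nlinarith
      have := hFn β α
      have := hFn β (-α)
      have := hFn (-β) α
      have := hFn (-β) (-α)
      linarith
  -- The moments give `E(dβ² - 4)² ≤ 3 - 8 + 16 = 11`.
  have hleft : 49 / 225 ≤ ∫ x : Sph d, (1 - 16 / 225 *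
      (d ^ 2 * inner ℝ v (x : EuclideanSpace ℝ (Fin d)) ^ 4
        - 8 * d * inner ℝ v (x : EuclideanSpace ℝ (Fin d)) ^ 2 + 16)) ∂(uniformSphere d) := by
    have j1 := i4.const_mul ((d : ℝ) ^ 2)
    have j2 := (i2 v).const_mul (8 * (d : ℝ))
    have j3 : Integrable (fun x : Sph d => d ^ 2 * inner ℝ v (x : EuclideanSpace ℝ (Fin d)) ^ 4
        - 8 * d * inner ℝ v (x : EuclideanSpace ℝ (Fin d)) ^ 2) (uniformSphere d) := j1.sub j2
    have j4 : Integrable (fun x : Sph d => d ^ 2 * inner ℝ v (x : EuclideanSpace ℝ (Fin d)) ^ 4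
        - 8 * d * inner ℝ v (x : EuclideanSpace ℝ (Fin d)) ^ 2 + 16) (uniformSphere d) :=
      j3.add (integrable_const 16)
    rw [integral_sub (integrable_const _) (j4.const_mul _),
      integral_const_mul, integral_add j3 (integrable_const _),
      integral_sub j1 j2, integral_const_mul, integral_const_mul,
      second_moment hd hw hv hwv]
    simp only [integral_const, probReal_univ, smul_eq_mul, one_mul]
    have h4 := mul_le_mul_of_nonneg_left (fourth_moment hd hw hv hwv)
      (show 0 ≤ (d : ℝ) ^ 2 by positivity)
    have e : (d : ℝ) ^ 2 * (3 / (d : ℝ) ^ 2) = 3 := by field_simp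
    have e' : 8 * (d : ℝ) * (1 / d) = 8 := by field_simp
    rw [e] at h4
    rw [e']
    linarith
  -- Markov's inequality in pointwise form removes the points with `α² + β² > 100/d`, at a cost of
  -- `1/50`. What remains is `49/900 - 1/50 ≥ 1/40`.
  have hfin : ∫ x : Sph d, (F (inner ℝ v x) (inner ℝ w x) -
      d / 100 * (inner ℝ w (x : EuclideanSpace ℝ (Fin d)) ^ 2
        + inner ℝ v (x : EuclideanSpace ℝ (Fin d)) ^ 2)) ∂(uniformSphere d) ≤
      ∫ x : Sph d, Set.indicator {x : Sph d | inner ℝ w (x : EuclideanSpace ℝ (Fin d)) ≤ 0 ∧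
        c ≤ inner ℝ v (x : EuclideanSpace ℝ (Fin d)) ∧
        inner ℝ w (x : EuclideanSpace ℝ (Fin d)) ^ 2
          + inner ℝ v (x : EuclideanSpace ℝ (Fin d)) ^ 2 ≤ 100 / d} (1 : Sph d → ℝ) x
        ∂(uniformSphere d) := by
    refine integral_mono ((iF _ _).sub (((i2 _).add (i2 _)).const_mul _)) ?_ fun x => ?_
    · refine integrable_of_measurable_bounded hd1 (measurable_one.indicator ?_) 1 fun x => ?_
      · exact (measurableSet_le mw measurable_const).inter ((measurableSet_le measurable_const mv).inter
          (measurableSet_le ((mw.pow_const 2).add (mv.pow_const 2)) measurable_const))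
      · by_cases hx : x ∈ {x : Sph d | inner ℝ w (x : EuclideanSpace ℝ (Fin d)) ≤ 0 ∧
          c ≤ inner ℝ v (x : EuclideanSpace ℝ (Fin d)) ∧
          inner ℝ w (x : EuclideanSpace ℝ (Fin d)) ^ 2
          + inner ℝ v (x : EuclideanSpace ℝ (Fin d)) ^ 2 ≤ 100 / d}
        · rw [Set.indicator_of_mem hx]; simp
        · rw [Set.indicator_of_notMem hx]; simp
    · simp only [Set.indicator_apply, Set.mem_ofPred_eq, Pi.one_apply, hF]
      set β := inner ℝ v (x : EuclideanSpace ℝ (Fin d))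
      set α := inner ℝ w (x : EuclideanSpace ℝ (Fin d))
      have hnn : 0 ≤ d / 100 * (α ^ 2 + β ^ 2) := by positivity
      split_ifs with h h' h'
      · linarith
      · have : 100 / d < α ^ 2 + β ^ 2 := by
          by_contra hcon
          exact h' ⟨h.2, h.1, not_lt.1 hcon⟩
        rw [div_lt_iff₀ hd0] at this
        linarith
      · linarith
      · linarith
  have j : Integrable (fun x : Sph d => inner ℝ w (x : EuclideanSpace ℝ (Fin d)) ^ 2
      + inner ℝ v (x : EuclideanSpace ℝ (Fin d)) ^ 2) (uniformSphere d) := (i2 w).add (i2 v)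
  rw [integral_sub (iF _ _) (j.const_mul _), integral_const_mul,
    integral_add (i2 _) (i2 _), second_moment hd hw hv hwv, second_moment hd hv hw hvw] at hfin
  have e : (d : ℝ) / 100 * (1 / d + 1 / d) = 1 / 50 := by field_simp; norm_num
  rw [e] at hfin
  linarith

end BandProbability

/-! ### Lower bound for the probability of the band -/

section BandLower

variable {d : ℕ}

lemma band_of_mem {b s : ℝ} (h : s ∈ Set.Icc (b / 2) b) : band b s = 1 :=
  Set.indicator_of_mem h _

lemma band_of_notMem {b s : ℝ} (h : s ∉ Set.Icc (b / 2) b) : band b s = 0 :=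
  Set.indicator_of_notMem h _

/-- The trigonometric function rises from `α ≤ 0` at `0` to `β ≥ b` at `π/2`, so it crosses the
middle `3b/4` of the band. It is Lipschitz with constant `|α| + |β| ≤ 15/q`, so it stays in the band
on an interval around the crossing. -/
lemma integral_band_trig_ge {α β b q : ℝ} (hq : 0 < q) (hb : 0 < b) (hbq : b * q ≤ 1 / 2)
    (hα : α ≤ 0) (hβ : 1 / (2 * q) ≤ β) (hr : α ^ 2 + β ^ 2 ≤ 100 / q ^ 2) :
    b * q / 30 ≤ ∫ φ in Set.Icc (-1 : ℝ) 3, band b (α * Real.cos φ + β * Real.sin φ) := by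
  have hbβ : b ≤ β := by
    refine le_trans ?_ hβ
    rw [le_div_iff₀ (by positivity)]
    linarith
  obtain ⟨φ₀, ⟨h0, h1⟩, hφ⟩ := intermediate_value_Icc (a := 0) (b := Real.pi / 2)
    (f := fun φ => α * Real.cos φ + β * Real.sin φ) (by positivity) (by fun_prop)
    (show 3 * b / 4 ∈ Set.Icc _ _ by
      simp only [Real.cos_zero, Real.sin_zero, Real.cos_pi_div_two, Real.sin_pi_div_two]
      constructor <;> linarith)
  simp only at hφ
  have hpi := Real.pi_lt_d2
  -- The radius at which the Lipschitz bound `15/q` allows a deviation of exactly `b/4`, half the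
  -- width of the band.
  set r : ℝ := b * q / 60 with hrdef
  have hr0 : 0 < r := by positivity
  have hr1 : r ≤ 1 / 120 := by rw [hrdef]; linarith
  have hsum : |α| + |β| ≤ 15 / q := by
    rw [← pow_le_pow_iff_left₀ (by positivity) (by positivity) (n := 2) two_ne_zero]
    have h : (15 / q) ^ 2 = 225 / q ^ 2 := by rw [div_pow]; norm_num
    have h' : (225 : ℝ) / q ^ 2 = 9 / 4 * (100 / q ^ 2) := by ring
    have h'' : 0 ≤ 100 / q ^ 2 := by positivity
    rw [h, h']
    nlinarith [sq_nonneg (|α| - |β|), sq_abs α, sq_abs β]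
  have hmem : ∀ φ ∈ Set.Icc (φ₀ - r) (φ₀ + r),
      α * Real.cos φ + β * Real.sin φ ∈ Set.Icc (b / 2) b := by
    intro φ hφm
    have hd : |φ - φ₀| ≤ r := by rw [abs_le]; constructor <;> linarith [hφm.1, hφm.2]
    have h : |α * Real.cos φ + β * Real.sin φ - 3 * b / 4| ≤ b / 4 := by
      rw [← hφ]
      calc |α * Real.cos φ + β * Real.sin φ - (α * Real.cos φ₀ + β * Real.sin φ₀)|
          = |α * (Real.cos φ - Real.cos φ₀) + β * (Real.sin φ - Real.sin φ₀)| := by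
            congr 1; ring
        _ ≤ |α| * r + |β| * r := by
            refine (abs_add_le _ _).trans (add_le_add ?_ ?_)
            · rw [abs_mul]
              exact mul_le_mul_of_nonneg_left ((Real.abs_cos_sub_cos_le _ _).trans hd)
                (abs_nonneg _)
            · rw [abs_mul]
              exact mul_le_mul_of_nonneg_left ((Real.abs_sin_sub_sin_le _ _).trans hd)
                (abs_nonneg _)
        _ = (|α| + |β|) * r := by ring
        _ ≤ 15 / q * r := mul_le_mul_of_nonneg_right hsum hr0.le
        _ = b / 4 := by rw [hrdef]; field_simp; norm_num
    rw [abs_le] at h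
    constructor <;> linarith [h.1, h.2]
  have hmeas : Measurable fun φ : ℝ => band b (α * Real.cos φ + β * Real.sin φ) :=
    (measurable_band b).comp (by fun_prop)
  have hint : IntegrableOn (fun φ : ℝ => band b (α * Real.cos φ + β * Real.sin φ))
      (Set.Icc (-1 : ℝ) 3) := by
    refine Integrable.of_bound hmeas.aestronglyMeasurable 1 (Filter.Eventually.of_forall fun φ => ?_)
    rw [Real.norm_eq_abs, abs_of_nonneg (band_nonneg _ _)]
    exact band_le_one _ _
  calc b * q / 30 = ∫ φ in Set.Icc (φ₀ - r) (φ₀ + r), (1 : ℝ) := by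
        simp only [integral_const, MeasurableSet.univ, measureReal_restrict_apply, Set.univ_inter,
          Real.volume_real_Icc, smul_eq_mul, mul_one]
        rw [max_eq_left (by linarith), hrdef]
        ring
    _ = ∫ φ in Set.Icc (φ₀ - r) (φ₀ + r), band b (α * Real.cos φ + β * Real.sin φ) :=
        setIntegral_congr_fun measurableSet_Icc fun φ hφm => (band_of_mem (hmem φ hφm)).symm
    _ ≤ _ := by
        refine setIntegral_mono_set hint (Filter.Eventually.of_forall fun φ => band_nonneg _ _) ?_
        exact (Set.Icc_subset_Icc (by linarith) (by linarith)).eventuallyLE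

lemma exists_orthogonal_unit (hd : 2 ≤ d) {w : EuclideanSpace ℝ (Fin d)} (hw : ‖w‖ = 1) :
    ∃ v : EuclideanSpace ℝ (Fin d), ‖v‖ = 1 ∧ inner ℝ w v = 0 := by
  set i : Fin d := ⟨0, by omega⟩
  set j : Fin d := ⟨1, by omega⟩
  have hij : j ≠ i := by simp [i, j]
  have ho : Orthonormal ℝ (({i} : Set (Fin d)).domRestrict fun _ => w) := by
    constructor
    · rintro ⟨k, hk⟩
      exact hw
    · rintro ⟨k, rfl⟩ ⟨l, rfl⟩ hkl
      exact absurd rfl hkl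
  obtain ⟨e, he⟩ := ho.exists_orthonormalBasis_extension_of_card_eq (by simp)
  refine ⟨e j, by simp, ?_⟩
  rw [← he i (by simp)]
  exact e.orthonormal.2 hij.symm

/-- A band of width `b / 2` near the equator has probability at least a constant times `b √d`. -/
lemma integral_band_ge (hd : 2 ≤ d) {b : ℝ} (hb : 0 < b) (hbd : b * √d ≤ 1 / 2)
    {w : EuclideanSpace ℝ (Fin d)} (hw : ‖w‖ = 1) :
    b * √d / 5000 ≤ ∫ x : Sph d, band b (inner ℝ w x) ∂(uniformSphere d) := by
  have hd1 : 1 ≤ d := by omega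
  have := isProbabilityMeasure_uniformSphere (d := d) hd1
  have hd0 : (0 : ℝ) < d := by exact_mod_cast hd1
  obtain ⟨v, hv, hwv⟩ := exists_orthogonal_unit hd hw
  set G : Set (Sph d) := {x : Sph d | inner ℝ w (x : EuclideanSpace ℝ (Fin d)) ≤ 0 ∧
      1 / (2 * √d) ≤ inner ℝ v (x : EuclideanSpace ℝ (Fin d)) ∧
      inner ℝ w (x : EuclideanSpace ℝ (Fin d)) ^ 2 + inner ℝ v (x : EuclideanSpace ℝ (Fin d)) ^ 2
        ≤ 100 / d} with hG
  have hquad := measure_quadrant_ge hd hw hv hwv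
  rw [← hG] at hquad
  have mw : Measurable fun x : Sph d => inner ℝ w (x : EuclideanSpace ℝ (Fin d)) :=
    (continuous_inner_sphere w).measurable
  have mv : Measurable fun x : Sph d => inner ℝ v (x : EuclideanSpace ℝ (Fin d)) :=
    (continuous_inner_sphere v).measurable
  have hGm : MeasurableSet G := (measurableSet_le mw measurable_const).inter
    ((measurableSet_le measurable_const mv).inter
      (measurableSet_le ((mw.pow_const 2).add (mv.pow_const 2)) measurable_const))
  set f : ℝ → Sph d → ℝ := fun φ x => band b (inner ℝ w (x : EuclideanSpace ℝ (Fin d)) * Real.cos φ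
    + inner ℝ v (x : EuclideanSpace ℝ (Fin d)) * Real.sin φ) with hf
  have hfm : Measurable (Function.uncurry f) := by
    refine (measurable_band b).comp ?_
    exact ((mw.comp measurable_snd).mul (Real.measurable_cos.comp measurable_fst)).add
      ((mv.comp measurable_snd).mul (Real.measurable_sin.comp measurable_fst))
  have hfi : Integrable (Function.uncurry f)
      ((volume.restrict (Set.Icc (-1 : ℝ) 3)).prod (uniformSphere d)) := by
    refine Integrable.of_bound hfm.aestronglyMeasurable 1 (Filter.Eventually.of_forall fun z => ?_)
    rw [Real.norm_eq_abs, Function.uncurry, abs_of_nonneg (band_nonneg _ _)]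
    exact band_le_one _ _
  -- Every rotated vector `cos φ • w + sin φ • v` sees the same band probability. By Fubini that
  -- probability is an average over `x` of the time the rotation spends in the band. Only `x ∈ G` is
  -- kept, and the constants multiply to `4 · 30 · 40 = 4800`.
  have hrot : ∀ φ, ∫ x, f φ x ∂(uniformSphere d) =
      ∫ x : Sph d, band b (inner ℝ w x) ∂(uniformSphere d) := by
    intro φ
    have h := integral_inner_congr (d := d) (fun _ a => band b a) (w := 0)
      (v := Real.cos φ • w + Real.sin φ • v) (v' := w) (by
        rw [hw, ← sq_eq_sq₀ (norm_nonneg _) zero_le_one, norm_add_sq_real, norm_smul, norm_smul,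
          hw, hv, inner_smul_left, inner_smul_right, hwv]
        simp) (by simp)
    rw [← h]
    refine integral_congr_ae (Filter.Eventually.of_forall fun x => ?_)
    simp only [hf, inner_add_left, inner_smul_left, RCLike.conj_to_real]
    ring_nf
  have hswap := integral_integral_swap hfi
  simp only [hrot] at hswap
  have hleft : ∫ φ in Set.Icc (-1 : ℝ) 3, (∫ x : Sph d, band b (inner ℝ w x) ∂(uniformSphere d)) =
      4 * ∫ x : Sph d, band b (inner ℝ w x) ∂(uniformSphere d) := by
    simp only [integral_const, MeasurableSet.univ, measureReal_restrict_apply, Set.univ_inter,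
      Real.volume_real_Icc, smul_eq_mul]
    norm_num
  rw [hleft] at hswap
  have hright : b * √d / 30 * ∫ x, G.indicator (1 : Sph d → ℝ) x ∂(uniformSphere d) ≤
      ∫ x, (∫ φ in Set.Icc (-1 : ℝ) 3, f φ x) ∂(uniformSphere d) := by
    rw [← integral_const_mul]
    refine integral_mono ?_ hfi.integral_prod_right fun x => ?_
    · exact ((integrable_const (1 : ℝ)).indicator hGm).const_mul _
    · simp only
      by_cases hx : x ∈ G
      · rw [Set.indicator_of_mem hx, Pi.one_apply, mul_one]
        obtain ⟨h1, h2, h3⟩ := hx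
        refine integral_band_trig_ge (Real.sqrt_pos.2 hd0) hb hbd h1 h2 ?_
        rwa [Real.sq_sqrt hd0.le]
      · rw [Set.indicator_of_notMem hx, mul_zero]
        exact integral_nonneg fun φ => band_nonneg _ _
  have hbq : 0 ≤ b * √d / 30 := by positivity
  have := mul_le_mul_of_nonneg_left hquad hbq
  linarith

end BandLower

/-! ### Drift and exponential moment of a single update -/

section OneStep

variable {d : ℕ}

/-- A unit vector `u` is a combination of the unit vector `w` and a unit vector orthogonal to
`w`. -/
lemma exists_orthogonal_decomposition (hd : 2 ≤ d) {w u : EuclideanSpace ℝ (Fin d)}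
    (hw : ‖w‖ = 1) (hu : ‖u‖ = 1) :
    ∃ (v : EuclideanSpace ℝ (Fin d)) (s : ℝ), ‖v‖ = 1 ∧ inner ℝ w v = 0 ∧ 0 ≤ s ∧
      s ^ 2 = 1 - inner ℝ w u ^ 2 ∧ u = (inner ℝ w u : ℝ) • w + s • v := by
  set c : ℝ := inner ℝ w u with hc
  set z := u - c • w with hz
  have hwz : inner ℝ w z = 0 := by
    rw [hz, inner_sub_right, inner_smul_right, real_inner_self_eq_norm_sq, hw]
    simp [hc]
  have hzn : ‖z‖ ^ 2 = 1 - c ^ 2 := by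
    rw [hz, norm_sub_sq_real, norm_smul, inner_smul_right, real_inner_comm, ← hc, hw, hu]
    simp only [Real.norm_eq_abs, mul_one, sq_abs]
    ring
  rcases eq_or_ne z 0 with h0 | h0
  · obtain ⟨v, hv, hwv⟩ := exists_orthogonal_unit hd hw
    refine ⟨v, 0, hv, hwv, le_rfl, ?_, ?_⟩
    · rw [← hzn, h0]; simp
    · rw [zero_smul, add_zero]; exact sub_eq_zero.1 h0
  · have hn : ‖z‖ ≠ 0 := norm_ne_zero_iff.2 h0
    refine ⟨‖z‖⁻¹ • z, ‖z‖, ?_, ?_, norm_nonneg _, hzn, ?_⟩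
    · rw [norm_smul, norm_inv, norm_norm, inv_mul_cancel₀ hn]
    · rw [inner_smul_right, hwz, mul_zero]
    · rw [smul_smul, mul_inv_cancel₀ hn, one_smul, hz]; abel

lemma band_ne_zero_iff {b s : ℝ} : band b s ≠ 0 ↔ s ∈ Set.Icc (b / 2) b := by
  by_cases h : s ∈ Set.Icc (b / 2) b
  · simp [band_of_mem h, h]
  · simp [band_of_notMem h, h]

/-- `π` is the probability of a negative label under `η`-bounded noise. -/
structure IsNoisyNegative (π : Sph d → ℝ) (u : EuclideanSpace ℝ (Fin d)) (η : ℝ) : Prop where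
  measurable : Measurable π
  nonneg : ∀ x, 0 ≤ π x
  le_one : ∀ x, π x ≤ 1
  noise : ∀ᵐ x : Sph d ∂(uniformSphere d), (0 ≤ inner ℝ u (x : EuclideanSpace ℝ (Fin d)) → π x ≤ η) ∧
    (inner ℝ u (x : EuclideanSpace ℝ (Fin d)) < 0 → 1 - η ≤ π x)

lemma band_mul_le_of_mem {b s A B : ℝ} (h : s ∈ Set.Icc (b / 2) b → A ≤ B) :
    band b s * A ≤ band b s * B := by
  by_cases hs : s ∈ Set.Icc (b / 2) b
  · exact mul_le_mul_of_nonneg_left (h hs) (band_nonneg _ _)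
  · simp [band_of_notMem hs]

lemma integrable_band_mul (hd : 1 ≤ d) (b : ℝ) (w : EuclideanSpace ℝ (Fin d)) {f : Sph d → ℝ}
    (hf : Measurable f) (C : ℝ) (hC : ∀ x, |f x| ≤ C) :
    Integrable (fun x : Sph d => band b (inner ℝ w x) * f x) (uniformSphere d) := by
  refine integrable_of_measurable_bounded hd
    (((measurable_band b).comp (continuous_inner_sphere w).measurable).mul hf) C fun x => ?_
  rw [abs_mul, abs_of_nonneg (band_nonneg _ _)]
  exact (mul_le_of_le_one_left (abs_nonneg _) (band_le_one _ _)).trans (hC x)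

/-- In both cases of the noise condition `pγ ≤ ηγ - (1 - 2η)γ⁻`. The gain uses `a ≥ b/2` and the
losses use `a ≤ b`. The term `b²/2` is `ηb²` from the `η c a²` part plus `(1 - 2η)b²/2` from
replacing `γ⁻` by `sβ⁻ - b`. -/
lemma drift_pointwise {η b s c a β γ p : ℝ} (hη0 : 0 ≤ η) (hη : η < 1 / 2) (hc1 : |c| ≤ 1)
    (ha1 : b / 2 ≤ a) (ha2 : a ≤ b) (hγ : γ = c * a + s * β)
    (hx1 : 0 ≤ γ → p ≤ η) (hx2 : γ < 0 → 1 - η ≤ p) :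
    p * (a * γ) ≤ b ^ 2 / 2 - (1 - 2 * η) * (b / 2) * s * max (-β) 0 + η * s * (a * β) := by
  have hb0 : 0 ≤ b := by linarith
  have ha0 : 0 ≤ a := by linarith
  have hpγ : p * γ ≤ η * γ - (1 - 2 * η) * max (-γ) 0 := by
    rcases le_or_gt 0 γ with h | h
    · rw [max_eq_right (by linarith)]
      have := mul_le_mul_of_nonneg_right (hx1 h) h
      linarith
    · rw [max_eq_left (by linarith)]
      have := mul_le_mul_of_nonpos_right (hx2 h) h.le
      linarith
  have hca : c * a ≤ b := by
    have := mul_le_mul_of_nonneg_right (abs_le.1 hc1).2 ha0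
    linarith
  have hmax : s * max (-β) 0 - b ≤ max (-γ) 0 := by
    rw [hγ]
    rcases le_total 0 (-β) with h | h
    · rw [max_eq_left h]
      refine le_trans ?_ (le_max_left _ _)
      linarith
    · rw [max_eq_right h]
      refine le_trans ?_ (le_max_right _ _)
      linarith
  have hκ : 0 ≤ 1 - 2 * η := by linarith
  have hstep1 : p * (a * γ) ≤ a * (η * γ) - (1 - 2 * η) * (b / 2) * max (-γ) 0 := by
    have h1 := mul_le_mul_of_nonneg_left hpγ ha0
    have h2 := mul_le_mul_of_nonneg_right ha1 (mul_nonneg hκ (le_max_right (-γ) 0))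
    linarith
  have hstep2 : (1 - 2 * η) * (b / 2) * (s * max (-β) 0 - b) ≤
      (1 - 2 * η) * (b / 2) * max (-γ) 0 :=
    mul_le_mul_of_nonneg_left hmax (mul_nonneg hκ (by linarith))
  have hstep3 : a * (η * γ) ≤ η * b ^ 2 + η * s * (a * β) := by
    have h1 : c * a * a ≤ b * b := mul_le_mul hca ha2 ha0 hb0
    have h2 := mul_le_mul_of_nonneg_left h1 hη0
    rw [hγ]
    linarith
  linarith

/-- The expected change of `⟪w, u⟫` in one update, up to the factor `-2`. -/
lemma integral_drift_le (hd : 2 ≤ d) {π : Sph d → ℝ} {w u : EuclideanSpace ℝ (Fin d)} {η b s : ℝ}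
    (hπ : IsNoisyNegative π u η) (hη0 : 0 ≤ η) (hη : η < 1 / 2)
    (hw : ‖w‖ = 1) (hu : ‖u‖ = 1) (hb : 0 < b) (hb2 : b ^ 2 ≤ 1 / 50)
    (hs : 0 ≤ s) (hsc : s ^ 2 = 1 - inner ℝ w u ^ 2) :
    ∫ x : Sph d, band b (inner ℝ w x) * (π x * (inner ℝ w x * inner ℝ u x)) ∂(uniformSphere d) ≤
      (∫ x : Sph d, band b (inner ℝ w x) ∂(uniformSphere d)) *
        (b ^ 2 / 2 - (1 - 2 * η) * (b / 2) * (s / (4 * √d))) := by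
  have hd1 : 1 ≤ d := by omega
  obtain ⟨v, s', hv, hwv, hs', hsc', hdec⟩ := exists_orthogonal_decomposition hd hw hu
  obtain rfl : s = s' := by
    rw [← sq_eq_sq₀ hs hs', hsc, hsc']
  set c : ℝ := inner ℝ w u with hc
  have hc1 : |c| ≤ 1 := by rw [← sq_le_one_iff_abs_le_one]; nlinarith [sq_nonneg s]
  have hmeas : ∀ z : EuclideanSpace ℝ (Fin d),
      Measurable fun x : Sph d => inner ℝ z (x : EuclideanSpace ℝ (Fin d)) := fun z =>
    (continuous_inner_sphere z).measurable
  have hbd : ∀ (z : EuclideanSpace ℝ (Fin d)) (x : Sph d), ‖z‖ = 1 →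
      |inner ℝ z (x : EuclideanSpace ℝ (Fin d))| ≤ 1 := fun z x hz =>
    (abs_inner_sphere_le z x).trans hz.le
  have i0 : Integrable (fun x : Sph d => band b (inner ℝ w x)) (uniformSphere d) := by
    simpa using integrable_band_mul hd1 b w (f := fun _ => 1) measurable_const 1 (by simp)
  have i1 : Integrable (fun x : Sph d => band b (inner ℝ w x) * max (-inner ℝ v x) 0)
      (uniformSphere d) :=
    integrable_weight_mul hd1 (measurable_band b) (band_nonneg b) (band_le_one b) w (by fun_prop)
  have i2 : Integrable (fun x : Sph d => band b (inner ℝ w x) * (inner ℝ w x * inner ℝ v x))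
      (uniformSphere d) :=
    integrable_weight_mul hd1 (measurable_band b) (band_nonneg b) (band_le_one b) w (by fun_prop)
  have hneg := weighted_neg_part_moment hd (measurable_band b) (band_nonneg b) (band_le_one b)
    (fun a ha => by
      obtain ⟨h1, h2⟩ := band_ne_zero_iff.1 ha
      nlinarith) hw hv hwv
  set p := ∫ x : Sph d, band b (inner ℝ w x) ∂(uniformSphere d) with hp
  have hmain : ∫ x : Sph d, band b (inner ℝ w x) * (π x * (inner ℝ w x * inner ℝ u x))
      ∂(uniformSphere d) ≤
      ∫ x : Sph d, (b ^ 2 / 2 * band b (inner ℝ w x)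
        - (1 - 2 * η) * (b / 2) * s * (band b (inner ℝ w x) * max (-inner ℝ v x) 0)
        + η * s * (band b (inner ℝ w x) * (inner ℝ w x * inner ℝ v x))) ∂(uniformSphere d) := by
    refine integral_mono_ae (integrable_band_mul hd1 b w
      (hπ.measurable.mul ((hmeas w).mul (hmeas u))) 1 fun x => ?_)
      (((i0.const_mul _).sub (i1.const_mul _)).add (i2.const_mul _)) ?_
    · rw [abs_mul, abs_mul, abs_of_nonneg (hπ.nonneg x)]
      have h1 := hbd w x hw
      have h2 := hbd u x hu
      have h3 := hπ.le_one x
      have h4 := hπ.nonneg x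
      calc _ ≤ (1 : ℝ) * (1 * 1) := by gcongr
        _ = 1 := by norm_num
    · filter_upwards [hπ.noise] with x hx
      obtain ⟨hx1, hx2⟩ := hx
      have hux : inner ℝ u (x : EuclideanSpace ℝ (Fin d)) =
          c * inner ℝ w (x : EuclideanSpace ℝ (Fin d))
            + s * inner ℝ v (x : EuclideanSpace ℝ (Fin d)) := by
        conv_lhs => rw [hdec]
        simp [inner_add_left, inner_smul_left]
      set a := inner ℝ w (x : EuclideanSpace ℝ (Fin d)) with ha
      set β := inner ℝ v (x : EuclideanSpace ℝ (Fin d)) with hβ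
      set γ := inner ℝ u (x : EuclideanSpace ℝ (Fin d)) with hγ
      have hgoal : band b a * (π x * (a * γ)) ≤ band b a * (b ^ 2 / 2
          - (1 - 2 * η) * (b / 2) * s * max (-β) 0 + η * s * (a * β)) := by
        refine band_mul_le_of_mem fun hmem => ?_
        exact drift_pointwise hη0 hη hc1 hmem.1 hmem.2 hux hx1 hx2
      calc _ ≤ _ := hgoal
        _ = _ := by ring
  -- The remaining noise term is a multiple of the cross moment of `w` and `v`, so it integrates to
  -- zero.
  have e : ∫ x : Sph d, (b ^ 2 / 2 * band b (inner ℝ w x)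
        - (1 - 2 * η) * (b / 2) * s * (band b (inner ℝ w x) * max (-inner ℝ v x) 0)
        + η * s * (band b (inner ℝ w x) * (inner ℝ w x * inner ℝ v x))) ∂(uniformSphere d) =
      b ^ 2 / 2 * p - (1 - 2 * η) * (b / 2) * s *
        ∫ x : Sph d, band b (inner ℝ w x) * max (-inner ℝ v x) 0 ∂(uniformSphere d) := by
    have j1 := i0.const_mul (b ^ 2 / 2)
    have j2 := i1.const_mul ((1 - 2 * η) * (b / 2) * s)
    have j3 : Integrable (fun x : Sph d => b ^ 2 / 2 * band b (inner ℝ w x)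
        - (1 - 2 * η) * (b / 2) * s * (band b (inner ℝ w x) * max (-inner ℝ v x) 0))
        (uniformSphere d) := j1.sub j2
    rw [integral_add j3 (i2.const_mul _), integral_sub j1 j2, integral_const_mul,
      integral_const_mul, integral_const_mul, weighted_cross_moment (band b) hwv]
    ring
  rw [e] at hmain
  refine hmain.trans ?_
  have hk : 0 ≤ (1 - 2 * η) * (b / 2) * s :=
    mul_nonneg (mul_nonneg (by linarith) (by linarith)) hs
  have := mul_le_mul_of_nonneg_left hneg hk
  have e2 : (1 - 2 * η) * (b / 2) * s * (1 / (4 * √(d : ℝ)) * p) =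
    p * ((1 - 2 * η) * (b / 2) * (s / (4 * √d))) := by ring
  rw [e2] at this
  linarith

lemma norm_sub_sq_eq {w u : EuclideanSpace ℝ (Fin d)} (hw : ‖w‖ = 1) (hu : ‖u‖ = 1) :
    ‖u - w‖ ^ 2 = 2 * (1 - inner ℝ w u) := by
  rw [norm_sub_sq_real, hw, hu, real_inner_comm]; ring

/-- Since `⟪u, x⟫ = ⟪w, x⟫ + ⟪u - w, x⟫`, its size in the band is at most `b + ‖u - w‖`, and `‖u -
w‖² = 2(1 - ⟪w, u⟫)`. The size of an update is therefore proportional to the current angle, up to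
`b`. -/
lemma abs_inner_le_of_band {w u : EuclideanSpace ℝ (Fin d)} {b G : ℝ} (hw : ‖w‖ = 1)
    (hu : ‖u‖ = 1) (hb : 0 < b) (hG0 : b ≤ G)
    (hG : 2 * (1 - inner ℝ w u) ≤ (G - b) ^ 2) (x : Sph d)
    (hx : inner ℝ w (x : EuclideanSpace ℝ (Fin d)) ∈ Set.Icc (b / 2) b) :
    |inner ℝ u (x : EuclideanSpace ℝ (Fin d))| ≤ G := by
  have h1 : ‖u - w‖ ≤ G - b := by
    rw [← pow_le_pow_iff_left₀ (norm_nonneg _) (by linarith) two_ne_zero, norm_sub_sq_eq hw hu]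
    exact hG
  have h2 : inner ℝ u (x : EuclideanSpace ℝ (Fin d)) =
      inner ℝ w (x : EuclideanSpace ℝ (Fin d)) + inner ℝ (u - w) (x : EuclideanSpace ℝ (Fin d)) := by
    rw [inner_sub_left]; ring
  rw [h2]
  have h3 : |inner ℝ w (x : EuclideanSpace ℝ (Fin d))| ≤ b := by
    rw [abs_le]; constructor <;> linarith [hx.1, hx.2]
  have h4 := abs_inner_sphere_le (u - w) x
  exact (abs_add_le _ _).trans (by linarith)

/-- The exponential moment of one update. -/
lemma integral_exp_update_le (hd : 2 ≤ d) {π : Sph d → ℝ} {w u : EuclideanSpace ℝ (Fin d)}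
    {η b s lam G : ℝ}
    (hπ : IsNoisyNegative π u η) (hη0 : 0 ≤ η) (hη : η < 1 / 2)
    (hw : ‖w‖ = 1) (hu : ‖u‖ = 1) (hb : 0 < b) (hb2 : b ^ 2 ≤ 1 / 50)
    (hs : 0 ≤ s) (hsc : s ^ 2 = 1 - inner ℝ w u ^ 2) (hG0 : b ≤ G)
    (hG : 2 * (1 - inner ℝ w u) ≤ (G - b) ^ 2) (hlam : 0 ≤ lam) (hsmall : 2 * lam * b * G ≤ 1) :
    ∫ x : Sph d, band b (inner ℝ w x) *
        (1 - π x + π x * Real.exp (2 * lam * (inner ℝ w x * inner ℝ u x))) ∂(uniformSphere d) ≤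
      (∫ x : Sph d, band b (inner ℝ w x) ∂(uniformSphere d)) *
        (1 + lam * b ^ 2 - lam * (1 - 2 * η) * b * s / (4 * √d) + (2 * lam * b * G) ^ 2) := by
  have hd1 : 1 ≤ d := by omega
  have hmeas : ∀ z : EuclideanSpace ℝ (Fin d),
      Measurable fun x : Sph d => inner ℝ z (x : EuclideanSpace ℝ (Fin d)) := fun z =>
    (continuous_inner_sphere z).measurable
  have hbd : ∀ (z : EuclideanSpace ℝ (Fin d)) (x : Sph d), ‖z‖ = 1 →
      |inner ℝ z (x : EuclideanSpace ℝ (Fin d))| ≤ 1 := fun z x hz =>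
    (abs_inner_sphere_le z x).trans hz.le
  have hprod : ∀ x : Sph d, |inner ℝ w (x : EuclideanSpace ℝ (Fin d)) *
      inner ℝ u (x : EuclideanSpace ℝ (Fin d))| ≤ 1 := fun x => by
    rw [abs_mul]
    exact mul_le_one₀ (hbd w x hw) (abs_nonneg _) (hbd u x hu)
  have i0 : Integrable (fun x : Sph d => band b (inner ℝ w x)) (uniformSphere d) := by
    simpa using integrable_band_mul hd1 b w (f := fun _ => 1) measurable_const 1 (by simp)
  have i1 : Integrable (fun x : Sph d => band b (inner ℝ w x) *
      (π x * (inner ℝ w x * inner ℝ u x))) (uniformSphere d) :=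
    integrable_band_mul hd1 b w (hπ.measurable.mul ((hmeas w).mul (hmeas u))) 1 fun x => by
      rw [abs_mul, abs_of_nonneg (hπ.nonneg x)]
      exact mul_le_one₀ (hπ.le_one x) (abs_nonneg _) (hprod x)
  have hdrift := integral_drift_le hd hπ hη0 hη hw hu hb hb2 hs hsc
  set p := ∫ x : Sph d, band b (inner ℝ w x) ∂(uniformSphere d) with hp
  have hmain : ∫ x : Sph d, band b (inner ℝ w x) *
        (1 - π x + π x * Real.exp (2 * lam * (inner ℝ w x * inner ℝ u x))) ∂(uniformSphere d) ≤
      ∫ x : Sph d, ((1 + (2 * lam * b * G) ^ 2) * band b (inner ℝ w x) +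
        2 * lam * (band b (inner ℝ w x) * (π x * (inner ℝ w x * inner ℝ u x))))
        ∂(uniformSphere d) := by
    refine integral_mono (integrable_band_mul hd1 b w ?_ (1 + Real.exp (2 * lam)) fun x => ?_)
      ((i0.const_mul _).add (i1.const_mul _)) fun x => ?_
    · exact (measurable_const.sub hπ.measurable).add (hπ.measurable.mul
        (Real.measurable_exp.comp (((hmeas w).mul (hmeas u)).const_mul _)))
    · have h1 := hπ.nonneg x
      have h2 := hπ.le_one x
      have h3 : Real.exp (2 * lam * (inner ℝ w (x : EuclideanSpace ℝ (Fin d)) *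
          inner ℝ u (x : EuclideanSpace ℝ (Fin d)))) ≤ Real.exp (2 * lam) := by
        refine Real.exp_le_exp.2 ?_
        have := (abs_le.1 (hprod x)).2
        nlinarith
      have h4 := Real.exp_pos (2 * lam * (inner ℝ w (x : EuclideanSpace ℝ (Fin d)) *
          inner ℝ u (x : EuclideanSpace ℝ (Fin d))))
      rw [abs_of_nonneg (add_nonneg (by linarith) (by positivity))]
      nlinarith
    · have hgoal : band b (inner ℝ w (x : EuclideanSpace ℝ (Fin d))) *
          (1 - π x + π x * Real.exp (2 * lam * (inner ℝ w (x : EuclideanSpace ℝ (Fin d)) *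
            inner ℝ u (x : EuclideanSpace ℝ (Fin d))))) ≤
          band b (inner ℝ w (x : EuclideanSpace ℝ (Fin d))) * ((1 + (2 * lam * b * G) ^ 2)
            + 2 * lam * (π x * (inner ℝ w (x : EuclideanSpace ℝ (Fin d)) *
            inner ℝ u (x : EuclideanSpace ℝ (Fin d))))) := by
        refine band_mul_le_of_mem fun hmem => ?_
        have hγ := abs_inner_le_of_band hw hu hb hG0 hG x hmem
        set a := inner ℝ w (x : EuclideanSpace ℝ (Fin d)) with ha
        set γ := inner ℝ u (x : EuclideanSpace ℝ (Fin d)) with hγd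
        set z := 2 * lam * (a * γ) with hz
        have hza : |z| ≤ 2 * lam * b * G := by
          rw [hz, abs_mul, abs_mul, abs_mul, abs_of_nonneg hlam, abs_two,
            abs_of_nonneg (show 0 ≤ a by linarith [hmem.1])]
          have h := mul_le_mul hmem.2 hγ (abs_nonneg _) hb.le
          calc 2 * lam * (a * |γ|) ≤ 2 * lam * (b * G) :=
                mul_le_mul_of_nonneg_left h (by positivity)
            _ = _ := by ring
        -- `exp z ≤ 1 + z + z²` for `|z| ≤ 1`. The linear term becomes the drift and the quadratic
        -- term is bounded uniformly.
        have hexp := (abs_le.1 (Real.abs_exp_sub_one_sub_id_le (hza.trans hsmall))).2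
        have hz2 : z ^ 2 ≤ (2 * lam * b * G) ^ 2 := by
          rw [← sq_abs z]; gcongr
        have h1 := hπ.nonneg x
        have h2 := hπ.le_one x
        have h3 : π x * Real.exp z ≤ π x * (1 + z + (2 * lam * b * G) ^ 2) :=
          mul_le_mul_of_nonneg_left (by linarith) h1
        have h4 : π x * (2 * lam * b * G) ^ 2 ≤ (2 * lam * b * G) ^ 2 :=
          mul_le_of_le_one_left (by positivity) h2
        have h5 : 2 * lam * (π x * (a * γ)) = π x * z := by rw [hz]; ring
        rw [h5]
        linarith
      calc _ ≤ _ := hgoal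
        _ = _ := by ring
  rw [integral_add (i0.const_mul _) (i1.const_mul _), integral_const_mul, integral_const_mul]
    at hmain
  refine hmain.trans ?_
  have := mul_le_mul_of_nonneg_left hdrift (show 0 ≤ 2 * lam by positivity)
  refine (add_le_add_right this _).trans (le_of_eq ?_)
  ring

/-- In the region where the angle is neither small nor large, the exponential potential decreases
by a constant factor in expectation. -/
lemma integral_exp_update_le_of_mem (hd : 2 ≤ d) {π : Sph d → ℝ}
    {w u : EuclideanSpace ℝ (Fin d)} {η b lam r : ℝ}
    (hπ : IsNoisyNegative π u η) (hη0 : 0 ≤ η) (hη : η < 1 / 2)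
    (hw : ‖w‖ = 1) (hu : ‖u‖ = 1) (hb : 0 < b) (hr : 0 < r) (hr1 : r ≤ 1) (hlam : 0 ≤ lam)
    (hbr : b ≤ (1 - 2 * η) * r / (1000000 * √d))
    (hlb : lam * b * r ≤ (1 - 2 * η) / (10000 * √d))
    (hlow : r ^ 2 / 8 ≤ 1 - inner ℝ w u) (hhigh : 1 - inner ℝ w u ≤ 3 * r ^ 2 / 2) :
    ∫ x : Sph d, band b (inner ℝ w x) *
        (1 - π x + π x * Real.exp (2 * lam * (inner ℝ w x * inner ℝ u x))) ∂(uniformSphere d) ≤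
      (∫ x : Sph d, band b (inner ℝ w x) ∂(uniformSphere d)) *
        (1 - lam * b * r * (1 - 2 * η) / (32 * √d)) := by
  set c : ℝ := inner ℝ w u with hc
  have hd0 : (1 : ℝ) ≤ d := by exact_mod_cast (by omega : 1 ≤ d)
  have hq : 1 ≤ √(d : ℝ) := Real.one_le_sqrt.2 hd0
  have hq0 : 0 < √(d : ℝ) := by linarith
  have hκ : 0 < 1 - 2 * η := by linarith
  have hb' : b ≤ r / 1000000 := by
    refine hbr.trans ?_
    rw [div_le_div_iff₀ (by positivity) (by norm_num)]
    nlinarith [mul_nonneg hη0 hr.le, mul_nonneg (sub_nonneg.2 hq) hr.le]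
  have hlb' : lam * b * r ≤ 1 / 10000 := by
    refine hlb.trans ?_
    rw [div_le_div_iff₀ (by positivity) (by norm_num)]
    nlinarith
  have hlbr0 : 0 ≤ lam * b * r := by positivity
  -- `1 - c² = (1 - c)(1 + c)`, where the upper bound on `1 - c` together with `r ≤ 1` keeps `1 + c
  -- ≥ 1/2`.
  have hs2 : r ^ 2 / 16 ≤ 1 - c ^ 2 := by
    have hr2 : r ^ 2 ≤ 1 := pow_le_one₀ hr.le hr1
    have := mul_nonneg (show 0 ≤ 1 - c by linarith [sq_nonneg r])
      (show 0 ≤ c + 1 / 2 by linarith)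
    linarith
  have hsr : r / 4 ≤ √(1 - c ^ 2) := by
    refine Real.le_sqrt_of_sq_le ?_
    linarith [show (r / 4) ^ 2 = r ^ 2 / 16 by ring]
  -- `G = 2r` is admissible because `2(1 - c) ≤ 3r² ≤ (7r/4)²` and `b` is tiny compared with `r`.
  have h := integral_exp_update_le (G := 2 * r) (s := √(1 - c ^ 2)) hd hπ hη0 hη hw hu hb
    (by nlinarith) (Real.sqrt_nonneg _) (Real.sq_sqrt (by nlinarith)) (by linarith)
    (by
      have : (7 / 4 * r) ^ 2 ≤ (2 * r - b) ^ 2 := by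
        refine pow_le_pow_left₀ (by positivity) ?_ 2
        linarith
      nlinarith) hlam (by nlinarith)
  refine h.trans (mul_le_mul_of_nonneg_left ?_ (integral_nonneg fun x => band_nonneg _ _))
  -- With `X = λbr(1 - 2η)/√d`, the curvature, drift and quadratic terms are at most `X/10⁶`,
  -- `-X/16` and `X/625`, and their sum is below `-X/32`.
  have e1 : lam * b ^ 2 ≤ lam * b * r * (1 - 2 * η) / √d / 1000000 := by
    have := mul_le_mul_of_nonneg_left hbr (show 0 ≤ lam * b by positivity)
    calc lam * b ^ 2 = lam * b * b := by ring
      _ ≤ _ := this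
      _ = _ := by field_simp
  have e2 : lam * b * r * (1 - 2 * η) / √d / 16 ≤
      lam * (1 - 2 * η) * b * √(1 - c ^ 2) / (4 * √d) := by
    have h1 : lam * b * r * (1 - 2 * η) / √d / 16 =
      lam * (1 - 2 * η) * b * (r / 4) / (4 * √d) := by field_simp; norm_num
    rw [h1]
    gcongr
  have e3 : (2 * lam * b * (2 * r)) ^ 2 ≤ lam * b * r * (1 - 2 * η) / √d / 625 := by
    have := mul_le_mul_of_nonneg_left hlb hlbr0
    calc (2 * lam * b * (2 * r)) ^ 2 = 16 * (lam * b * r * (lam * b * r)) := by ring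
      _ ≤ 16 * (lam * b * r * ((1 - 2 * η) / (10000 * √d))) := by linarith
      _ = _ := by field_simp; ring
  have e4 : lam * b * r * (1 - 2 * η) / (32 * √d) = lam * b * r * (1 - 2 * η) / √d / 32 := by
    field_simp
  have e5 : 0 ≤ lam * b * r * (1 - 2 * η) / √d := by positivity
  rw [e4]
  linarith

end OneStep

/-! ### Values and costs of the vector subroutines -/

namespace RAM

variable {d : ℕ}

lemma bind_run {α β : Type} (x : RAM d α) (f : α → RAM d β) (ω : ℕ → Sph d × Label)
    (L : Ledger) : (x >>= f) ω L = f (x ω L).1 ω (x ω L).2 := rfl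

lemma pure_run {α : Type} (a : α) (ω : ℕ → Sph d × Label) (L : Ledger) :
    (pure a : RAM d α) ω L = (a, L) := rfl

lemma dot_fold_run (v x : Fin d → ℝ) (ω : ℕ → Sph d × Label) (l : List (Fin d)) (acc : ℝ)
    (L : Ledger) :
    (l.foldlM (m := fun α => RAM d α) (fun a i => do
      tick
      (do let p ← load v i
          let q ← load x i
          let r ← mul p q
          add a r : RAM d ℝ)) acc) ω L =
      (acc + (l.map fun i => v i * x i).sum, { L with time := L.time + 5 * l.length }) := by
  induction l generalizing acc L with
  | nil => simp [pure_run]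
  | cons i l ih =>
    rw [List.foldlM_cons, bind_run, ih]
    simp only [bind_run, tick, load, mul, add, pure_run, List.map_cons, List.sum_cons,
      List.length_cons]
    refine Prod.ext ?_ ?_
    · exact add_assoc _ _ _
    · simp only [Ledger.mk.injEq, and_true]
      ring

lemma dot_run (v x : Fin d → ℝ) (ω : ℕ → Sph d × Label) (L : Ledger) :
    dot v x ω L = (∑ i, v i * x i, { L with time := L.time + 5 * d }) := by
  have h := dot_fold_run v x ω (List.finRange d) 0 L
  rw [zero_add, ← List.ofFn_eq_map, List.sum_ofFn, List.length_finRange] at h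
  exact h

/-- The list must have no duplicates because the vector is overwritten in place: a repeated
coordinate would be reduced twice. -/
lemma subScaled_fold_run (c : ℝ) (x : Fin d → ℝ) (ω : ℕ → Sph d × Label) (l : List (Fin d))
    (hl : l.Nodup) (v : Fin d → ℝ) (L : Ledger) :
    (l.foldlM (m := fun α => RAM d α) (fun v' i => do
      tick
      (do let p ← load v' i
          let q ← load x i
          let r ← mul c q
          let s ← sub p r
          store v' i s : RAM d (Fin d → ℝ))) v) ω L =
      (fun j => if j ∈ l then v j - c * x j else v j,
        { L with time := L.time + 6 * l.length }) := by
  induction l generalizing v L with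
  | nil => simp [pure_run]
  | cons i l ih =>
    rw [List.nodup_cons] at hl
    rw [List.foldlM_cons, bind_run, ih hl.2]
    simp only [bind_run, tick, load, mul, sub, store, pure_run,
      List.length_cons, List.mem_cons]
    refine Prod.ext ?_ ?_
    · funext j
      by_cases hj : j = i
      · subst hj
        simp [hl.1]
      · simp [hj]
    · simp only [Ledger.mk.injEq, and_true]
      ring

lemma subScaled_run (v : Fin d → ℝ) (c : ℝ) (x : Fin d → ℝ) (ω : ℕ → Sph d × Label)
    (L : Ledger) :
    subScaled v c x ω L = (fun j => v j - c * x j, { L with time := L.time + 6 * d }) := by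
  have h := subScaled_fold_run c x ω (List.finRange d) (List.nodup_finRange d) v L
  simp only [List.mem_finRange, if_true, List.length_finRange] at h
  exact h

end RAM

/-! ### Reduction of the program to a deterministic recursion on the sphere -/

section PureChain

variable {d : ℕ}

/-- The reflection of `w` in the hyperplane orthogonal to `x`. -/
noncomputable def reflectSphere (w x : Sph d) : Sph d :=
  ⟨(w : EuclideanSpace ℝ (Fin d)) - (2 * inner ℝ (w : EuclideanSpace ℝ (Fin d))
      (x : EuclideanSpace ℝ (Fin d))) • (x : EuclideanSpace ℝ (Fin d)), by
    have hw : ‖(w : EuclideanSpace ℝ (Fin d))‖ = 1 := by simp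
    have hx : ‖(x : EuclideanSpace ℝ (Fin d))‖ = 1 := by simp
    rw [mem_sphere_zero_iff_norm, ← sq_eq_sq₀ (norm_nonneg _) zero_le_one, norm_sub_sq_real,
      norm_smul, inner_smul_right, hw, hx]
    simp only [Real.norm_eq_abs, mul_one, sq_abs]
    ring⟩

lemma inner_reflectSphere (w x : Sph d) (u : EuclideanSpace ℝ (Fin d)) :
    inner ℝ (reflectSphere w x : EuclideanSpace ℝ (Fin d)) u =
      inner ℝ (w : EuclideanSpace ℝ (Fin d)) u -
        2 * (inner ℝ (w : EuclideanSpace ℝ (Fin d)) (x : EuclideanSpace ℝ (Fin d)) *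
          inner ℝ u (x : EuclideanSpace ℝ (Fin d))) := by
  simp only [reflectSphere, inner_sub_left, inner_smul_left, RCLike.conj_to_real]
  rw [real_inner_comm u (x : EuclideanSpace ℝ (Fin d))]
  ring

open Classical in
/-- The effect of one pass of the main loop on the iteration number and the iterate. -/
noncomputable def chainStep (m : ℕ) (b : ℝ) (s : ℕ × Sph d) (z : Sph d × Label) : ℕ × Sph d :=
  if m ≤ s.1 then s
  else if inner ℝ (s.2 : EuclideanSpace ℝ (Fin d)) (z.1 : EuclideanSpace ℝ (Fin d))
      ∈ Set.Icc (b / 2) b then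
    (s.1 + 1, if z.2 = true then s.2 else reflectSphere s.2 z.1)
  else s

/-- The iteration number and the iterate after `n` passes in the environment `ω`. -/
noncomputable def chain (m : ℕ) (b : ℝ) (w₀ : Sph d) (ω : ℕ → Sph d × Label) : ℕ → ℕ × Sph d
  | 0 => (0, w₀)
  | n + 1 => chainStep m b (chain m b w₀ ω n) (ω n)

lemma chain_fst_le (m : ℕ) (b : ℝ) (w₀ : Sph d) (ω : ℕ → Sph d × Label) (n : ℕ) :
    (chain m b w₀ ω n).1 ≤ m := by
  induction n with
  | zero => simp [chain]
  | succ n ih =>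
    rw [chain, chainStep]
    split
    · exact ih
    · split
      · simp only; omega
      · exact ih

/-- The coordinates of a point of the sphere. -/
def coords (w : Sph d) : Fin d → ℝ := fun i => (w : EuclideanSpace ℝ (Fin d)) i

lemma sum_coords_mul (w x : Sph d) : ∑ i, coords w i * coords x i =
    inner ℝ (w : EuclideanSpace ℝ (Fin d)) (x : EuclideanSpace ℝ (Fin d)) := by
  rw [PiLp.inner_apply]
  exact Finset.sum_congr rfl fun i _ => by simp [coords, mul_comm]

/-- Inside the band `⟪w, x⟫ > 0`, so the mistake test of the program is the test for a negative
label used in `chainStep`. The costliest pass spends `d` on the draw, `5d` on the inner product,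
`6d` on the update and `9` on scalar work. -/
lemma perceptronPass_run {m : ℕ} {b : ℝ} (hb : 0 < b) (s : ℕ × Sph d) (hs : s.1 ≤ m)
    (ω : ℕ → Sph d × Label) (L : Ledger) (hL : L.labels = s.1) :
    ∃ L' : Ledger,
      perceptronPass m b ⟨s.1, coords s.2, decide (s.1 = m)⟩ ω L =
        (⟨(chainStep m b s (ω L.draws)).1, coords (chainStep m b s (ω L.draws)).2,
          decide ((chainStep m b s (ω L.draws)).1 = m)⟩, L') ∧
      L'.labels = (chainStep m b s (ω L.draws)).1 ∧
      (s.1 = m → L' = L) ∧ (s.1 < m → L'.draws = L.draws + 1) ∧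
      L'.time ≤ L.time + (12 * d + 9) := by
  obtain ⟨t, w⟩ := s
  simp only at hs hL ⊢
  by_cases hm : t = m
  · refine ⟨L, ?_, ?_, fun _ => rfl, fun h => absurd hm h.ne, by omega⟩
    · simp only [perceptronPass, chainStep, hm, decide_true, if_true, le_refl]
      rfl
    · simp [chainStep, hm, hL]
  have hlt : ¬ m ≤ t := by omega
  set x := (ω L.draws).1 with hx
  set a : ℝ := inner ℝ (w : EuclideanSpace ℝ (Fin d)) (x : EuclideanSpace ℝ (Fin d)) with ha
  have hdot : ∑ i, coords w i * (x : EuclideanSpace ℝ (Fin d)) i = a := sum_coords_mul w x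
  by_cases hmem : a ∈ Set.Icc (b / 2) b
  · have ha0 : 0 < a := by linarith [hmem.1]
    by_cases hy : (ω L.draws).2 = true
    · have hstep : chainStep m b (t, w) (ω L.draws) = (t + 1, w) := by
        simp [chainStep, hlt, ← hx, ← ha, hmem, hy]
      have hneg : ¬ (1 * a < 0) := by linarith
      rw [hstep]
      refine ⟨⟨L.time + (6 * d + 8), L.draws + 1, L.labels + 1⟩, ?_, by simp [hL],
        fun h => absurd h hm, fun _ => rfl, by simp only; omega⟩
      simp only [perceptronPass, hm, decide_false, RAM.bind_run, RAM.draw, RAM.dot_run,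
        RAM.div, RAM.le, RAM.query, RAM.mul, RAM.lt, RAM.incr, RAM.eqNat, RAM.tick, RAM.pure_run,
        ← hx, hdot, hmem.1, hmem.2, decide_true, Bool.and_self, Label.toReal, hy, hneg, Bool.false_eq_true, ↓reduceIte]
      refine Prod.ext rfl ?_
      simp only [Ledger.mk.injEq, and_true]
      ring
    · have hstep : chainStep m b (t, w) (ω L.draws) = (t + 1, reflectSphere w x) := by
        simp [chainStep, hlt, ← hx, ← ha, hmem, hy]
      have hneg : (-1) * a < 0 := by linarith
      rw [hstep]
      refine ⟨⟨L.time + (12 * d + 9), L.draws + 1, L.labels + 1⟩, ?_, by simp [hL],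
        fun h => absurd h hm, fun _ => rfl, by simp only; omega⟩
      simp only [perceptronPass, hm, decide_false, RAM.bind_run, RAM.draw, RAM.dot_run,
        RAM.div, RAM.le, RAM.query, RAM.mul, RAM.lt, RAM.incr, RAM.eqNat, RAM.tick, RAM.pure_run,
        ← hx, hdot, hmem.1, hmem.2, decide_true, Bool.and_self, Label.toReal, hy, hneg,
        RAM.subScaled_run, Bool.false_eq_true, ↓reduceIte]
      refine Prod.ext rfl ?_
      simp only [Ledger.mk.injEq, and_true]
      ring
  · have hstep : chainStep m b (t, w) (ω L.draws) = (t, w) := by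
      simp [chainStep, hlt, ← hx, ← ha, hmem]
    rw [hstep]
    refine ⟨⟨L.time + (6 * d + 3), L.draws + 1, L.labels⟩, ?_, by simp [hL],
        fun h => absurd h hm, fun _ => rfl, by simp only; omega⟩
    have hout : ¬ b / 2 ≤ a ∨ ¬ a ≤ b := not_and_or.1 hmem
    rcases hout with hout | hout <;>
    · simp only [perceptronPass, hm, decide_false, RAM.bind_run, RAM.draw, RAM.dot_run,
        RAM.div, RAM.le, RAM.tick, RAM.pure_run, ← hx, hdot, hout, Bool.false_and, Bool.and_false,
        Bool.false_eq_true, ↓reduceIte]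
      refine Prod.ext rfl ?_
      simp only [Ledger.mk.injEq, and_true]
      ring

lemma modifiedPerceptron_run {m : ℕ} {b : ℝ} (hb : 0 < b) (w₀ : Sph d)
    (ω : ℕ → Sph d × Label) (n : ℕ) :
    ∃ L : Ledger,
      modifiedPerceptron (coords w₀) m b n ω ⟨0, 0, 0⟩ =
        (⟨(chain m b w₀ ω n).1, coords (chain m b w₀ ω n).2,
          decide ((chain m b w₀ ω n).1 = m)⟩, L) ∧
      L.labels = (chain m b w₀ ω n).1 ∧ L.draws ≤ n ∧
      ((chain m b w₀ ω n).1 < m → L.draws = n) ∧ L.time ≤ 1 + n * (12 * d + 9) := by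
  induction n with
  | zero =>
    refine ⟨⟨1, 0, 0⟩, ?_, rfl, le_rfl, fun _ => rfl, by simp⟩
    rfl
  | succ n ih =>
    obtain ⟨L, h1, h2, h3, h4, h5⟩ := ih
    obtain ⟨L', g1, g2, g3, g4, g5⟩ := perceptronPass_run hb (chain m b w₀ ω n)
      (chain_fst_le m b w₀ ω n) ω L h2
    have hrun : modifiedPerceptron (coords w₀) m b (n + 1) ω ⟨0, 0, 0⟩ =
        perceptronPass m b (modifiedPerceptron (coords w₀) m b n ω ⟨0, 0, 0⟩).1 ω
          (modifiedPerceptron (coords w₀) m b n ω ⟨0, 0, 0⟩).2 := rfl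
    rw [hrun, h1]
    -- Until halting, each pass draws one example, so the draw counter equals the pass number. After
    -- halting the example is irrelevant.
    have hstep : chainStep m b (chain m b w₀ ω n) (ω L.draws) = chain m b w₀ ω (n + 1) := by
      rw [chain]
      rcases (chain_fst_le m b w₀ ω n).eq_or_lt with h | h
      · simp [chainStep, h]
      · rw [h4 h]
    rw [hstep] at g1 g2
    refine ⟨L', g1, g2, ?_, ?_, ?_⟩
    · rcases (chain_fst_le m b w₀ ω n).eq_or_lt with h | h
      · rw [g3 h]; omega
      · rw [g4 h]; omega
    · intro hlt
      rcases (chain_fst_le m b w₀ ω n).eq_or_lt with h | h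
      · exfalso
        rw [chain, chainStep, if_pos h.ge] at hlt
        omega
      · rw [g4 h, h4 h]
    · calc L'.time ≤ L.time + (12 * d + 9) := g5
        _ ≤ 1 + n * (12 * d + 9) + (12 * d + 9) := by omega
        _ = 1 + (n + 1) * (12 * d + 9) := by ring

lemma outputs_of_chain {m : ℕ} {b : ℝ} (hb : 0 < b) (w₀ : Sph d)
    (ω : ℕ → Sph d × Label) (n : ℕ) (hn : (chain m b w₀ ω n).1 = m) :
    ∃ L : Ledger, Outputs w₀ m b ω ((chain m b w₀ ω n).2 : EuclideanSpace ℝ (Fin d)) L ∧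
      L.labels = m ∧ L.draws ≤ n ∧ L.time ≤ 1 + n * (12 * d + 9) := by
  obtain ⟨L, h1, h2, h3, -, h5⟩ := modifiedPerceptron_run hb w₀ ω n
  exact ⟨L, ⟨n, _, h1, by simp [hn], rfl⟩, h2.trans hn, h3, h5⟩

end PureChain

/-! ### The exponential potential and its decrease on an accepted example -/

section Potential

variable {d : ℕ}

/-- Bound on the probability that `n` more updates, started at `1 - cos(angle) = Φ`, do not end
with `1 - cos(angle) ≤ r ^ 2 / 4`. -/
noncomputable def updatePotential (ξ lam r : ℝ) (n : ℕ) (Φ : ℝ) : ℝ :=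
  (1 - ξ) ^ n * Real.exp (lam * (Φ - r ^ 2 / 4)) + n * (2 * Real.exp (-(lam * r ^ 2 / 16)))
    + Real.exp (lam * (Φ - 3 * r ^ 2 / 2))

/-- Bound on the probability that `N` more passes do not complete the `n` missing updates or end
with `1 - cos(angle) > r ^ 2 / 4`. -/
noncomputable def passPotential (ξ lam r q : ℝ) (N n : ℕ) (Φ : ℝ) : ℝ :=
  updatePotential ξ lam r n Φ + (Real.exp n - 1) * q ^ N

lemma updatePotential_nonneg {ξ lam r : ℝ} (hξ : ξ ≤ 1) (n : ℕ) (Φ : ℝ) :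
    0 ≤ updatePotential ξ lam r n Φ := by
  have : 0 ≤ (1 - ξ) ^ n := pow_nonneg (by linarith) n
  unfold updatePotential
  positivity

lemma passPotential_nonneg {ξ lam r q : ℝ} (hξ : ξ ≤ 1) (hq : 0 ≤ q) (N n : ℕ) (Φ : ℝ) :
    0 ≤ passPotential ξ lam r q N n Φ :=
  add_nonneg (updatePotential_nonneg hξ n Φ)
    (mul_nonneg (sub_nonneg.2 (Real.one_le_exp (Nat.cast_nonneg n))) (pow_nonneg hq N))

@[fun_prop]
lemma continuous_updatePotential (ξ lam r : ℝ) (n : ℕ) :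
    Continuous (updatePotential ξ lam r n) := by
  unfold updatePotential; fun_prop

/-- Below `3r²/16` both exponential terms are at most `exp(-λr²/16)`. The potential with `n` updates
left is then dominated by the middle term alone with `n + 1` updates left, so a step from the low
region is paid for by that term. -/
lemma updatePotential_le_of_le {ξ lam r : ℝ} (hξ0 : 0 ≤ ξ) (hξ : ξ ≤ 1) (hlam : 0 ≤ lam) (n : ℕ)
    {Φ : ℝ} (hΦ : Φ ≤ 3 * r ^ 2 / 16) :
    updatePotential ξ lam r n Φ ≤ ((n + 1 : ℕ) : ℝ) * (2 * Real.exp (-(lam * r ^ 2 / 16))) := by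
  have h1 : (1 - ξ) ^ n ≤ 1 := pow_le_one₀ (by linarith) (by linarith)
  have h2 : Real.exp (lam * (Φ - r ^ 2 / 4)) ≤ Real.exp (-(lam * r ^ 2 / 16)) := by
    refine Real.exp_le_exp.2 ?_
    nlinarith
  have h3 : Real.exp (lam * (Φ - 3 * r ^ 2 / 2)) ≤ Real.exp (-(lam * r ^ 2 / 16)) := by
    refine Real.exp_le_exp.2 ?_
    nlinarith [mul_nonneg hlam (sq_nonneg r)]
  have h4 : (1 - ξ) ^ n * Real.exp (lam * (Φ - r ^ 2 / 4)) ≤ Real.exp (lam * (Φ - r ^ 2 / 4)) :=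
    mul_le_of_le_one_left (Real.exp_pos _).le h1
  unfold updatePotential
  push_cast
  linarith

/-- The parameters of the potential and their relations. -/
structure GoodParams (d : ℕ) (η b lam r ξ : ℝ) : Prop where
  two_le : 2 ≤ d
  noise_nonneg : 0 ≤ η
  noise_lt : η < 1 / 2
  width_pos : 0 < b
  scale_pos : 0 < r
  scale_le : r ≤ 1
  rate_nonneg : 0 ≤ lam
  width_le : b ≤ (1 - 2 * η) * r / (1000000 * √d)
  rate_le : lam * b * r ≤ (1 - 2 * η) / (10000 * √d)
  gain_eq : ξ = lam * b * r * (1 - 2 * η) / (32 * √d)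

namespace GoodParams

variable {η b lam r ξ : ℝ}

lemma one_le_sqrt (h : GoodParams d η b lam r ξ) : 1 ≤ √(d : ℝ) :=
  Real.one_le_sqrt.2 (by exact_mod_cast (by have := h.two_le; omega : 1 ≤ d))

lemma width_le_scale (h : GoodParams d η b lam r ξ) : b ≤ r / 1000000 := by
  have hq := h.one_le_sqrt
  have hr := h.scale_pos
  refine h.width_le.trans ?_
  rw [div_le_div_iff₀ (by positivity) (by norm_num)]
  nlinarith [mul_nonneg h.noise_nonneg hr.le, mul_nonneg (sub_nonneg.2 hq) hr.le]

lemma gain_nonneg (h : GoodParams d η b lam r ξ) : 0 ≤ ξ := by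
  rw [h.gain_eq]
  have := h.rate_nonneg
  have := h.width_pos
  have := h.scale_pos
  have : 0 ≤ 1 - 2 * η := by linarith [h.noise_lt]
  positivity

lemma gain_le_one (h : GoodParams d η b lam r ξ) : ξ ≤ 1 := by
  have hq := h.one_le_sqrt
  have hκ : 0 ≤ 1 - 2 * η := by linarith [h.noise_lt]
  have hκ1 : 1 - 2 * η ≤ 1 := by linarith [h.noise_nonneg]
  have h1 : lam * b * r ≤ 1 := by
    refine h.rate_le.trans ?_
    rw [div_le_one (by positivity)]
    linarith
  rw [h.gain_eq, div_le_one (by positivity)]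
  have : lam * b * r * (1 - 2 * η) ≤ 1 * 1 := mul_le_mul h1 hκ1 hκ zero_le_one
  linarith

end GoodParams

lemma one_sub_inner_reflectSphere (w x u : Sph d) :
    1 - inner ℝ (reflectSphere w x : EuclideanSpace ℝ (Fin d)) (u : EuclideanSpace ℝ (Fin d)) =
      1 - inner ℝ (w : EuclideanSpace ℝ (Fin d)) (u : EuclideanSpace ℝ (Fin d)) +
        2 * (inner ℝ (w : EuclideanSpace ℝ (Fin d)) (x : EuclideanSpace ℝ (Fin d)) *
          inner ℝ (u : EuclideanSpace ℝ (Fin d)) (x : EuclideanSpace ℝ (Fin d))) := by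
  rw [inner_reflectSphere]; ring

lemma continuous_reflectSphere :
    Continuous fun p : Sph d × Sph d => reflectSphere p.1 p.2 := by
  refine Continuous.subtype_mk ?_ _
  fun_prop

lemma norm_coe_sphere (w : Sph d) : ‖(w : EuclideanSpace ℝ (Fin d))‖ = 1 := by simp

/-- One accepted example decreases the potential in expectation. -/
lemma integral_updatePotential_le {η b lam r ξ : ℝ} (h : GoodParams d η b lam r ξ)
    {π : Sph d → ℝ} {w u : Sph d} (hπ : IsNoisyNegative π u η) (n : ℕ)
    (hΦ : 1 - inner ℝ (w : EuclideanSpace ℝ (Fin d)) (u : EuclideanSpace ℝ (Fin d))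
      ≤ 3 * r ^ 2 / 2) :
    ∫ x : Sph d, band b (inner ℝ (w : EuclideanSpace ℝ (Fin d)) x) *
        ((1 - π x) * updatePotential ξ lam r n
            (1 - inner ℝ (w : EuclideanSpace ℝ (Fin d)) (u : EuclideanSpace ℝ (Fin d))) +
          π x * updatePotential ξ lam r n
            (1 - inner ℝ (reflectSphere w x : EuclideanSpace ℝ (Fin d))
              (u : EuclideanSpace ℝ (Fin d)))) ∂(uniformSphere d) ≤
      (∫ x : Sph d, band b (inner ℝ (w : EuclideanSpace ℝ (Fin d)) x) ∂(uniformSphere d)) *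
        updatePotential ξ lam r (n + 1)
          (1 - inner ℝ (w : EuclideanSpace ℝ (Fin d)) (u : EuclideanSpace ℝ (Fin d))) := by
  have hd1 : 1 ≤ d := by have := h.two_le; omega
  have hξ0 := h.gain_nonneg
  have hξ1 := h.gain_le_one
  have hlam := h.rate_nonneg
  have hr := h.scale_pos
  have hb := h.width_pos
  have hbr := h.width_le_scale
  have hw := norm_coe_sphere w
  have hu := norm_coe_sphere u
  simp only [one_sub_inner_reflectSphere]
  set Φ : ℝ := 1 - inner ℝ (w : EuclideanSpace ℝ (Fin d)) (u : EuclideanSpace ℝ (Fin d)) with hΦd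
  have i0 : Integrable (fun x : Sph d => band b (inner ℝ (w : EuclideanSpace ℝ (Fin d)) x))
      (uniformSphere d) := by
    simpa using integrable_band_mul hd1 b (w : EuclideanSpace ℝ (Fin d)) (f := fun _ => 1)
      measurable_const 1 (by simp)
  have hprod : ∀ x : Sph d, |inner ℝ (w : EuclideanSpace ℝ (Fin d)) (x : EuclideanSpace ℝ (Fin d)) *
      inner ℝ (u : EuclideanSpace ℝ (Fin d)) (x : EuclideanSpace ℝ (Fin d))| ≤ 1 := fun x => by
    rw [abs_mul]
    exact mul_le_one₀ ((abs_inner_sphere_le _ x).trans hw.le) (abs_nonneg _)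
      ((abs_inner_sphere_le _ x).trans hu.le)
  have hmw := (continuous_inner_sphere (w : EuclideanSpace ℝ (Fin d))).measurable
  have hmu := (continuous_inner_sphere (u : EuclideanSpace ℝ (Fin d))).measurable
  set p := ∫ x : Sph d, band b (inner ℝ (w : EuclideanSpace ℝ (Fin d)) x) ∂(uniformSphere d) with hp
  have hp0 : 0 ≤ p := integral_nonneg fun x => band_nonneg _ _
  rcases lt_or_ge Φ (r ^ 2 / 8) with hlow | hlow
  -- Low region: one step raises `Φ < r²/8` by at most `4br`, so the new value is below `3r²/16`
  -- whatever the label. No drift is needed.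
  · set E := Real.exp (-(lam * r ^ 2 / 16)) with hE
    have hle : ∀ x : Sph d, band b (inner ℝ (w : EuclideanSpace ℝ (Fin d)) x) *
        ((1 - π x) * updatePotential ξ lam r n Φ +
          π x * updatePotential ξ lam r n (Φ + 2 *
            (inner ℝ (w : EuclideanSpace ℝ (Fin d)) (x : EuclideanSpace ℝ (Fin d)) *
          inner ℝ (u : EuclideanSpace ℝ (Fin d)) (x : EuclideanSpace ℝ (Fin d))))) ≤
        band b (inner ℝ (w : EuclideanSpace ℝ (Fin d)) x) * (((n + 1 : ℕ) : ℝ) * (2 * E)) := by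
      intro x
      refine band_mul_le_of_mem fun hmem => ?_
      have hγ := abs_inner_le_of_band (G := 2 * r) hw hu hb (by linarith)
        (by
          have : (7 / 4 * r) ^ 2 ≤ (2 * r - b) ^ 2 := by
            refine pow_le_pow_left₀ (by positivity) ?_ 2
            linarith
          nlinarith) x hmem
      have h1 := updatePotential_le_of_le hξ0 hξ1 hlam n (Φ := Φ) (r := r) (by nlinarith)
      have hstep : inner ℝ (w : EuclideanSpace ℝ (Fin d)) (x : EuclideanSpace ℝ (Fin d)) *
          inner ℝ (u : EuclideanSpace ℝ (Fin d)) (x : EuclideanSpace ℝ (Fin d)) ≤ b * (2 * r) := by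
        refine (le_abs_self _).trans ?_
        rw [abs_mul, abs_of_nonneg (show 0 ≤ inner ℝ (w : EuclideanSpace ℝ (Fin d))
          (x : EuclideanSpace ℝ (Fin d)) by linarith [hmem.1])]
        exact mul_le_mul hmem.2 hγ (abs_nonneg _) hb.le
      have h2 := updatePotential_le_of_le hξ0 hξ1 hlam n (Φ := Φ + 2 *
            (inner ℝ (w : EuclideanSpace ℝ (Fin d)) (x : EuclideanSpace ℝ (Fin d)) *
          inner ℝ (u : EuclideanSpace ℝ (Fin d)) (x : EuclideanSpace ℝ (Fin d)))) (r := r)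
          (by nlinarith)
      have h3 := hπ.nonneg x
      have h4 := hπ.le_one x
      have h5 := mul_le_mul_of_nonneg_left h1 (show 0 ≤ 1 - π x by linarith)
      have h6 := mul_le_mul_of_nonneg_left h2 h3
      rw [← hE] at h5 h6
      linarith
    refine (integral_mono_of_nonneg (Filter.Eventually.of_forall fun x => ?_)
      (i0.mul_const _) (Filter.Eventually.of_forall hle)).trans ?_
    · have h3 := hπ.nonneg x
      have h4 := hπ.le_one x
      exact mul_nonneg (band_nonneg _ _) (add_nonneg
        (mul_nonneg (by linarith) (updatePotential_nonneg hξ1 _ _))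
        (mul_nonneg h3 (updatePotential_nonneg hξ1 _ _)))
    · rw [integral_mul_const]
      refine mul_le_mul_of_nonneg_left ?_ hp0
      have h1 : 0 ≤ (1 - ξ) ^ (n + 1) := pow_nonneg (by linarith) _
      unfold updatePotential
      rw [← hE]
      have h2 := mul_nonneg h1 (Real.exp_pos (lam * (Φ - r ^ 2 / 4))).le
      have h3 := (Real.exp_pos (lam * (Φ - 3 * r ^ 2 / 2))).le
      linarith
  -- Middle region: both exponential summands are multiplied by the same random factor, whose mean
  -- is at most `1 - ξ`. The first uses this to gain a power of `1 - ξ`; the last only needs that it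
  -- does not grow.
  · have hexp := integral_exp_update_le_of_mem h.two_le hπ h.noise_nonneg h.noise_lt hw hu hb hr
      h.scale_le hlam h.width_le h.rate_le hlow hΦ
    rw [← h.gain_eq, ← hp] at hexp
    set K : ℝ := (1 - ξ) ^ n * Real.exp (lam * (Φ - r ^ 2 / 4))
      + Real.exp (lam * (Φ - 3 * r ^ 2 / 2)) with hK
    have hK0 : 0 ≤ K := by
      have : 0 ≤ (1 - ξ) ^ n := pow_nonneg (by linarith) n
      positivity
    set D : ℝ := n * (2 * Real.exp (-(lam * r ^ 2 / 16))) with hD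
    have e : ∀ x : Sph d, band b (inner ℝ (w : EuclideanSpace ℝ (Fin d)) x) *
        ((1 - π x) * updatePotential ξ lam r n Φ +
          π x * updatePotential ξ lam r n (Φ + 2 *
            (inner ℝ (w : EuclideanSpace ℝ (Fin d)) (x : EuclideanSpace ℝ (Fin d)) *
          inner ℝ (u : EuclideanSpace ℝ (Fin d)) (x : EuclideanSpace ℝ (Fin d))))) =
        K * (band b (inner ℝ (w : EuclideanSpace ℝ (Fin d)) x) *
          (1 - π x + π x * Real.exp (2 * lam *
            (inner ℝ (w : EuclideanSpace ℝ (Fin d)) (x : EuclideanSpace ℝ (Fin d)) *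
          inner ℝ (u : EuclideanSpace ℝ (Fin d)) (x : EuclideanSpace ℝ (Fin d)))))) +
        D * band b (inner ℝ (w : EuclideanSpace ℝ (Fin d)) x) := by
      intro x
      set y : ℝ := inner ℝ (w : EuclideanSpace ℝ (Fin d)) (x : EuclideanSpace ℝ (Fin d)) *
          inner ℝ (u : EuclideanSpace ℝ (Fin d)) (x : EuclideanSpace ℝ (Fin d)) with hy
      have e1 : ∀ c : ℝ, Real.exp (lam * (Φ + 2 * y - c)) =
          Real.exp (lam * (Φ - c)) * Real.exp (2 * lam * y) := fun c => by
        rw [← Real.exp_add]; ring_nf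
      unfold updatePotential
      rw [e1, e1, hK, hD]
      ring
    simp only [e]
    have i1 : Integrable (fun x : Sph d => band b (inner ℝ (w : EuclideanSpace ℝ (Fin d)) x) *
          (1 - π x + π x * Real.exp (2 * lam *
            (inner ℝ (w : EuclideanSpace ℝ (Fin d)) (x : EuclideanSpace ℝ (Fin d)) *
          inner ℝ (u : EuclideanSpace ℝ (Fin d)) (x : EuclideanSpace ℝ (Fin d))))))
          (uniformSphere d) := by
      refine integrable_band_mul hd1 b _ ?_ (1 + Real.exp (2 * lam)) fun x => ?_
      · exact (measurable_const.sub hπ.measurable).add (hπ.measurable.mul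
          (Real.measurable_exp.comp ((hmw.mul hmu).const_mul _)))
      · have h1 := hπ.nonneg x
        have h2 := hπ.le_one x
        have h3 : Real.exp (2 * lam * (inner ℝ (w : EuclideanSpace ℝ (Fin d)) (x : EuclideanSpace ℝ (Fin d)) *
            inner ℝ (u : EuclideanSpace ℝ (Fin d)) (x : EuclideanSpace ℝ (Fin d)))) ≤ Real.exp (2 * lam) := by
          refine Real.exp_le_exp.2 ?_
          have := (abs_le.1 (hprod x)).2
          nlinarith
        have h4 := Real.exp_pos (2 * lam * (inner ℝ (w : EuclideanSpace ℝ (Fin d)) (x : EuclideanSpace ℝ (Fin d)) *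
            inner ℝ (u : EuclideanSpace ℝ (Fin d)) (x : EuclideanSpace ℝ (Fin d))))
        rw [abs_of_nonneg (add_nonneg (by linarith) (by positivity))]
        nlinarith
    rw [integral_add (i1.const_mul _) (i0.const_mul _), integral_const_mul, integral_const_mul,
      ← hp]
    have h1 := mul_le_mul_of_nonneg_left hexp hK0
    have h2 : K * (p * (1 - ξ)) + D * p ≤ p * updatePotential ξ lam r (n + 1) Φ := by
      have h3 : K * (1 - ξ) + D ≤ updatePotential ξ lam r (n + 1) Φ := by
        unfold updatePotential
        have h4 : Real.exp (lam * (Φ - 3 * r ^ 2 / 2)) * (1 - ξ) ≤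
            Real.exp (lam * (Φ - 3 * r ^ 2 / 2)) :=
          mul_le_of_le_one_right (Real.exp_pos _).le (by linarith)
        have h5 := (Real.exp_pos (-(lam * r ^ 2 / 16))).le
        rw [hK, hD, pow_succ (1 - ξ) n]
        push_cast
        linarith
      have := mul_le_mul_of_nonneg_left h3 hp0
      linarith
    linarith

end Potential

/-! ### The supermartingale inequality for one pass -/

section Recursion

variable {d : ℕ}

lemma isNoisyNegative_of_boundedNoise {O : Kernel (Sph d) Label} [IsMarkovKernel O] {u : Sph d}
    {η : ℝ} (hη : 0 ≤ η) (h : BoundedNoise O u η) :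
    IsNoisyNegative (fun x => (O x).real {false}) (u : EuclideanSpace ℝ (Fin d)) η where
  measurable := (O.measurable_coe (measurableSet_singleton _)).ennreal_toReal
  nonneg _ := measureReal_nonneg
  le_one _ := measureReal_le_one
  noise := by
    filter_upwards [h] with x hx
    have hreal := ENNReal.toReal_le_of_le_ofReal hη hx
    constructor
    · intro h0
      have : {y : Label | y ≠ halfspaceLabel u x} = {false} := by
        ext y; simp [halfspaceLabel, h0]
      rwa [this] at hreal
    · intro h0
      have hset : {y : Label | y ≠ halfspaceLabel u x} = {false}ᶜ := by
        ext y; simp [halfspaceLabel, not_le.2 h0]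
      rw [hset] at hreal
      have := probReal_compl_eq_one_sub (μ := O x) (measurableSet_singleton false)
      rw [measureReal_def] at this
      linarith

lemma isProbabilityMeasure_dataLaw (hd : 1 ≤ d) (O : Kernel (Sph d) Label) [IsMarkovKernel O] :
    IsProbabilityMeasure (dataLaw O) := by
  have := isProbabilityMeasure_uniformSphere hd
  unfold dataLaw
  infer_instance

lemma integral_dataLaw (hd : 1 ≤ d) (O : Kernel (Sph d) Label) [IsMarkovKernel O]
    {f : Sph d × Label → ℝ} (hf : Integrable f (dataLaw O)) :
    ∫ z, f z ∂(dataLaw O) = ∫ x, ((1 - (O x).real {false}) * f (x, true)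
      + (O x).real {false} * f (x, false)) ∂(uniformSphere d) := by
  have := isProbabilityMeasure_uniformSphere hd
  unfold dataLaw at hf ⊢
  rw [Measure.integral_compProd hf]
  refine integral_congr_ae (Filter.Eventually.of_forall fun x => ?_)
  simp only
  rw [integral_fintype Integrable.of_finite, Fintype.sum_bool]
  have : ({true} : Set Bool) = {false}ᶜ := by ext y; simp
  rw [this, probReal_compl_eq_one_sub (measurableSet_singleton _)]
  simp only [smul_eq_mul]

/-- The failure probability bound in a state with `N` passes left, truncated at `1`. -/
noncomputable def statePotential (m : ℕ) (u : Sph d) (ξ lam r q : ℝ) (N : ℕ) (s : ℕ × Sph d) : ℝ :=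
  min 1 (passPotential ξ lam r q N (m - s.1)
    (1 - inner ℝ (s.2 : EuclideanSpace ℝ (Fin d)) (u : EuclideanSpace ℝ (Fin d))))

lemma measurable_statePotential (m : ℕ) (u : Sph d) (ξ lam r q : ℝ) (N : ℕ) :
    Measurable (statePotential m u ξ lam r q N) := by
  refine measurable_from_prod_countable_right fun t => Continuous.measurable ?_
  have : Continuous fun w : Sph d => updatePotential ξ lam r (m - t)
      (1 - inner ℝ (w : EuclideanSpace ℝ (Fin d)) (u : EuclideanSpace ℝ (Fin d))) :=
    (continuous_updatePotential ξ lam r (m - t)).comp (by fun_prop)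
  exact continuous_const.min (this.add
    (continuous_const (y := (Real.exp ((m - t : ℕ) : ℝ) - 1) * q ^ N)))

lemma measurable_chainStep (m : ℕ) (b : ℝ) :
    Measurable fun p : (ℕ × Sph d) × (Sph d × Label) => chainStep m b p.1 p.2 := by
  unfold chainStep
  refine Measurable.ite (measurableSet_le measurable_const (measurable_fst.comp measurable_fst))
    measurable_fst (Measurable.ite ?_ ?_ measurable_fst)
  · refine measurableSet_Icc.preimage (f := fun p : (ℕ × Sph d) × (Sph d × Label) =>
      inner ℝ (p.1.2 : EuclideanSpace ℝ (Fin d)) (p.2.1 : EuclideanSpace ℝ (Fin d))) ?_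
    fun_prop
  · refine Measurable.prodMk ((measurable_fst.comp measurable_fst).add_const 1)
      (Measurable.ite ?_ (measurable_snd.comp measurable_fst) ?_)
    · exact (measurable_snd.comp measurable_snd) (measurableSet_singleton true)
    · exact continuous_reflectSphere.measurable.comp
        ((measurable_snd.comp measurable_fst).prodMk (measurable_fst.comp measurable_snd))

lemma chainStep_of_le {m : ℕ} {b : ℝ} {s : ℕ × Sph d} (hs : m ≤ s.1) (z : Sph d × Label) :
    chainStep m b s z = s := if_pos hs

lemma statePotential_nonneg {m : ℕ} {u : Sph d} {ξ lam r q : ℝ} (hξ : ξ ≤ 1) (hq : 0 ≤ q) (N : ℕ)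
    (s : ℕ × Sph d) : 0 ≤ statePotential m u ξ lam r q N s :=
  le_min zero_le_one (passPotential_nonneg hξ hq _ _ _)

/-- An acceptance lowers `exp n - 1` by at least half of its value, because `e ≥ 2`; an acceptance
probability `p ≥ p₀` thus gives the mean factor `1 - p₀/2`. The weight vanishes at `n = 0`, as it
must once no update is missing. -/
lemma exp_sub_one_step {p₀ p : ℝ} (hp : p₀ ≤ p) (hp₀ : 0 ≤ p₀) (k : ℕ) :
    (1 - p) * (Real.exp ((k + 1 : ℕ) : ℝ) - 1) + p * (Real.exp k - 1) ≤
      (1 - p₀ / 2) * (Real.exp ((k + 1 : ℕ) : ℝ) - 1) := by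
  have he : 2 ≤ Real.exp 1 := by linarith [Real.add_one_le_exp 1]
  have h1 : Real.exp ((k + 1 : ℕ) : ℝ) = Real.exp k * Real.exp 1 := by
    rw [← Real.exp_add]; push_cast; rfl
  have hk := Real.exp_pos (k : ℝ)
  rw [h1]
  have h2 : 2 * Real.exp (k : ℝ) ≤ Real.exp k * Real.exp 1 := by nlinarith
  nlinarith [mul_nonneg hp₀ (sub_nonneg.2 h2), mul_nonneg (sub_nonneg.2 hp) hk.le,
    mul_nonneg (sub_nonneg.2 hp) (sub_nonneg.2 h2)]

/-- The potential decreases in expectation along one pass of the main loop. -/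
lemma integral_statePotential_le {m : ℕ} {η b lam r ξ p₀ : ℝ} (h : GoodParams d η b lam r ξ)
    {O : Kernel (Sph d) Label} [IsMarkovKernel O] {u : Sph d} (hO : BoundedNoise O u η)
    (hp₀ : 0 ≤ p₀) (hp₁ : p₀ ≤ 1)
    (hp : ∀ w : Sph d, p₀ ≤
      ∫ x : Sph d, band b (inner ℝ (w : EuclideanSpace ℝ (Fin d)) x) ∂(uniformSphere d))
    (N : ℕ) (s : ℕ × Sph d) :
    ∫ z, statePotential m u ξ lam r (1 - p₀ / 2) N (chainStep m b s z) ∂(dataLaw O) ≤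
      statePotential m u ξ lam r (1 - p₀ / 2) (N + 1) s := by
  have hd1 : 1 ≤ d := by have := h.two_le; omega
  have := isProbabilityMeasure_dataLaw hd1 O
  have := isProbabilityMeasure_uniformSphere hd1
  have hξ1 := h.gain_le_one
  set q : ℝ := 1 - p₀ / 2 with hq
  have hq0 : 0 ≤ q := by linarith
  obtain ⟨t, w⟩ := s
  by_cases ht : m ≤ t
  · have h1 : ∀ z, chainStep m b (t, w) z = (t, w) := fun z => chainStep_of_le ht z
    simp only [h1, integral_const, probReal_univ, one_smul]
    -- With no update missing, the only summand depending on the number of passes has the factor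
    -- `exp 0 - 1 = 0`.
    refine le_of_eq ?_
    simp [statePotential, passPotential, Nat.sub_eq_zero_of_le ht]
  obtain ⟨k, hk⟩ : ∃ k, m - t = k + 1 := ⟨m - t - 1, by omega⟩
  have hk' : m - (t + 1) = k := by omega
  set Φ : ℝ := 1 - inner ℝ (w : EuclideanSpace ℝ (Fin d)) (u : EuclideanSpace ℝ (Fin d)) with hΦd
  have hmeas : Measurable fun z => statePotential m u ξ lam r q N (chainStep m b (t, w) z) :=
    (measurable_statePotential m u ξ lam r q N).comp
      ((measurable_chainStep m b).comp measurable_prodMk_left)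
  have hint : Integrable (fun z => statePotential m u ξ lam r q N (chainStep m b (t, w) z))
      (dataLaw O) := by
    refine Integrable.of_bound hmeas.aestronglyMeasurable 1 (Filter.Eventually.of_forall fun z => ?_)
    rw [Real.norm_eq_abs, abs_of_nonneg (statePotential_nonneg hξ1 hq0 _ _)]
    exact min_le_left _ _
  refine le_min ?_ ?_
  · calc _ ≤ ∫ z, (1 : ℝ) ∂(dataLaw O) :=
          integral_mono hint (integrable_const _) fun z => min_le_left _ _
      _ = 1 := by simp
  simp only [hk]
  have hPhinn : 0 ≤ passPotential ξ lam r q (N + 1) (k + 1) Φ := passPotential_nonneg hξ1 hq0 _ _ _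
  -- Above `3r²/2` the last exponential alone is at least `1`, so truncation at `1` makes the
  -- inequality trivial exactly where the drift estimate is unavailable.
  rcases lt_or_ge (3 * r ^ 2 / 2) Φ with hbig | hΦ
  · have h1 : 1 ≤ passPotential ξ lam r q (N + 1) (k + 1) Φ := by
      have h1 : 1 ≤ Real.exp (lam * (Φ - 3 * r ^ 2 / 2)) :=
        Real.one_le_exp (mul_nonneg h.rate_nonneg (by linarith))
      have h2 : 0 ≤ (1 - ξ) ^ (k + 1) := pow_nonneg (by linarith) _
      have h3 := mul_nonneg h2 (Real.exp_pos (lam * (Φ - r ^ 2 / 4))).le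
      have h4 : 0 ≤ ((k + 1 : ℕ) : ℝ) * (2 * Real.exp (-(lam * r ^ 2 / 16))) := by positivity
      have h5 : 0 ≤ (Real.exp ((k + 1 : ℕ) : ℝ) - 1) * q ^ (N + 1) :=
        mul_nonneg (sub_nonneg.2 (Real.one_le_exp (Nat.cast_nonneg _))) (pow_nonneg hq0 _)
      unfold passPotential updatePotential
      linarith
    refine le_trans ?_ h1
    calc _ ≤ ∫ z, (1 : ℝ) ∂(dataLaw O) :=
          integral_mono hint (integrable_const _) fun z => min_le_left _ _
      _ = 1 := by simp
  rw [integral_dataLaw hd1 O hint]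
  have hπ := isNoisyNegative_of_boundedNoise h.noise_nonneg hO
  set π : Sph d → ℝ := fun x => (O x).real {false} with hπd
  have hmain := integral_updatePotential_le h hπ k (w := w) hΦ
  rw [← hΦd] at hmain
  set p := ∫ x : Sph d, band b (inner ℝ (w : EuclideanSpace ℝ (Fin d)) x) ∂(uniformSphere d) with hpd
  have i0 : Integrable (fun x : Sph d => band b (inner ℝ (w : EuclideanSpace ℝ (Fin d)) x))
      (uniformSphere d) := by
    simpa using integrable_band_mul hd1 b (w : EuclideanSpace ℝ (Fin d)) (f := fun _ => 1)
      measurable_const 1 (by simp)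
  set U : Sph d → ℝ := fun x => (1 - π x) * updatePotential ξ lam r k Φ +
    π x * updatePotential ξ lam r k (1 - inner ℝ (reflectSphere w x : EuclideanSpace ℝ (Fin d))
      (u : EuclideanSpace ℝ (Fin d))) with hU
  have i1 : Integrable (fun x : Sph d => band b (inner ℝ (w : EuclideanSpace ℝ (Fin d)) x) * U x)
      (uniformSphere d) := by
    have hcont : Continuous fun x : Sph d => updatePotential ξ lam r k
        (1 - inner ℝ (reflectSphere w x : EuclideanSpace ℝ (Fin d))
          (u : EuclideanSpace ℝ (Fin d))) := by
      have : Continuous fun x : Sph d => reflectSphere w x :=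
        continuous_reflectSphere.comp (Continuous.prodMk_right w)
      fun_prop
    obtain ⟨C, hC⟩ := isCompact_univ.exists_bound_of_continuousOn hcont.continuousOn
    refine integrable_band_mul hd1 b _ ?_ (|updatePotential ξ lam r k Φ| + C) fun x => ?_
    · exact ((measurable_const.sub hπ.measurable).mul_const _).add
        (hπ.measurable.mul hcont.measurable)
    · refine (abs_add_le _ _).trans (add_le_add ?_ ?_)
      · rw [abs_mul, abs_of_nonneg (sub_nonneg.2 (hπ.le_one x))]
        exact mul_le_of_le_one_left (abs_nonneg _) (by linarith [hπ.nonneg x])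
      · rw [abs_mul, abs_of_nonneg (hπ.nonneg x)]
        exact (mul_le_of_le_one_left (abs_nonneg _) (hπ.le_one x)).trans (hC x (Set.mem_univ x))
  set A : ℝ := passPotential ξ lam r q N (k + 1) Φ with hA
  set T : ℝ := (Real.exp k - 1) * q ^ N with hT
  -- Since `band` takes only the values `0` and `1`, the two outcomes combine into one linear
  -- expression: rejection leaves `A`, and acceptance gives `U x + T`.
  have hpt : ∀ x : Sph d, (1 - π x) * statePotential m u ξ lam r q N (chainStep m b (t, w) (x, true))
      + π x * statePotential m u ξ lam r q N (chainStep m b (t, w) (x, false)) ≤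
      (A - A * band b (inner ℝ (w : EuclideanSpace ℝ (Fin d)) x)) +
        (band b (inner ℝ (w : EuclideanSpace ℝ (Fin d)) x) * U x +
          T * band b (inner ℝ (w : EuclideanSpace ℝ (Fin d)) x)) := by
    intro x
    have hπ0 := hπ.nonneg x
    have hπ1 := hπ.le_one x
    by_cases hmem : inner ℝ (w : EuclideanSpace ℝ (Fin d)) (x : EuclideanSpace ℝ (Fin d))
        ∈ Set.Icc (b / 2) b
    · have e1 : chainStep m b (t, w) (x, true) = (t + 1, w) := by
        simp [chainStep, ht, hmem]
      have e2 : chainStep m b (t, w) (x, false) = (t + 1, reflectSphere w x) := by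
        simp [chainStep, ht, hmem]
      rw [e1, e2, band_of_mem hmem]
      have h1 : statePotential m u ξ lam r q N (t + 1, w) ≤ updatePotential ξ lam r k Φ + T := by
        refine (min_le_right _ _).trans (le_of_eq ?_)
        simp only [hk', passPotential]
        rfl
      have h2 : statePotential m u ξ lam r q N (t + 1, reflectSphere w x) ≤
          updatePotential ξ lam r k (1 - inner ℝ (reflectSphere w x : EuclideanSpace ℝ (Fin d))
            (u : EuclideanSpace ℝ (Fin d))) + T := by
        refine (min_le_right _ _).trans (le_of_eq ?_)
        simp only [hk', passPotential]
        rfl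
      have h3 := mul_le_mul_of_nonneg_left h1 (sub_nonneg.2 hπ1)
      have h4 := mul_le_mul_of_nonneg_left h2 hπ0
      simp only [hU]
      linarith
    · have e1 : ∀ y, chainStep m b (t, w) (x, y) = (t, w) := by
        intro y; simp [chainStep, ht, hmem]
      rw [e1, e1, band_of_notMem hmem]
      have h1 : statePotential m u ξ lam r q N (t, w) ≤ A := by
        refine (min_le_right _ _).trans (le_of_eq ?_)
        simp only [hk]
        rfl
      linarith
  have j1 : Integrable (fun x : Sph d => A - A * band b (inner ℝ (w : EuclideanSpace ℝ (Fin d)) x))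
      (uniformSphere d) := (integrable_const A).sub (i0.const_mul A)
  have j2 : Integrable (fun x : Sph d => band b (inner ℝ (w : EuclideanSpace ℝ (Fin d)) x) * U x +
          T * band b (inner ℝ (w : EuclideanSpace ℝ (Fin d)) x)) (uniformSphere d) :=
    i1.add (i0.const_mul T)
  refine (integral_mono_of_nonneg (Filter.Eventually.of_forall fun x => ?_)
    (j1.add j2) (Filter.Eventually.of_forall hpt)).trans ?_
  · exact add_nonneg
      (mul_nonneg (sub_nonneg.2 (hπ.le_one x)) (statePotential_nonneg hξ1 hq0 N
        (chainStep m b (t, w) (x, true))))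
      (mul_nonneg (hπ.nonneg x) (statePotential_nonneg hξ1 hq0 N
        (chainStep m b (t, w) (x, false))))
  have hval : ∫ x : Sph d, ((A - A * band b (inner ℝ (w : EuclideanSpace ℝ (Fin d)) x)) +
        (band b (inner ℝ (w : EuclideanSpace ℝ (Fin d)) x) * U x +
          T * band b (inner ℝ (w : EuclideanSpace ℝ (Fin d)) x))) ∂(uniformSphere d) =
      A - A * p + (∫ x : Sph d, band b (inner ℝ (w : EuclideanSpace ℝ (Fin d)) x) * U x
        ∂(uniformSphere d) + T * p) := by
    rw [integral_add j1 j2, integral_sub (integrable_const A) (i0.const_mul A),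
      integral_add i1 (i0.const_mul T), integral_const_mul, integral_const_mul]
    simp [hpd]
  calc _ = _ := hval
    _ ≤ A - A * p + (p * updatePotential ξ lam r (k + 1) Φ + T * p) := by linarith
    _ ≤ passPotential ξ lam r q (N + 1) (k + 1) Φ := by
      have h1 := mul_le_mul_of_nonneg_right (exp_sub_one_step (hp w) hp₀ k) (pow_nonneg hq0 N)
      rw [← hpd, ← hq] at h1
      rw [hA, hT]
      unfold passPotential
      rw [pow_succ]
      linarith

end Recursion

/-! ### From one pass to the whole run -/

section Independence

variable {d : ℕ}

lemma chain_congr (m : ℕ) (b : ℝ) (w₀ : Sph d) {ω ω' : ℕ → Sph d × Label} (n : ℕ)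
    (h : ∀ i < n, ω i = ω' i) : chain m b w₀ ω n = chain m b w₀ ω' n := by
  induction n with
  | zero => rfl
  | succ n ih =>
    rw [chain, chain, ih fun i hi => h i (by omega), h n (by omega)]

lemma measurable_chain (m : ℕ) (b : ℝ) (w₀ : Sph d) (n : ℕ) :
    Measurable fun ω : ℕ → Sph d × Label => chain m b w₀ ω n := by
  induction n with
  | zero => exact measurable_const
  | succ n ih => exact (measurable_chainStep m b).comp (ih.prodMk (measurable_pi_apply n))

variable {Ω : Type*} [MeasurableSpace Ω] {P : Measure Ω} {Z : ℕ → Ω → Sph d × Label}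

/-- The state after `n` passes is a measurable function of the first `n` examples, which are
independent of the example with index `n`. -/
lemma indepFun_chain (hZ : ∀ i, Measurable (Z i)) (hind : iIndepFun Z P)
    (m : ℕ) (b : ℝ) (w₀ : Sph d) (n : ℕ) :
    IndepFun (fun ω => chain m b w₀ (fun i => Z i ω) n) (Z n) P := by
  have h := hind.indepFun_finset (Finset.range n) {n} (by simp) hZ
  -- The value beyond index `n` is arbitrary: by `chain_congr` it does not affect the first `n`
  -- passes.
  let ext : ((i : Finset.range n) → Sph d × Label) → ℕ → Sph d × Label := fun z i =>
    if hi : i ∈ Finset.range n then z ⟨i, hi⟩ else (w₀, true)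
  have hext : Measurable ext := by
    refine measurable_pi_lambda _ fun i => ?_
    by_cases hi : i ∈ Finset.range n
    · simp only [ext, hi, dite_true]
      exact measurable_pi_apply _
    · simp only [ext, hi, dite_false]
      exact measurable_const
  have h' := h.comp ((measurable_chain m b w₀ n).comp hext)
    (measurable_pi_apply (⟨n, Finset.mem_singleton_self n⟩ : ({n} : Finset ℕ)))
  have e : ((fun ω : ℕ → Sph d × Label => chain m b w₀ ω n) ∘ ext) ∘
      (fun a (i : Finset.range n) => Z i a) = fun ω => chain m b w₀ (fun i => Z i ω) n := by
    funext ω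
    refine chain_congr m b w₀ n fun i hi => ?_
    simp [ext, hi]
  rw [e] at h'
  exact h'

variable [IsProbabilityMeasure P]

/-- Independence makes the joint law of the state and the next example a product. The one-pass
inequality can then be integrated over the state, and induction on `n` chains the passes. -/
lemma lintegral_statePotential_le {m : ℕ} {η b lam r ξ p₀ : ℝ} (h : GoodParams d η b lam r ξ)
    {O : Kernel (Sph d) Label} [IsMarkovKernel O] {u : Sph d} (hO : BoundedNoise O u η)
    (hp₀ : 0 ≤ p₀) (hp₁ : p₀ ≤ 1)
    (hp : ∀ w : Sph d, p₀ ≤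
      ∫ x : Sph d, band b (inner ℝ (w : EuclideanSpace ℝ (Fin d)) x) ∂(uniformSphere d))
    (hZ : ∀ i, Measurable (Z i)) (hind : iIndepFun Z P) (hlaw : ∀ i, P.map (Z i) = dataLaw O)
    (w₀ : Sph d) (N n : ℕ) (hn : n ≤ N) :
    ∫⁻ ω, ENNReal.ofReal (statePotential m u ξ lam r (1 - p₀ / 2) (N - n)
      (chain m b w₀ (fun i => Z i ω) n)) ∂P ≤
      ENNReal.ofReal (statePotential m u ξ lam r (1 - p₀ / 2) N (0, w₀)) := by
  have hd1 : 1 ≤ d := by have := h.two_le; omega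
  have := isProbabilityMeasure_dataLaw hd1 O
  have hξ1 := h.gain_le_one
  induction n with
  | zero => simp [chain]
  | succ n ih =>
    refine le_trans ?_ (ih (by omega))
    set S : Ω → ℕ × Sph d := fun ω => chain m b w₀ (fun i => Z i ω) n with hS
    have hSm : Measurable S := (measurable_chain m b w₀ n).comp (measurable_pi_lambda _ hZ)
    set V : ℕ → ℕ × Sph d → ℝ := statePotential m u ξ lam r (1 - p₀ / 2) with hV
    have hVm : ∀ k, Measurable (V k) := fun k => measurable_statePotential m u ξ lam r _ k
    have hf : Measurable fun p : (ℕ × Sph d) × (Sph d × Label) =>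
        ENNReal.ofReal (V (N - (n + 1)) (chainStep m b p.1 p.2)) :=
      ((hVm _).comp (measurable_chainStep m b)).ennreal_ofReal
    have hmap := (indepFun_iff_map_prod_eq_prod_map_map hSm.aemeasurable (hZ n).aemeasurable).1
      (indepFun_chain hZ hind m b w₀ n)
    have := Measure.isProbabilityMeasure_map (μ := P) hSm.aemeasurable
    calc ∫⁻ ω, ENNReal.ofReal (V (N - (n + 1)) (chain m b w₀ (fun i => Z i ω) (n + 1))) ∂P
        = ∫⁻ p, ENNReal.ofReal (V (N - (n + 1)) (chainStep m b p.1 p.2))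
            ∂(P.map fun ω => (S ω, Z n ω)) := by
          rw [lintegral_map hf (hSm.prodMk (hZ n))]
          rfl
      _ = ∫⁻ s, ∫⁻ z, ENNReal.ofReal (V (N - (n + 1)) (chainStep m b s z)) ∂(dataLaw O)
            ∂(P.map S) := by
          rw [hmap, hlaw, lintegral_prod _ hf.aemeasurable]
      _ ≤ ∫⁻ s, ENNReal.ofReal (V (N - n) s) ∂(P.map S) := by
          refine lintegral_mono fun s => ?_
          rw [← ofReal_integral_eq_lintegral_ofReal]
          · refine ENNReal.ofReal_le_ofReal ?_
            have := integral_statePotential_le (m := m) h hO hp₀ hp₁ hp (N - (n + 1)) s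
            rwa [show N - (n + 1) + 1 = N - n by omega] at this
          · refine Integrable.of_bound ((hVm _).comp ((measurable_chainStep m b).comp
              measurable_prodMk_left)).aestronglyMeasurable 1 (Filter.Eventually.of_forall fun z => ?_)
            rw [Real.norm_eq_abs, abs_of_nonneg]
            · exact min_le_left _ _
            · exact statePotential_nonneg hξ1 (by linarith) _ _
          · exact Filter.Eventually.of_forall fun z =>
              statePotential_nonneg hξ1 (by linarith) _ _
      _ = _ := by rw [lintegral_map (hVm _).ennreal_ofReal hSm]

/-- At the end of the passes the potential dominates the indicator of failure: missing updates give
`exp n - 1 ≥ n ≥ 1`, and a completed run with `Φ > r²/4` makes the first exponential exceed `1`. -/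
lemma one_le_statePotential_zero {m : ℕ} {u : Sph d} {ξ lam r q : ℝ} (hξ : ξ ≤ 1)
    (hlam : 0 ≤ lam) {s : ℕ × Sph d}
    (hs : s.1 < m ∨ (s.1 = m ∧ r ^ 2 / 4 <
      1 - inner ℝ (s.2 : EuclideanSpace ℝ (Fin d)) (u : EuclideanSpace ℝ (Fin d)))) :
    1 ≤ statePotential m u ξ lam r q 0 s := by
  refine le_min le_rfl ?_
  rcases hs with hs | ⟨hs, hΦ⟩
  · have h1 := updatePotential_nonneg (lam := lam) (r := r) hξ (m - s.1)
      (1 - inner ℝ (s.2 : EuclideanSpace ℝ (Fin d)) (u : EuclideanSpace ℝ (Fin d)))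
    have h2 : (1 : ℝ) ≤ ((m - s.1 : ℕ) : ℝ) := by exact_mod_cast (by omega : 1 ≤ m - s.1)
    have h3 := Real.add_one_le_exp ((m - s.1 : ℕ) : ℝ)
    unfold passPotential
    rw [pow_zero, mul_one]
    linarith
  · have h1 : 1 ≤ Real.exp (lam * (1 - inner ℝ (s.2 : EuclideanSpace ℝ (Fin d))
        (u : EuclideanSpace ℝ (Fin d)) - r ^ 2 / 4)) :=
      Real.one_le_exp (mul_nonneg hlam (by linarith))
    have h2 := Real.exp_pos (lam * (1 - inner ℝ (s.2 : EuclideanSpace ℝ (Fin d))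
        (u : EuclideanSpace ℝ (Fin d)) - 3 * r ^ 2 / 2))
    simp only [passPotential, updatePotential, hs, Nat.sub_self, pow_zero, one_mul, Nat.cast_zero,
      zero_mul, Real.exp_zero, sub_self, add_zero]
    linarith

/-- With high probability, `N` passes complete the `m` iterations and halve the angle. -/
lemma measure_success_ge {m : ℕ} {η b lam r ξ p₀ ε : ℝ} (h : GoodParams d η b lam r ξ)
    {O : Kernel (Sph d) Label} [IsMarkovKernel O] {u : Sph d} (hO : BoundedNoise O u η)
    (hp₀ : 0 ≤ p₀) (hp₁ : p₀ ≤ 1)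
    (hp : ∀ w : Sph d, p₀ ≤
      ∫ x : Sph d, band b (inner ℝ (w : EuclideanSpace ℝ (Fin d)) x) ∂(uniformSphere d))
    (hZ : ∀ i, Measurable (Z i)) (hind : iIndepFun Z P) (hlaw : ∀ i, P.map (Z i) = dataLaw O)
    (w₀ : Sph d) (N : ℕ) (hε : 0 ≤ ε)
    (hpot : passPotential ξ lam r (1 - p₀ / 2) N m
      (1 - inner ℝ (w₀ : EuclideanSpace ℝ (Fin d)) (u : EuclideanSpace ℝ (Fin d))) ≤ ε) :
    ENNReal.ofReal (1 - ε) ≤ P {ω | (chain m b w₀ (fun i => Z i ω) N).1 = m ∧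
      1 - inner ℝ ((chain m b w₀ (fun i => Z i ω) N).2 : EuclideanSpace ℝ (Fin d))
        (u : EuclideanSpace ℝ (Fin d)) ≤ r ^ 2 / 4} := by
  have hmain := lintegral_statePotential_le (m := m) h hO hp₀ hp₁ hp hZ hind hlaw w₀ N N le_rfl
  rw [Nat.sub_self] at hmain
  set S : Ω → ℕ × Sph d := fun ω => chain m b w₀ (fun i => Z i ω) N with hS
  have hSm : Measurable S := (measurable_chain m b w₀ N).comp (measurable_pi_lambda _ hZ)
  set G : Set Ω := {ω | (S ω).1 = m ∧ 1 - inner ℝ ((S ω).2 : EuclideanSpace ℝ (Fin d))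
        (u : EuclideanSpace ℝ (Fin d)) ≤ r ^ 2 / 4} with hG
  have hGm : MeasurableSet G := by
    have h1 : Measurable fun w : Sph d => 1 - inner ℝ (w : EuclideanSpace ℝ (Fin d))
        (u : EuclideanSpace ℝ (Fin d)) := by fun_prop
    have h2 : MeasurableSet {ω | 1 - inner ℝ ((S ω).2 : EuclideanSpace ℝ (Fin d))
        (u : EuclideanSpace ℝ (Fin d)) ≤ r ^ 2 / 4} :=
      measurableSet_le (h1.comp (measurable_snd.comp hSm)) measurable_const
    exact ((measurable_fst.comp hSm) (measurableSet_singleton m)).inter h2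
  have hbad : P Gᶜ ≤ ENNReal.ofReal ε := by
    calc P Gᶜ = ∫⁻ ω, Gᶜ.indicator 1 ω ∂P := (lintegral_indicator_one hGm.compl).symm
      _ ≤ ∫⁻ ω, ENNReal.ofReal (statePotential m u ξ lam r (1 - p₀ / 2) 0 (S ω)) ∂P := by
          refine lintegral_mono fun ω => ?_
          by_cases hω : ω ∈ Gᶜ
          · rw [Set.indicator_of_mem hω, Pi.one_apply, ENNReal.one_le_ofReal]
            refine one_le_statePotential_zero h.gain_le_one h.rate_nonneg ?_
            rcases (chain_fst_le m b w₀ (fun i => Z i ω) N).lt_or_eq with h1 | h1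
            · exact Or.inl h1
            · exact Or.inr ⟨h1, not_le.1 fun h2 => hω ⟨h1, h2⟩⟩
          · rw [Set.indicator_of_notMem hω]
            exact zero_le
      _ ≤ _ := hmain
      _ ≤ ENNReal.ofReal ε := ENNReal.ofReal_le_ofReal ((min_le_right _ _).trans (by simpa using hpot))
  have hcompl := prob_compl_eq_one_sub (μ := P) hGm.compl
  rw [compl_compl] at hcompl
  rw [hcompl, ENNReal.ofReal_sub _ hε, ENNReal.ofReal_one]
  exact tsub_le_tsub_left hbad _

end Independence

/-! ### Numerical constants and the choice of parameters -/

section Parameters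

lemma cube_const_bounds : (10 : ℝ) ^ 12 ≤ (3200 * Real.pi) ^ 3 ∧
    (3200 * Real.pi) ^ 3 ≤ 2 * 10 ^ 12 := by
  have h1 := Real.pi_gt_d2
  have h2 := Real.pi_lt_d2
  constructor
  · calc (10 : ℝ) ^ 12 ≤ (3200 * 3.14) ^ 3 := by norm_num
      _ ≤ _ := by gcongr
  · calc (3200 * Real.pi) ^ 3 ≤ (3200 * 3.15) ^ 3 := by gcongr
      _ ≤ _ := by norm_num

lemma width_const_bounds : (7000000 : ℝ) ≤ 2 * (600 * Real.pi) ^ 2 ∧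
    2 * (600 * Real.pi) ^ 2 ≤ 8000000 := by
  have h1 := Real.pi_gt_d2
  have h2 := Real.pi_lt_d2
  constructor
  · calc (7000000 : ℝ) ≤ 2 * (600 * 3.14) ^ 2 := by norm_num
      _ ≤ _ := by gcongr
  · calc 2 * (600 * Real.pi) ^ 2 ≤ 2 * (600 * 3.15) ^ 2 := by gcongr
      _ ≤ _ := by norm_num

lemma log_cube_const_le : Real.log ((3200 * Real.pi) ^ 3) ≤ 30 := by
  rw [Real.log_le_iff_le_exp (by positivity)]
  refine cube_const_bounds.2.trans ?_
  have h : Real.exp 30 = Real.exp 1 ^ 30 := by rw [← Real.exp_nat_mul]; norm_num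
  rw [h]
  calc (2 : ℝ) * 10 ^ 12 ≤ 2.7 ^ 30 := by norm_num
    _ ≤ _ := by
      gcongr
      linarith [Real.exp_one_gt_d9]

lemma one_le_log_three : 1 ≤ Real.log 3 := by
  rw [Real.le_log_iff_exp_le (by norm_num)]
  linarith [Real.exp_one_lt_d9]

variable {d : ℕ} {η δ : ℝ}

/-- The size of the number of iterations and of the logarithms in the parameters. -/
structure IterationBounds (d : ℕ) (η δ : ℝ) (m : ℕ) : Prop where
  one_le_logFactor : 1 ≤ logFactor d η δ
  le_iterations : d / (1 - 2 * η) ^ 2 * logFactor d η δ ≤ m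
  iterations_le : (m : ℝ) ≤ 10 ^ 15 * (d / (1 - 2 * η) ^ 2 * logFactor d η δ)
  one_le_log : 1 ≤ Real.log ((m : ℝ) ^ 2 / δ)
  log_le : Real.log ((m : ℝ) ^ 2 / δ) ≤ 155 * logFactor d η δ
  mul_log_le : 10 ^ 11 * (d / (1 - 2 * η) ^ 2 * Real.log ((m : ℝ) ^ 2 / δ)) ≤ m
  log_inv_le : Real.log (1 / δ) + 5 ≤ m

/-- Everything is compared with `L = ln A + ln(1/δ)`. Since the constant in `A` has logarithm at
most `30` and `Λ ≥ 1`, one has `Λ ≤ L ≤ 31Λ`; the ceiling costs at most a factor `2`. -/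
lemma iterationBounds (hd : 3 ≤ d) (hη0 : 0 ≤ η) (hη : η < 1 / 2) (hδ0 : 0 < δ) (hδ : δ < 1) :
    IterationBounds d η δ (numIterations d η δ) := by
  have hκ0 : 0 < 1 - 2 * η := by linarith
  have hκ1 : 1 - 2 * η ≤ 1 := by linarith
  have hdR : (3 : ℝ) ≤ d := by exact_mod_cast hd
  set k : ℝ := (3200 * Real.pi) ^ 3 with hk
  set D : ℝ := d / (1 - 2 * η) ^ 2 with hD
  obtain ⟨hk1, hk2⟩ := cube_const_bounds
  rw [← hk] at hk1 hk2
  have hk0 : 0 < k := by linarith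
  have hD3 : 3 ≤ D := by
    rw [hD, le_div_iff₀ (by positivity)]
    have : (1 - 2 * η) ^ 2 ≤ 1 := pow_le_one₀ hκ0.le hκ1
    linarith
  have hkD : k * d / (1 - 2 * η) ^ 2 = k * D := by rw [hD]; ring
  have hlδ : 0 ≤ Real.log (1 / δ) := Real.log_nonneg (by rw [le_div_iff₀ hδ0]; linarith)
  set Λ : ℝ := logFactor d η δ with hΛ
  have hΛ' : Λ = Real.log D + Real.log (1 / δ) := rfl
  have hlD : 1 ≤ Real.log D := one_le_log_three.trans (Real.log_le_log (by norm_num) hD3)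
  have hΛ1 : 1 ≤ Λ := by linarith
  set L : ℝ := Real.log (k * D) + Real.log (1 / δ) with hL
  have hlk : 0 ≤ Real.log k := Real.log_nonneg (by linarith)
  have hlk' : Real.log k ≤ 30 := log_cube_const_le
  have hlkD : Real.log (k * D) = Real.log k + Real.log D := Real.log_mul hk0.ne' (by linarith)
  have hLΛ : Λ ≤ L := by linarith
  have hLΛ' : L ≤ 31 * Λ := by linarith
  set m : ℕ := numIterations d η δ with hm
  have hm' : m = ⌈k * D * L⌉₊ := by rw [hm, numIterations, hkD]
  have hm1 : k * D * L ≤ m := by rw [hm']; exact Nat.le_ceil _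
  have hDL : 3 ≤ D * L := by
    have := mul_le_mul hD3 (show 1 ≤ L by linarith) zero_le_one (by linarith)
    linarith
  have hkDL : 1 ≤ k * D * L := by
    have := mul_le_mul_of_nonneg_left hDL hk0.le
    linarith
  have hm2 : (m : ℝ) ≤ 2 * (k * D * L) := by
    have := Nat.ceil_lt_add_one (show 0 ≤ k * D * L by linarith)
    rw [← hm'] at this
    linarith
  have hm0 : (0 : ℝ) < m := by linarith
  have hDΛ : 0 ≤ D * Λ := by positivity
  have hDL' : D * L ≤ 31 * (D * Λ) := by
    have := mul_le_mul_of_nonneg_left hLΛ' (show 0 ≤ D by linarith)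
    linarith
  have hℓ : Real.log ((m : ℝ) ^ 2 / δ) = 2 * Real.log m + Real.log (1 / δ) := by
    rw [Real.log_div (by positivity) hδ0.ne', Real.log_pow, one_div, Real.log_inv]
    push_cast
    ring
  have hlm1 : Real.log (k * D) ≤ Real.log m := by
    refine Real.log_le_log (by positivity) (le_trans ?_ hm1)
    exact le_mul_of_one_le_right (by positivity) (by linarith)
  -- From `m ≤ 2kDL`, the estimate `ln L ≤ L - 1` controls the logarithm occurring inside `m`
  -- itself.
  have hlm2 : Real.log m ≤ 2 * L := by
    have h1 : Real.log m ≤ Real.log (2 * (k * D * L)) := Real.log_le_log hm0 hm2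
    rw [Real.log_mul (by norm_num) (by linarith), Real.log_mul (by positivity) (by linarith)] at h1
    have h2 := Real.log_le_sub_one_of_pos (show 0 < L by linarith)
    have h3 := Real.log_le_sub_one_of_pos (show (0 : ℝ) < 2 by norm_num)
    linarith
  have hℓ5 : Real.log ((m : ℝ) ^ 2 / δ) ≤ 5 * L := by rw [hℓ]; linarith
  refine ⟨hΛ1, ?_, ?_, ?_, ?_, ?_, ?_⟩
  · refine le_trans ?_ hm1
    have h1 : D * Λ ≤ D * L := mul_le_mul_of_nonneg_left hLΛ (by linarith)
    have h2 := mul_le_mul_of_nonneg_right hk1 (show 0 ≤ D * L by linarith)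
    linarith
  · refine hm2.trans ?_
    have h1 : k * (D * L) ≤ 2 * 10 ^ 12 * (31 * (D * Λ)) :=
      mul_le_mul hk2 hDL' (by linarith) (by norm_num)
    linarith
  · rw [hℓ]; linarith
  · linarith
  · have h1 : D * Real.log ((m : ℝ) ^ 2 / δ) ≤ D * (5 * L) :=
      mul_le_mul_of_nonneg_left hℓ5 (by linarith)
    have h2 := mul_le_mul_of_nonneg_right hk1 (show 0 ≤ D * L by linarith)
    linarith
  · have h1 := mul_le_mul_of_nonneg_right hk1 (show 0 ≤ D * L by linarith)
    have h2 : Real.log (1 / δ) ≤ L := by linarith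
    have h3 := mul_le_mul_of_nonneg_right hD3 (show 0 ≤ L by linarith)
    linarith

variable {θ : ℝ}

lemma sq_le_of_one_sub_cos (hθ0 : 0 ≤ θ) (hθ : θ ≤ Real.pi / 2) :
    θ ^ 2 ≤ 5 * (1 - Real.cos θ) := by
  have hpi := Real.pi_pos
  have hpi' := Real.pi_lt_d2
  have h := Real.cos_le_one_sub_mul_cos_sq (x := θ) (by rw [abs_of_nonneg hθ0]; linarith)
  have h1 : 1 / 5 ≤ 2 / Real.pi ^ 2 := by
    rw [div_le_div_iff₀ (by norm_num) (by positivity)]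
    nlinarith
  nlinarith [mul_le_mul_of_nonneg_right h1 (sq_nonneg θ)]

/-- The potential at the start is at most `δ`. -/
lemma passPotential_start_le {m N : ℕ} {δ ℓ lam r ξ p₀ Φ : ℝ} (hδ0 : 0 < δ)
    (hℓ : ℓ = Real.log ((m : ℝ) ^ 2 / δ)) (hℓ1 : 1 ≤ ℓ) (hm : Real.log (1 / δ) + 5 ≤ m)
    (hlδ : 0 ≤ Real.log (1 / δ)) (hlam : lam * r ^ 2 = 16 * ℓ) (hlam0 : 0 ≤ lam)
    (hξ : 13 * ℓ ≤ m * ξ) (hξ1 : ξ ≤ 1) (hΦ : Φ ≤ r ^ 2) (hp : p₀ ≤ 1) (hN : 4 * m ≤ N * p₀) :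
    passPotential ξ lam r (1 - p₀ / 2) N m Φ ≤ δ := by
  have hm5 : (5 : ℝ) ≤ m := by linarith
  -- `λr² = 16ℓ` is chosen so that `exp(-λr²/16)` equals this value, which is small enough to be
  -- paid at each of the `m` updates.
  have hE : Real.exp (-ℓ) = δ / (m : ℝ) ^ 2 := by
    rw [Real.exp_neg, hℓ, Real.exp_log (by positivity), inv_div]
  have h1 : (1 - ξ) ^ m * Real.exp (lam * (Φ - r ^ 2 / 4)) ≤ Real.exp (-ℓ) := by
    have h2 : (1 - ξ) ^ m ≤ Real.exp (-(m * ξ)) := by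
      have h3 : 1 - ξ ≤ Real.exp (-ξ) := by linarith [Real.add_one_le_exp (-ξ)]
      calc (1 - ξ) ^ m ≤ Real.exp (-ξ) ^ m := pow_le_pow_left₀ (by linarith) h3 m
        _ = Real.exp (-(m * ξ)) := by rw [← Real.exp_nat_mul]; ring_nf
    -- The start has `Φ ≤ r²`, so the exponent is at most `λ · 3r²/4 = 12ℓ`. The total gain `mξ ≥
    -- 13ℓ` beats this by `ℓ`.
    have h4 : lam * (Φ - r ^ 2 / 4) ≤ 12 * ℓ := by nlinarith
    calc (1 - ξ) ^ m * Real.exp (lam * (Φ - r ^ 2 / 4))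
        ≤ Real.exp (-(m * ξ)) * Real.exp (12 * ℓ) := by gcongr
      _ = Real.exp (-(m * ξ) + 12 * ℓ) := (Real.exp_add _ _).symm
      _ ≤ Real.exp (-ℓ) := Real.exp_le_exp.2 (by linarith)
  have h2 : Real.exp (-(lam * r ^ 2 / 16)) = Real.exp (-ℓ) := by rw [hlam]; ring_nf
  have h3 : Real.exp (lam * (Φ - 3 * r ^ 2 / 2)) ≤ Real.exp (-ℓ) := by
    refine Real.exp_le_exp.2 ?_
    nlinarith
  have h4 : (Real.exp m - 1) * (1 - p₀ / 2) ^ N ≤ δ / 2 := by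
    have h5 : (1 - p₀ / 2) ^ N ≤ Real.exp (-(2 * m)) := by
      have h6 : 1 - p₀ / 2 ≤ Real.exp (-(p₀ / 2)) := by linarith [Real.add_one_le_exp (-(p₀ / 2))]
      calc (1 - p₀ / 2) ^ N ≤ Real.exp (-(p₀ / 2)) ^ N := pow_le_pow_left₀ (by linarith) h6 N
        _ = Real.exp (N * (-(p₀ / 2))) := by rw [← Real.exp_nat_mul]
        _ ≤ Real.exp (-(2 * m)) := Real.exp_le_exp.2 (by linarith)
    have h7 : Real.exp (-(m : ℝ)) ≤ δ / 2 := by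
      have h8 : -(m : ℝ) ≤ Real.log (δ / 2) := by
        rw [Real.log_div hδ0.ne' (by norm_num)]
        rw [one_div, Real.log_inv] at hm
        have := Real.log_le_sub_one_of_pos (show (0 : ℝ) < 2 by norm_num)
        linarith
      calc Real.exp (-(m : ℝ)) ≤ Real.exp (Real.log (δ / 2)) := Real.exp_le_exp.2 h8
        _ = δ / 2 := Real.exp_log (by positivity)
    calc (Real.exp m - 1) * (1 - p₀ / 2) ^ N ≤ Real.exp m * Real.exp (-(2 * m)) :=
          mul_le_mul (by linarith) h5 (pow_nonneg (by linarith) N) (Real.exp_pos _).le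
      _ = Real.exp (-m) := by rw [← Real.exp_add]; ring_nf
      _ ≤ _ := h7
  -- The middle summand contributes `2m` copies of `exp(-ℓ)`, the first and the last at most one
  -- each.
  have h5 : (2 * m + 2) * Real.exp (-ℓ) ≤ δ / 2 := by
    rw [hE, ← mul_div_assoc, div_le_iff₀ (by positivity)]
    have h6 : 4 * (m : ℝ) + 4 ≤ (m : ℝ) ^ 2 := by nlinarith
    have h7 := mul_le_mul_of_nonneg_left h6 hδ0.le
    linarith
  unfold passPotential updatePotential
  rw [h2]
  linarith

/-- The logarithm in `λ` cancels the one in the denominator of `b`, so the gain `ξ` is free of it.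
The scale `r = √(1 - cos θ)` is comparable to `θ`: `r ≤ θ ≤ 9r/4`. The first inequality yields the
lower bound on `ξ`, and the second the smallness of `b` and `λbr`. -/
lemma goodParams_bandWidth {m : ℕ} (hd : 3 ≤ d) (hη0 : 0 ≤ η) (hη : η < 1 / 2) (hθ0 : 0 < θ)
    (hθ : θ ≤ Real.pi / 2) (hℓ1 : 1 ≤ Real.log ((m : ℝ) ^ 2 / δ)) :
    GoodParams d η (bandWidth d η δ θ m) (16 * Real.log ((m : ℝ) ^ 2 / δ) / (1 - Real.cos θ))
        (√(1 - Real.cos θ))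
        (θ * (1 - 2 * η) ^ 2 / (2 * (2 * (600 * Real.pi) ^ 2) * d * √(1 - Real.cos θ))) ∧
      1 / (2 * (2 * (600 * Real.pi) ^ 2) * (d / (1 - 2 * η) ^ 2)) ≤
        θ * (1 - 2 * η) ^ 2 / (2 * (2 * (600 * Real.pi) ^ 2) * d * √(1 - Real.cos θ)) := by
  have hκ0 : 0 < 1 - 2 * η := by linarith
  have hdR : (3 : ℝ) ≤ d := by exact_mod_cast hd
  have hq : 0 < √(d : ℝ) := Real.sqrt_pos.2 (by linarith)
  have hqq : √(d : ℝ) ^ 2 = d := Real.sq_sqrt (by linarith)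
  obtain ⟨hB1, hB2⟩ := width_const_bounds
  have hsq := sq_le_of_one_sub_cos hθ0.le hθ
  have hcos : Real.cos θ < 1 := by nlinarith
  have hcos0 : 0 ≤ Real.cos θ := Real.cos_nonneg_of_mem_Icc ⟨by linarith, hθ⟩
  have hlow := Real.one_sub_sq_div_two_le_cos (x := θ)
  unfold bandWidth
  set B : ℝ := 2 * (600 * Real.pi) ^ 2 with hB
  set ℓ : ℝ := Real.log ((m : ℝ) ^ 2 / δ) with hℓ
  set r : ℝ := √(1 - Real.cos θ) with hr
  have hr0 : 0 < r := Real.sqrt_pos.2 (by linarith)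
  have hrr : r ^ 2 = 1 - Real.cos θ := Real.sq_sqrt (by linarith)
  have hB0 : 0 < B := by linarith
  have hℓ0 : 0 < ℓ := by linarith
  have hθr : θ ≤ 9 / 4 * r := by
    rw [← pow_le_pow_iff_left₀ hθ0.le (by positivity) two_ne_zero, mul_pow, hrr]
    nlinarith
  have hrθ : r ≤ θ := by
    rw [← pow_le_pow_iff_left₀ hr0.le hθ0.le two_ne_zero, hrr]
    nlinarith
  rw [← hrr]
  refine ⟨⟨by omega, hη0, hη, by positivity, hr0, ?_, by positivity, ?_, ?_, ?_⟩, ?_⟩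
  · rw [← pow_le_one_iff_of_nonneg hr0.le two_ne_zero, hrr]
    linarith
  · have h1 : 1 / (B * ℓ) * (θ * (1 - 2 * η) / √d) = (θ / (B * ℓ)) * ((1 - 2 * η) / √d) := by
      field_simp
    have h2 : (1 - 2 * η) * r / (1000000 * √d) = (r / 1000000) * ((1 - 2 * η) / √d) := by
      field_simp
    rw [h1, h2]
    refine mul_le_mul_of_nonneg_right ?_ (by positivity)
    rw [div_le_div_iff₀ (by positivity) (by norm_num)]
    have h3 : 7000000 * 1 ≤ B * ℓ := mul_le_mul hB1 hℓ1 zero_le_one hB0.le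
    nlinarith
  · have h1 : 16 * ℓ / r ^ 2 * (1 / (B * ℓ) * (θ * (1 - 2 * η) / √d)) * r =
        (16 * θ / (B * r)) * ((1 - 2 * η) / √d) := by
      field_simp
    have h2 : (1 - 2 * η) / (10000 * √d) = (1 / 10000) * ((1 - 2 * η) / √d) := by
      field_simp
    rw [h1, h2]
    refine mul_le_mul_of_nonneg_right ?_ (by positivity)
    rw [div_le_div_iff₀ (by positivity) (by norm_num)]
    nlinarith [mul_le_mul_of_nonneg_right hB1 hr0.le]
  · have h1 : 16 * ℓ / r ^ 2 * (1 / (B * ℓ) * (θ * (1 - 2 * η) / √d)) * r * (1 - 2 * η) /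
        (32 * √d) = θ * (1 - 2 * η) ^ 2 / (2 * B * √d ^ 2 * r) := by
      field_simp
      norm_num
    rw [h1, hqq]
  · have h1 : 1 / (2 * B * (d / (1 - 2 * η) ^ 2)) = r * (1 - 2 * η) ^ 2 / (2 * B * d * r) := by
      field_simp
    rw [h1]
    gcongr

lemma bandWidth_mul_sqrt {m : ℕ} (hd : 3 ≤ d) :
    bandWidth d η δ θ m * √d =
      θ * (1 - 2 * η) / (2 * (600 * Real.pi) ^ 2 * Real.log ((m : ℝ) ^ 2 / δ)) := by
  have hq : 0 < √(d : ℝ) := Real.sqrt_pos.2 (by exact_mod_cast (by omega : 0 < d))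
  unfold bandWidth
  field_simp

end Parameters

/-! ### The probabilistic guarantee and the resource bounds -/

section Guarantee

variable {d : ℕ} {η δ θ : ℝ}

lemma inner_eq_cos_angle (w u : Sph d) :
    inner ℝ (w : EuclideanSpace ℝ (Fin d)) (u : EuclideanSpace ℝ (Fin d)) =
      Real.cos (InnerProductGeometry.angle (w : EuclideanSpace ℝ (Fin d))
        (u : EuclideanSpace ℝ (Fin d))) := by
  rw [InnerProductGeometry.cos_angle, norm_coe_sphere, norm_coe_sphere, mul_one, div_one]

/-- With `c = cos(θ/2)`, `(1 - cos θ)/4 = (1 - c)(1 + c)/2 ≤ 1 - c`. -/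
lemma angle_le_half {w u : Sph d} (hθ0 : 0 ≤ θ) (hθ : θ ≤ Real.pi / 2)
    (h : 1 - inner ℝ (w : EuclideanSpace ℝ (Fin d)) (u : EuclideanSpace ℝ (Fin d)) ≤
      (1 - Real.cos θ) / 4) :
    InnerProductGeometry.angle (w : EuclideanSpace ℝ (Fin d)) (u : EuclideanSpace ℝ (Fin d))
      ≤ θ / 2 := by
  have hpi := Real.pi_pos
  rw [← Real.strictAntiOn_cos.le_iff_ge ⟨by linarith, by linarith⟩
    ⟨InnerProductGeometry.angle_nonneg _ _, InnerProductGeometry.angle_le_pi _ _⟩,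
    ← inner_eq_cos_angle]
  have h1 : Real.cos θ = 2 * Real.cos (θ / 2) ^ 2 - 1 := by
    rw [← Real.cos_two_mul]; congr 1; ring
  have h2 := Real.cos_le_one (θ / 2)
  nlinarith

/-- `ln(m²/δ)` lies between `ln(m/δ)` and twice that, so only the numerical constant in `b` matters.
-/
lemma bandWidth_theta {m : ℕ} (hd : 3 ≤ d) (hη : η < 1 / 2) (hδ0 : 0 < δ) (hδ : δ < 1)
    (hθ0 : 0 < θ) (hm : 5 ≤ (m : ℝ)) :
    bandWidth d η δ θ m ≤ θ * (1 - 2 * η) / (√d * Real.log (m / δ)) ∧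
      θ * (1 - 2 * η) / (√d * Real.log (m / δ)) ≤ 10 ^ 8 * bandWidth d η δ θ m := by
  have hκ0 : 0 < 1 - 2 * η := by linarith
  have hq : 0 < √(d : ℝ) := Real.sqrt_pos.2 (by exact_mod_cast (by omega : 0 < d))
  obtain ⟨hB1, hB2⟩ := width_const_bounds
  unfold bandWidth
  set B : ℝ := 2 * (600 * Real.pi) ^ 2 with hB
  set ℓ : ℝ := Real.log ((m : ℝ) ^ 2 / δ) with hℓ
  set M : ℝ := Real.log ((m : ℝ) / δ) with hM
  have hm0 : (0 : ℝ) < m := by linarith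
  have hlm : 0 < Real.log m := Real.log_pos (by linarith)
  have hlδ : 0 < -Real.log δ := by linarith [Real.log_neg hδ0 hδ]
  have hℓ' : ℓ = 2 * Real.log m - Real.log δ := by
    rw [hℓ, Real.log_div (by positivity) hδ0.ne', Real.log_pow]; push_cast; ring
  have hM' : M = Real.log m - Real.log δ := Real.log_div hm0.ne' hδ0.ne'
  have hM0 : 0 < M := by linarith
  have hB0 : 0 < B := by linarith
  have hℓ0 : 0 < ℓ := by linarith
  have e1 : 1 / (B * ℓ) * (θ * (1 - 2 * η) / √d) = θ * (1 - 2 * η) / √d / (B * ℓ) := by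
    field_simp
  have e2 : θ * (1 - 2 * η) / (√d * M) = θ * (1 - 2 * η) / √d / M := by field_simp
  have hX : 0 < θ * (1 - 2 * η) / √d := by positivity
  rw [e1, e2]
  set X : ℝ := θ * (1 - 2 * η) / √d
  constructor
  · refine div_le_div_of_nonneg_left hX.le hM0 ?_
    nlinarith
  · rw [← mul_div_assoc, div_le_div_iff₀ hM0 (by positivity)]
    have h1 : B * ℓ ≤ 8000000 * (2 * M) := mul_le_mul hB2 (by linarith) hℓ0.le (by norm_num)
    have h2 := mul_le_mul_of_nonneg_left h1 hX.le
    have h3 := mul_pos hX hM0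
    linarith

/-- The number of passes that suffices with high probability. -/
noncomputable def passBudget (d m : ℕ) (b : ℝ) : ℕ := ⌈4 * m / (b * √d / 5000)⌉₊

lemma passBudget_le {m : ℕ} (hd : 3 ≤ d) (hη0 : 0 ≤ η) (hη : η < 1 / 2) (hθ0 : 0 < θ)
    (hθ : θ ≤ Real.pi / 2) (hb : IterationBounds d η δ m) (hm5 : 5 ≤ (m : ℝ)) :
    (passBudget d m (bandWidth d η δ θ m) : ℝ) ≤
      10 ^ 29 * (d / (1 - 2 * η) ^ 3 * logFactor d η δ ^ 2 * (1 / θ)) := by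
  have hκ0 : 0 < 1 - 2 * η := by linarith
  have hκ1 : 1 - 2 * η ≤ 1 := by linarith
  have hpi := Real.pi_lt_d2
  have hdR : (3 : ℝ) ≤ d := by exact_mod_cast hd
  obtain ⟨hB1, hB2⟩ := width_const_bounds
  have hℓ1 := hb.one_le_log
  unfold passBudget
  rw [bandWidth_mul_sqrt hd]
  set B : ℝ := 2 * (600 * Real.pi) ^ 2 with hB
  set ℓ : ℝ := Real.log ((m : ℝ) ^ 2 / δ) with hℓ
  set Λ : ℝ := logFactor d η δ with hΛ
  have hB0 : 0 < B := by linarith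
  have hℓ0 : 0 < ℓ := by linarith
  have e1 : 4 * (m : ℝ) / (θ * (1 - 2 * η) / (B * ℓ) / 5000) =
      20000 * (m * (B * ℓ)) / (θ * (1 - 2 * η)) := by
    field_simp
    norm_num
  rw [e1]
  have hθκ : 0 < θ * (1 - 2 * η) := by positivity
  have hθκ2 : θ * (1 - 2 * η) ≤ 2 := by nlinarith
  have hmB : 35000000 ≤ m * (B * ℓ) := by
    have h1 : 7000000 * 1 ≤ B * ℓ := mul_le_mul hB1 hℓ1 zero_le_one hB0.le
    have h2 := mul_le_mul hm5 h1 (by norm_num) (by linarith)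
    linarith
  have hceil := (Nat.ceil_lt_add_one
    (show 0 ≤ 20000 * (m * (B * ℓ)) / (θ * (1 - 2 * η)) by positivity)).le
  refine hceil.trans ?_
  -- This absorbs the `+1` from the ceiling into the main term.
  have h1 : (1 : ℝ) ≤ m * (B * ℓ) / (θ * (1 - 2 * η)) := by
    rw [le_div_iff₀ hθκ]; linarith
  have hΛ0 : 0 < Λ := by linarith [hb.one_le_logFactor]
  have h2 : m * (B * ℓ) ≤ 10 ^ 15 * (d / (1 - 2 * η) ^ 2 * Λ) * (8000000 * (155 * Λ)) :=
    mul_le_mul hb.iterations_le (mul_le_mul hB2 hb.log_le hℓ0.le (by norm_num)) (by positivity)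
      (by positivity)
  have h3 : m * (B * ℓ) / (θ * (1 - 2 * η)) ≤
      10 ^ 15 * (d / (1 - 2 * η) ^ 2 * Λ) * (8000000 * (155 * Λ)) / (θ * (1 - 2 * η)) := by
    gcongr
  have e3 : 10 ^ 15 * (d / (1 - 2 * η) ^ 2 * Λ) * (8000000 * (155 * Λ)) / (θ * (1 - 2 * η)) =
      10 ^ 15 * 8000000 * 155 * (d / (1 - 2 * η) ^ 3 * Λ ^ 2 * (1 / θ)) := by
    field_simp
  rw [e3] at h3
  have h4 : 0 < d / (1 - 2 * η) ^ 3 * Λ ^ 2 * (1 / θ) := by positivity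
  rw [mul_div_assoc]
  linarith

lemma success_probability_ge {m : ℕ} {Ω : Type*} [MeasurableSpace Ω] {P : Measure Ω}
    [IsProbabilityMeasure P] {Z : ℕ → Ω → Sph d × Label} {O : Kernel (Sph d) Label}
    [IsMarkovKernel O] {u w₀ : Sph d} (hd : 3 ≤ d) (hη0 : 0 ≤ η) (hη : η < 1 / 2) (hδ0 : 0 < δ)
    (hδ : δ < 1) (hθ0 : 0 < θ) (hθ : θ ≤ Real.pi / 2) (hO : BoundedNoise O u η)
    (hangle : InnerProductGeometry.angle (w₀ : EuclideanSpace ℝ (Fin d))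
      (u : EuclideanSpace ℝ (Fin d)) ≤ θ) (hb : IterationBounds d η δ m)
    (hZ : ∀ i, Measurable (Z i)) (hind : iIndepFun Z P) (hlaw : ∀ i, P.map (Z i) = dataLaw O) :
    ENNReal.ofReal (1 - δ) ≤ P {ω |
      (chain m (bandWidth d η δ θ m) w₀ (fun i => Z i ω)
        (passBudget d m (bandWidth d η δ θ m))).1 = m ∧
      InnerProductGeometry.angle ((chain m (bandWidth d η δ θ m) w₀ (fun i => Z i ω)
        (passBudget d m (bandWidth d η δ θ m))).2 : EuclideanSpace ℝ (Fin d))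
        (u : EuclideanSpace ℝ (Fin d)) ≤ θ / 2} := by
  obtain ⟨hgood, hξ⟩ := goodParams_bandWidth (d := d) (η := η) (δ := δ) (θ := θ) (m := m)
    hd hη0 hη hθ0 hθ hb.one_le_log
  set b : ℝ := bandWidth d η δ θ m with hbd
  set ℓ : ℝ := Real.log ((m : ℝ) ^ 2 / δ) with hℓ
  set r : ℝ := √(1 - Real.cos θ) with hr
  set ξ : ℝ := θ * (1 - 2 * η) ^ 2 / (2 * (2 * (600 * Real.pi) ^ 2) * d * r) with hξd
  have hsq := sq_le_of_one_sub_cos hθ0.le hθ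
  have hcos : Real.cos θ < 1 := by nlinarith
  have hrr : r ^ 2 = 1 - Real.cos θ := Real.sq_sqrt (by linarith)
  have hκ0 : 0 < 1 - 2 * η := by linarith
  have hκ1 : 1 - 2 * η ≤ 1 := by linarith
  have hd0 : (0 : ℝ) < d := by exact_mod_cast (by omega : 0 < d)
  have hpi := Real.pi_lt_d2
  obtain ⟨hB1, hB2⟩ := width_const_bounds
  have hℓ1 : 1 ≤ ℓ := hb.one_le_log
  have hlδ : 0 ≤ Real.log (1 / δ) := Real.log_nonneg (by rw [le_div_iff₀ hδ0]; linarith)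
  have hbq : b * √d ≤ 1 / 2 := by
    rw [hbd, bandWidth_mul_sqrt hd, ← hℓ, div_le_iff₀ (by positivity)]
    have h1 : 7000000 * 1 ≤ 2 * (600 * Real.pi) ^ 2 * ℓ :=
      mul_le_mul hB1 hℓ1 zero_le_one (by positivity)
    have h2 : θ * (1 - 2 * η) ≤ θ := mul_le_of_le_one_right hθ0.le hκ1
    linarith
  have hb0 := hgood.width_pos
  have hbq0 : 0 < b * √d := mul_pos hb0 (Real.sqrt_pos.2 hd0)
  have hpos : 0 < b * √d / 5000 := by positivity
  -- The factor `4` makes `(1 - p₀/2)ᴺ ≤ exp(-2m)`, which beats the initial weight `exp m` of the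
  -- missing updates.
  have hN : 4 * (m : ℝ) ≤ passBudget d m b * (b * √d / 5000) := by
    rw [← div_le_iff₀ hpos]
    exact Nat.le_ceil _
  have hgain : 13 * ℓ ≤ m * ξ := by
    set B : ℝ := 2 * (600 * Real.pi) ^ 2 with hB
    set D : ℝ := d / (1 - 2 * η) ^ 2 with hD
    have hD0 : 0 < D := by positivity
    have hB0 : 0 < B := by linarith
    have h1 : m * (1 / (2 * B * D)) ≤ m * ξ :=
      mul_le_mul_of_nonneg_left hξ (Nat.cast_nonneg m)
    refine le_trans ?_ h1
    rw [mul_one_div, le_div_iff₀ (by positivity)]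
    have h2 := hb.mul_log_le
    have h3 : B * (D * ℓ) ≤ 8000000 * (D * ℓ) := mul_le_mul_of_nonneg_right hB2 (by positivity)
    have h4 : 0 ≤ D * ℓ := by positivity
    calc 13 * ℓ * (2 * B * D) = 26 * (B * (D * ℓ)) := by ring
      _ ≤ 10 ^ 11 * (D * ℓ) := by linarith
      _ ≤ m := h2
  have hΦ : 1 - inner ℝ (w₀ : EuclideanSpace ℝ (Fin d)) (u : EuclideanSpace ℝ (Fin d)) ≤ r ^ 2 := by
    rw [hrr, inner_eq_cos_angle]
    have := Real.cos_le_cos_of_nonneg_of_le_pi (InnerProductGeometry.angle_nonneg _ _)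
      (by linarith [Real.pi_pos]) hangle
    linarith
  have hpot := passPotential_start_le (r := r) (lam := 16 * ℓ / (1 - Real.cos θ)) hδ0 hℓ hℓ1
    hb.log_inv_le hlδ (by rw [hrr]; exact div_mul_cancel₀ _ (by linarith)) hgood.rate_nonneg hgain
    hgood.gain_le_one hΦ (show b * √d / 5000 ≤ 1 by linarith) hN
  have hmain := measure_success_ge (m := m) hgood hO hpos.le (by linarith)
    (fun w => integral_band_ge (by omega) hb0 hbq (norm_coe_sphere w)) hZ hind hlaw w₀
    (passBudget d m b) hδ0.le hpot
  refine hmain.trans (measure_mono fun ω hω => ⟨hω.1, angle_le_half hθ0.le hθ ?_⟩)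
  rw [← hrr]
  exact hω.2

end Guarantee

end HalfspaceLearning

theorem mainTheorem4 :
    ∃ C : ℝ, 0 < C ∧
      ∀ (d : ℕ) (η δ θ : ℝ) (u w₀ : Sph d) (O : Kernel (Sph d) Label),
        3 ≤ d → 0 ≤ η → η < 1 / 2 → 0 < δ → δ < 1 → 0 < θ → θ ≤ Real.pi / 2 →
        IsMarkovKernel O → BoundedNoise O u η →
        InnerProductGeometry.angle
          (w₀ : EuclideanSpace ℝ (Fin d)) (u : EuclideanSpace ℝ (Fin d)) ≤ θ →
        ∀ (m : ℕ) (b : ℝ), m = numIterations d η δ → b = bandWidth d η δ θ m →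
          -- `m = Θ(d/(1-2η)² · (ln (d/(1-2η)²) + ln (1/δ)))`
          C⁻¹ * (d / (1 - 2 * η) ^ 2 * logFactor d η δ) ≤ m ∧
          m ≤ C * (d / (1 - 2 * η) ^ 2 * logFactor d η δ) ∧
          -- `b = Θ(θ (1-2η) / (√d ln (m/δ)))`
          C⁻¹ * (θ * (1 - 2 * η) / (√d * Real.log (m / δ))) ≤ b ∧
          b ≤ C * (θ * (1 - 2 * η) / (√d * Real.log (m / δ))) ∧
          -- the guarantee, for i.i.d. labeled examples `Z 0, Z 1, …`
          ∀ (Ω : Type*) [MeasurableSpace Ω] (P : Measure Ω) [IsProbabilityMeasure P]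
            (Z : ℕ → Ω → Sph d × Label),
            (∀ i, Measurable (Z i)) → iIndepFun Z P → (∀ i, P.map (Z i) = dataLaw O) →
            ENNReal.ofReal (1 - δ) ≤
              P {ω | ∃ (w : EuclideanSpace ℝ (Fin d)) (L : Ledger),
                Outputs w₀ m b (fun i => Z i ω) w L ∧
                ‖w‖ = 1 ∧
                InnerProductGeometry.angle w (u : EuclideanSpace ℝ (Fin d)) ≤ θ / 2 ∧
                (L.labels : ℝ) ≤ C * (d / (1 - 2 * η) ^ 2 * logFactor d η δ) ∧
                (L.draws : ℝ) ≤
                  C * (d / (1 - 2 * η) ^ 3 * logFactor d η δ ^ 2 * (1 / θ)) ∧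
                (L.time : ℝ) ≤
                  C * (d ^ 2 / (1 - 2 * η) ^ 3 * logFactor d η δ ^ 2 * (1 / θ))} := by
  refine ⟨10 ^ 31, by norm_num, ?_⟩
  intro d η δ θ u w₀ O hd hη0 hη hδ0 hδ hθ0 hθ hMarkov hO hangle m b hm hb
  have hbounds : IterationBounds d η δ m := hm ▸ iterationBounds hd hη0 hη hδ0 hδ
  have hm5 : (5 : ℝ) ≤ m := by
    have h1 := hbounds.log_inv_le
    have : 0 ≤ Real.log (1 / δ) := Real.log_nonneg (by rw [le_div_iff₀ hδ0]; linarith)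
    linarith
  have hκ0 : 0 < 1 - 2 * η := by linarith
  have hd0 : (3 : ℝ) ≤ d := by exact_mod_cast hd
  have hΛ1 := hbounds.one_le_logFactor
  obtain ⟨hb1, hb2⟩ := bandWidth_theta (m := m) hd hη hδ0 hδ hθ0 hm5
  rw [← hb] at hb1 hb2
  have hb0 : 0 < b := by
    rw [hb]
    exact (goodParams_bandWidth hd hη0 hη hθ0 hθ hbounds.one_le_log).1.width_pos
  have hDΛ : 0 ≤ d / (1 - 2 * η) ^ 2 * logFactor d η δ := by positivity
  have hlabels : (m : ℝ) ≤ 10 ^ 31 * (d / (1 - 2 * η) ^ 2 * logFactor d η δ) :=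
    hbounds.iterations_le.trans (mul_le_mul_of_nonneg_right (by norm_num) hDΛ)
  refine ⟨?_, hlabels, ?_, ?_, ?_⟩
  · refine le_trans ?_ hbounds.le_iterations
    exact mul_le_of_le_one_left hDΛ (by norm_num)
  · rw [inv_mul_le_iff₀ (by norm_num)]
    linarith
  · linarith
  · intro Ω _ P _ Z hZ hind hlaw
    have hprob := success_probability_ge (m := m) hd hη0 hη hδ0 hδ hθ0 hθ hO hangle hbounds hZ
      hind hlaw
    have hbudget := passBudget_le hd hη0 hη hθ0 hθ hbounds hm5
    rw [← hb] at hprob hbudget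
    -- All resource bounds are deterministic once the chain has finished within the budget, so no
    -- further probability is lost.
    refine hprob.trans (measure_mono fun ω hω => ?_)
    obtain ⟨L, hout, hL1, hL2, hL3⟩ := outputs_of_chain hb0 w₀ (fun i => Z i ω) _ hω.1
    have hK : 0 < d / (1 - 2 * η) ^ 3 * logFactor d η δ ^ 2 * (1 / θ) := by positivity
    have hL2' : (L.draws : ℝ) ≤ passBudget d m b := by exact_mod_cast hL2
    have hL3' : (L.time : ℝ) ≤ 1 + passBudget d m b * (12 * d + 9) := by exact_mod_cast hL3
    refine ⟨_, L, hout, norm_coe_sphere _, hω.2, by rw [hL1]; exact hlabels, by linarith, ?_⟩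
    have hK1 : 1 ≤ d / (1 - 2 * η) ^ 3 * logFactor d η δ ^ 2 * (1 / θ) := by
      have h1 : (1 - 2 * η) ^ 3 ≤ 1 := pow_le_one₀ hκ0.le (by linarith)
      have h2 : (3 : ℝ) ≤ d / (1 - 2 * η) ^ 3 := by
        rw [le_div_iff₀ (by positivity)]; linarith
      have h3 : 1 ≤ logFactor d η δ ^ 2 := one_le_pow₀ hΛ1
      have h4 : 1 / 2 ≤ 1 / θ := by
        have := Real.pi_lt_d2
        exact one_div_le_one_div_of_le hθ0 (by linarith)
      have h5 : (3 : ℝ) * 1 * (1 / 2) ≤ d / (1 - 2 * η) ^ 3 * logFactor d η δ ^ 2 * (1 / θ) := by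
        gcongr
      linarith
    have e : (d : ℝ) ^ 2 / (1 - 2 * η) ^ 3 * logFactor d η δ ^ 2 * (1 / θ) =
        d * (d / (1 - 2 * η) ^ 3 * logFactor d η δ ^ 2 * (1 / θ)) := by ring
    rw [e]
    set K : ℝ := d / (1 - 2 * η) ^ 3 * logFactor d η δ ^ 2 * (1 / θ)
    -- `12d + 9 ≤ 15d` since `d ≥ 3`. The resulting `15 · 10²⁹`, plus one unit for the initial test,
    -- is what `10³¹` has to cover.
    have h1 : (passBudget d m b : ℝ) * (12 * d + 9) ≤ 10 ^ 29 * K * (15 * d) :=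
      mul_le_mul hbudget (by linarith) (by positivity) (by positivity)
    have h2 : 1 ≤ d * K := by nlinarith
    linarith
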